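/- Let $\Sigma$ be a complete smooth fan in $N_{\mathbb R}$, $N=\mathbb Z^n$, whose toric manifold $Y$ is projective, let $\rho_1,\dots,\rho_d$ be the primitive generators of its rays, and let $s:\mathbb Z^d\to N$ send the $i$-th basis vector to $\rho_i$, so that $\ker s=A_1(Y,\mathbb Z)$. Let $P\subset A_1(Y,\mathbb Z)$ be the monoid of integral points of the cone $\overline{NE}(Y)$ of effective curves (the dual of the nef cone), let $\tilde\varphi:N\to\mathbb Z^d$ be the $\Sigma$-piecewise linear function with $\tilde\varphi(\rho_i)=$ the $i$-th basis vector, and let $P_\varphi=\{\tilde\varphi(m)+p : m\in N,\ p\in P\}\subset\mathbb Z^d$ (after a splitting $\mathbb Z^d\cong N\oplus A_1(Y,\mathbb Z)$ with projection $\pi$ to $A_1(Y,\mathbb Z)$ this is $\{(m,\varphi(m)+p)\}$ with $\varphi=\pi\circ\tilde\varphi$). Write $z_i$ for the monomial of the $i$-th basis vector. Let $\sigma_1,\dots,\sigma_\mu$ be an ordering of the $n$-dimensional cones of $\Sigma$ such that, with $\tau_i$ the intersection of $\sigma_i$ with all $\sigma_j$, $j>i$, for which $\dim(\sigma_i\cap\sigma_j)=n-1$,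 the inclusion $\tau_i\subset\sigma_j$ implies $i\le j$. Let $\varphi_i=\prod_{\rho_r\in\tau_i}z_r$ and $\deg\varphi_i=2\dim\tau_i$. Take one variable $t_i$ for each $i$ with $\deg\varphi_i\ne2$, and put $\mathscr R=\mathbb C[P]\otimes\mathbb C[t]$, $\mathscr S=\operatorname{Spec}\mathscr R$, $\mathcal I=$ the ideal of $\mathscr R$ generated by the $z^p$ ($0\ne p\in P$) and the $t_i$, $\mathscr R_k=\mathscr R/\mathcal I^{k+1}$, $\mathscr S_k=\operatorname{Spec}\mathscr R_k$. Let $\mathscr X$ be the analytic space $\operatorname{Spec}(\mathbb C[P_\varphi])\times\operatorname{Spec}\mathbb C[t]$ over $\mathscr S$, $\mathscr X_k=\mathscr X\times_{\mathscr S}\mathscr S_k$, with the log structures given by $P_\varphi$ and $P$, and let $F=\sum_{i=1}^d z_i+\sum_{\deg\varphi_i\neq2}t_i\varphi_i$. Let $\Omega^\bullet_{\mathscr X_k^\dagger/\mathscr S_k^\dagger}=\mathcal O_{\mathscr X_k}\otimes\bigwedge^\bullet N$ be the relative log differential forms, where $d\log z^v$ corresponds to $s(v)\in N$; let $\partial$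 be the relative de Rham differential, and let $\Omega=d\log z^{e_1}\wedge\dots\wedge d\log z^{e_n}$ be the generator of $\bigwedge^nN$ given by the standard basis $e_1,\dots,e_n$ of $N$. Since $\mathscr X_k$ is Stein, the hypercohomology of the twisted de Rham complex is the cohomology of its global sections: $$\mathcal H^F_k=H\bigl(\Gamma(\mathscr X_k,\Omega^\bullet_{\mathscr X_k^\dagger/\mathscr S_k^\dagger})[[u]],\ dF\wedge+u\,\partial\bigr).$$ Assign the weights $\deg z^v=2\sum_i v_i$, $\deg t_i=2-\deg\varphi_i$, $\deg u=2$, and let a wedge of $p$ of the constant forms $d\log$ have weight $2(n-p)$ (so that weights agree with those of polyvector fields under contraction with $\Omega$); the differential then preserves weights, and a class in $\mathcal H^F_k$ is said to have weight $w$ if it is represented by a cocycle of weight $w$. Then for every $k\ge0$ the $\mathscr R_k[[u]]$-module $\mathcal H^F_k$ is graded free, with homogeneous basis the classes $[\varphi_1\Omega],\dots,[\varphi_\mu\Omega]$. That is, these classes form an $\mathscr R_k[[u]]$-basis of $\mathcal H^F_k$, and for all $w\in\mathbb Z$ a class $\sum_i r_i[\varphi_i\Omega]$ has weight $w$ if and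 only if each $r_i\in\mathscr R_k[[u]]$ has weight $w-\deg\varphi_i$. -/

import Mathlib

open scoped TensorProduct

noncomputable section

namespace LogLG

/-- A complete smooth fan in `N_ℝ`, `N = ℤⁿ`. The rays are indexed by `ι`, `ray i` is the primitive
generator of the `i`-th ray, and a cone of the fan is recorded by the set of its rays. -/
structure SmoothCompleteFan (n : ℕ) (ι : Type) [Fintype ι] [DecidableEq ι] where
  /-- the primitive generators of the rays -/
  ray : ι → Fin n → ℤ
  /-- the cones, each given by its set of rays -/
  cones : Set (Finset ι)
  empty_mem : ∅ ∈ cones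
  singleton_mem : ∀ i, {i} ∈ cones
  face_mem : ∀ σ ∈ cones, ∀ τ ⊆ σ, τ ∈ cones
  /-- the generators of each cone are part of a basis of the lattice -/
  smooth : ∀ σ ∈ cones, ∃ (b : Module.Basis (Fin n) ℤ (Fin n → ℤ)) (e : σ → Fin n),
    Function.Injective e ∧ ∀ i : σ, ray i = b (e i)
  /-- two cones of `N_ℝ` meet in the cone spanned by their common rays -/
  inter : ∀ σ ∈ cones, ∀ τ ∈ cones, ∀ x : Fin n → ℝ,
    (∃ c : ι → ℝ, (∀ i, 0 ≤ c i) ∧ (∀ i ∉ σ, c i = 0) ∧ x = ∑ i, c i • fun j => (ray i j : ℝ)) →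
    (∃ c : ι → ℝ, (∀ i, 0 ≤ c i) ∧ (∀ i ∉ τ, c i = 0) ∧ x = ∑ i, c i • fun j => (ray i j : ℝ)) →
    ∃ c : ι → ℝ, (∀ i, 0 ≤ c i) ∧ (∀ i ∉ σ ∩ τ, c i = 0) ∧
      x = ∑ i, c i • fun j => (ray i j : ℝ)
  /-- the cones cover `N_ℝ` -/
  complete : ∀ x : Fin n → ℝ, ∃ σ ∈ cones,
    ∃ c : ι → ℝ, (∀ i, 0 ≤ c i) ∧ (∀ i ∉ σ, c i = 0) ∧ x = ∑ i, c i • fun j => (ray i j : ℝ)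

variable {n : ℕ} {ι : Type} [Fintype ι] [DecidableEq ι]

namespace SmoothCompleteFan

variable (S : SmoothCompleteFan n ι)

/-- The map `s : ℤ^{Σ(1)} → N` sending the basis vector of a ray to its primitive generator. -/
def raySum : (ι → ℤ) →ₗ[ℤ] (Fin n → ℤ) := Fintype.linearCombination ℤ S.ray

lemma raySum_apply (v : ι → ℤ) (j : Fin n) : S.raySum v j = ∑ i, v i * S.ray i j := by
  simp [raySum, Fintype.linearCombination_apply]

/-- A coefficient in a cone is the value of a coordinate functional of the lattice. -/
lemma exists_coord {σ : Finset ι} (hσ : σ ∈ S.cones) : ∃ L : ι → Fin n → ℤ,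
    ∀ c : ι → ℝ, (∀ i ∉ σ, c i = 0) → ∀ i ∈ σ,
      c i = ∑ j, (L i j : ℝ) * (∑ i', c i' • fun j => (S.ray i' j : ℝ)) j := by
  obtain ⟨b, e, he, hb⟩ := S.smooth σ hσ
  refine ⟨fun i j => if h : i ∈ σ then b.coord (e ⟨i, h⟩) (Pi.single j 1) else 0, ?_⟩
  intro c hc i hi
  have key : ∀ i' ∈ σ, (∑ j, b.coord (e ⟨i, hi⟩) (Pi.single j 1) * S.ray i' j) =
      if i' = i then 1 else 0 := by
    intro i' hi'
    have h1 : S.ray i' = ∑ j, S.ray i' j • (Pi.single j 1 : Fin n → ℤ) := by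
      ext j; simp [Finset.sum_apply, Pi.single_apply]
    have h2 : b.coord (e ⟨i, hi⟩) (S.ray i') = if i' = i then 1 else 0 := by
      rw [hb ⟨i', hi'⟩, Module.Basis.coord_apply, Module.Basis.repr_self, Finsupp.single_apply]
      by_cases h : i' = i
      · subst h; simp
      · have : e ⟨i', hi'⟩ ≠ e ⟨i, hi⟩ := fun h' => h (by simpa using he h')
        simp [h, this]
    rw [← h2]
    conv_rhs => rw [h1]
    rw [map_sum]
    refine Finset.sum_congr rfl fun j _ => ?_
    rw [map_smul, smul_eq_mul, mul_comm]
  simp only [hi, dif_pos, Finset.sum_apply, Pi.smul_apply, smul_eq_mul, Finset.mul_sum]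
  rw [Finset.sum_comm]
  have : ∀ i', (∑ j, ((b.coord (e ⟨i, hi⟩) (Pi.single j 1) : ℤ) : ℝ) * (c i' * (S.ray i' j : ℝ)))
      = if i' = i then c i' else 0 := by
    intro i'
    by_cases h : i' ∈ σ
    · have := congrArg (fun z : ℤ => (z : ℝ) * c i') (key i' h)
      simp only [Int.cast_sum, Int.cast_mul, Finset.sum_mul] at this
      rw [show (if i' = i then c i' else 0) = ((if i' = i then (1 : ℤ) else 0 : ℤ) : ℝ) * c i' by
        split_ifs <;> simp, ← this]
      exact Finset.sum_congr rfl fun j _ => by ring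
    · have h' : i' ≠ i := fun h'' => h (h'' ▸ hi)
      simp [hc i' h, h']
  rw [Finset.sum_congr rfl fun i' _ => this i']
  simp

/-- Every lattice point is a combination, with natural coefficients, of the generators of a cone. -/
lemma exists_lift (m : Fin n → ℤ) : ∃ v : ι → ℤ, (∀ i, 0 ≤ v i) ∧
    (∃ σ ∈ S.cones, ∀ i ∉ σ, v i = 0) ∧ S.raySum v = m := by
  obtain ⟨σ, hσ, c, hc0, hc, hm⟩ := S.complete (fun j => (m j : ℝ))
  obtain ⟨L, hL⟩ := S.exists_coord hσ
  have hint : ∀ i, ∃ z : ℤ, c i = z := by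
    intro i
    by_cases h : i ∈ σ
    · refine ⟨∑ j, L i j * m j, ?_⟩
      rw [hL c hc i h, ← hm]
      push_cast; rfl
    · exact ⟨0, by simp [hc i h]⟩
  choose v hv using hint
  refine ⟨v, fun i => ?_, ⟨σ, hσ, fun i hi => ?_⟩, ?_⟩
  · have := hc0 i; rw [hv] at this; exact_mod_cast this
  · have := hc i hi; rw [hv] at this; exact_mod_cast this
  · ext j
    have := congrFun hm j
    simp only [Finset.sum_apply, Pi.smul_apply, smul_eq_mul, hv] at this
    rw [raySum_apply]
    exact_mod_cast this.symm

lemma lift_unique {v w : ι → ℤ} (hv : ∀ i, 0 ≤ v i) (hw : ∀ i, 0 ≤ w i)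
    (hv' : ∃ σ ∈ S.cones, ∀ i ∉ σ, v i = 0) (hw' : ∃ σ ∈ S.cones, ∀ i ∉ σ, w i = 0)
    (h : S.raySum v = S.raySum w) : v = w := by
  obtain ⟨σ, hσ, hvσ⟩ := hv'
  obtain ⟨τ, hτ, hwτ⟩ := hw'
  have cast : ∀ u : ι → ℤ, (fun j => (S.raySum u j : ℝ)) =
      ∑ i, (u i : ℝ) • fun j => (S.ray i j : ℝ) := by
    intro u; ext j; simp [raySum_apply, Finset.sum_apply]
  obtain ⟨c, -, hc, hx⟩ := S.inter σ hσ τ hτ (fun j => (S.raySum v j : ℝ))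
    ⟨fun i => v i, fun i => Int.cast_nonneg (hv i), fun i hi => by simp [hvσ i hi], cast v⟩
    ⟨fun i => w i, fun i => Int.cast_nonneg (hw i), fun i hi => by simp [hwτ i hi],
      by rw [h]; exact cast w⟩
  have aux : ∀ (ρ : Finset ι), ρ ∈ S.cones → σ ∩ τ ⊆ ρ → ∀ u : ι → ℤ, (∀ i ∉ ρ, u i = 0) →
      S.raySum u = S.raySum v → ∀ i, (u i : ℝ) = c i := by
    intro ρ hρ hsub u hu huv i
    have hcρ : ∀ i ∉ ρ, c i = 0 := fun i hi => hc i fun h' => hi (hsub h')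
    by_cases hi : i ∈ ρ
    · obtain ⟨L, hL⟩ := S.exists_coord hρ
      rw [hL (fun i => (u i : ℝ)) (fun i hi => by simp [hu i hi]) i hi, hL c hcρ i hi, ← cast u,
        ← hx, huv]
    · simp [hu i hi, hcρ i hi]
  ext i
  have h1 := aux σ hσ Finset.inter_subset_left v hvσ rfl i
  have h2 := aux τ hτ Finset.inter_subset_right w hwτ h.symm i
  exact_mod_cast h1.trans h2.symm

/-- The `ℤ^{Σ(1)}`-valued `Σ`-piecewise linear function sending each primitive generator
to the corresponding basis vector. -/
def tphi (m : Fin n → ℤ) : ι → ℤ := (S.exists_lift m).choose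

lemma raySum_tphi (m : Fin n → ℤ) : S.raySum (S.tphi m) = m := (S.exists_lift m).choose_spec.2.2

lemma tphi_raySum {v : ι → ℤ} (hv : ∀ i, 0 ≤ v i) (hv' : ∃ σ ∈ S.cones, ∀ i ∉ σ, v i = 0) :
    S.tphi (S.raySum v) = v :=
  S.lift_unique (S.exists_lift _).choose_spec.1 hv (S.exists_lift _).choose_spec.2.1 hv'
    (S.raySum_tphi _)

/-- The value at `m ∈ N` of the `Σ`-piecewise linear function that takes the value `a i` at the
generator of the `i`-th ray. -/
def plFun (a : ι → ℤ) (m : Fin n → ℤ) : ℤ := ∑ i, a i * S.tphi m i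

/-- The divisor `∑ aᵢ Dᵢ` is nef: its piecewise linear function is convex. -/
def IsNef (a : ι → ℤ) : Prop := ∀ m m', S.plFun a (m + m') ≤ S.plFun a m + S.plFun a m'

/-- The toric manifold of the fan is projective: there is an integral piecewise linear function
that is strictly convex, that is, convex and linear along no two vectors outside a common cone. -/
def IsProjective : Prop := ∃ a : ι → ℤ, S.IsNef a ∧ ∀ m m',
  S.plFun a (m + m') = S.plFun a m + S.plFun a m' →
    ∃ σ ∈ S.cones, (∀ i ∉ σ, S.tphi m i = 0) ∧ (∀ i ∉ σ, S.tphi m' i = 0)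

/-- The monoid `P` of integral points of the cone `NE(Y)` of effective curves, which is dual to
the nef cone. A curve class is identified with its intersection numbers with the toric divisors,
so that `A₁(Y, ℤ)` is the kernel of `raySum`. -/
def NE : AddSubmonoid (ι → ℤ) where
  carrier := {β | S.raySum β = 0 ∧ ∀ a, S.IsNef a → 0 ≤ ∑ i, a i * β i}
  zero_mem' := by simp
  add_mem' := by
    rintro β γ ⟨h1, h2⟩ ⟨h3, h4⟩
    refine ⟨by simp [h1, h3], fun a ha => ?_⟩
    simp only [Pi.add_apply, mul_add, Finset.sum_add_distrib]
    exact add_nonneg (h2 a ha) (h4 a ha)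

/-- The monoid `P_φ`. A splitting `π` of `0 → A₁(Y, ℤ) → ℤ^{Σ(1)} → N → 0` identifies
`ℤ^{Σ(1)}` with `N × A₁(Y, ℤ)` through `v ↦ (s v, π v)`, and then this monoid
with `{(m, φ(m) + p) | m ∈ N, p ∈ P}`, `φ = π ∘ tphi`. -/
def Pphi : AddSubmonoid (ι → ℤ) where
  carrier := {v | v - S.tphi (S.raySum v) ∈ S.NE}
  zero_mem' := by
    have := S.tphi_raySum (v := 0) (fun _ => le_rfl) ⟨∅, S.empty_mem, fun _ _ => rfl⟩
    simp only [Set.mem_ofPred_eq, this, sub_zero]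
    exact zero_mem _
  add_mem' := by
    intro v w hv hw
    have hk : S.tphi (S.raySum v) + S.tphi (S.raySum w) - S.tphi (S.raySum (v + w)) ∈ S.NE := by
      refine ⟨by simp [raySum_tphi], fun a ha => ?_⟩
      have := ha (S.raySum v) (S.raySum w)
      simp only [plFun, ← map_add] at this
      simp only [Pi.sub_apply, Pi.add_apply, mul_sub, mul_add, Finset.sum_sub_distrib,
        Finset.sum_add_distrib]
      linarith
    have := add_mem (add_mem hv hw) hk
    simp only [Set.mem_ofPred_eq]
    convert this using 1
    abel

lemma NE_le_Pphi : S.NE ≤ S.Pphi := by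
  intro β hβ
  have h0 := S.tphi_raySum (v := 0) (fun _ => le_rfl) ⟨∅, S.empty_mem, fun _ _ => rfl⟩
  change β - S.tphi (S.raySum β) ∈ S.NE
  rw [hβ.1, ← map_zero S.raySum, h0, sub_zero]
  exact hβ

lemma single_mem_Pphi (i : ι) : Pi.single i (1 : ℤ) ∈ S.Pphi := by
  have h := S.tphi_raySum (v := Pi.single i (1 : ℤ))
    (fun j => by by_cases h : j = i <;> simp [h])
    ⟨{i}, S.singleton_mem i, fun j hj => by
      rw [Finset.mem_singleton] at hj; simp [hj]⟩
  change _ - _ ∈ S.NE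
  rw [h, sub_self]
  exact zero_mem _

/-! ### The total space and its holomorphic functions -/

variable (T : Type)

/-- The points of the analytic space `𝒳 = Spec(ℂ[P_φ]) × ℂ^T`. -/
abbrev Pt : Type := (Multiplicative S.Pphi →* ℂ) × (T → ℂ)

/-- The monomial `z^v t^α` as a function on `𝒳`. -/
def mon (q : S.Pphi × (T →₀ ℕ)) (x : S.Pt T) : ℂ :=
  x.1 (Multiplicative.ofAdd q.1) * q.2.prod fun i e => x.2 i ^ e

lemma mon_add (q r : S.Pphi × (T →₀ ℕ)) (x : S.Pt T) :
    S.mon T (q + r) x = S.mon T q x * S.mon T r x := by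
  classical
  simp only [mon, Prod.fst_add, Prod.snd_add, ofAdd_add, map_mul]
  rw [Finsupp.prod_add_index' (by simp) (fun i => pow_add (x.2 i))]
  ring

lemma mon_zero (x : S.Pt T) : S.mon T 0 x = 1 := by simp [mon]

/-- The algebra `𝒪(𝒳)` of holomorphic functions on `𝒳`: the sums of series of monomials that
converge (absolutely) at every point of `𝒳`, that is, the restrictions to `𝒳` of the entire
functions of finitely many coordinates `z^v` and of the `tᵢ`. -/
def holo : Subalgebra ℂ (S.Pt T → ℂ) where
  carrier := {f | ∃ c : S.Pphi × (T →₀ ℕ) → ℂ, ∀ x, HasSum (fun q => c q * S.mon T q x) (f x)}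
  algebraMap_mem' := by
    classical
    intro r
    refine ⟨fun q => if q = 0 then r else 0, fun x => ?_⟩
    have := hasSum_single (f := fun q => (if q = 0 then r else 0) * S.mon T q x) 0
      (fun q hq => by simp [hq])
    simpa [mon_zero] using this
  add_mem' := by
    rintro f g ⟨c, hc⟩ ⟨d, hd⟩
    exact ⟨c + d, fun x => by simpa [add_mul] using (hc x).add (hd x)⟩
  mul_mem' := by
    rintro f g ⟨c, hc⟩ ⟨d, hd⟩
    refine ⟨fun q => ∑' p : {p : (S.Pphi × (T →₀ ℕ)) × (S.Pphi × (T →₀ ℕ)) // p.1 + p.2 = q},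
      c p.1.1 * d p.1.2, fun x => ?_⟩
    have hs := summable_mul_of_summable_norm (hc x).summable.norm (hd x).summable.norm
    have hm := (hc x).mul (hd x) hs
    rw [← (Equiv.sigmaFiberEquiv
      (fun p : (S.Pphi × (T →₀ ℕ)) × (S.Pphi × (T →₀ ℕ)) => p.1 + p.2)).hasSum_iff] at hm
    have h2 := hm.sigma fun q => (hm.summable.sigma_factor q).hasSum
    refine Eq.mpr (congrArg (fun g => HasSum g _) (funext fun q => ?_)) h2
    rw [← tsum_mul_right]
    refine tsum_congr ?_
    rintro ⟨p, rfl⟩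
    simp only [Function.comp, Equiv.sigmaFiberEquiv, Equiv.coe_fn_mk, mon_add]
    ring

/-- The flow on `𝒳` of the logarithmic vector field that multiplies `z^v` by `l v`. -/
def flow (l : (ι → ℤ) →ₗ[ℤ] ℤ) (c : ℂ) (x : S.Pt T) : S.Pt T :=
  ({ toFun := fun v => Complex.exp (c * l (Multiplicative.toAdd v : S.Pphi)) * x.1 v
     map_one' := by simp
     map_mul' := fun v w => by
      simp only [toAdd_mul, AddSubmonoid.coe_add, map_add, map_mul, Int.cast_add, mul_add,
        Complex.exp_add]
      ring }, x.2)

lemma mon_flow (l : (ι → ℤ) →ₗ[ℤ] ℤ) (c : ℂ) (x : S.Pt T) (q : S.Pphi × (T →₀ ℕ)) :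
    S.mon T q (S.flow T l c x) = Complex.exp (c * l q.1) * S.mon T q x := by
  simp [mon, flow, mul_assoc]

lemma flow_zero (l : (ι → ℤ) →ₗ[ℤ] ℤ) (x : S.Pt T) : S.flow T l 0 x = x := by
  refine Prod.ext (MonoidHom.ext fun v => ?_) rfl
  simp [flow]

lemma abs_mul_exp_le (l : ℤ) {y : ℂ} (hy : ‖y‖ < 1) :
    ‖Complex.exp (y * l) * l‖ ≤ ‖Complex.exp (2 * l)‖ + ‖Complex.exp (-2 * l)‖ := by
  have h1 : ‖Complex.exp (y * l)‖ ≤ Real.exp |(l : ℝ)| := by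
    rw [Complex.norm_exp, Real.exp_le_exp]
    calc (y * l).re ≤ ‖y * l‖ := Complex.re_le_norm _
      _ = ‖y‖ * |(l : ℝ)| := by simp
      _ ≤ 1 * |(l : ℝ)| := by gcongr
      _ = _ := one_mul _
  have h2 : ‖(l : ℂ)‖ ≤ Real.exp |(l : ℝ)| := by
    rw [show ‖(l : ℂ)‖ = |(l : ℝ)| by simp]
    have := Real.add_one_le_exp |(l : ℝ)|
    linarith
  have h3 : ‖Complex.exp (2 * l)‖ = Real.exp (2 * l) := by
    rw [Complex.norm_exp]; simp
  have h4 : ‖Complex.exp (-2 * l)‖ = Real.exp (-2 * l) := by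
    rw [Complex.norm_exp]; simp
  rw [h3, h4, norm_mul]
  calc _ ≤ Real.exp |(l : ℝ)| * Real.exp |(l : ℝ)| := by gcongr
    _ = Real.exp (2 * |(l : ℝ)|) := by rw [← Real.exp_add]; ring_nf
    _ ≤ _ := by
      rcases abs_cases (l : ℝ) with ⟨h, _⟩ | ⟨h, _⟩ <;> rw [h]
      · have := Real.exp_pos (-2 * (l : ℝ)); linarith
      · have := Real.exp_pos (2 * (l : ℝ))
        rw [show 2 * -(l : ℝ) = -2 * l by ring]; linarith

lemma hasDeriv_flow (l : (ι → ℤ) →ₗ[ℤ] ℤ) {f : S.Pt T → ℂ} {c : S.Pphi × (T →₀ ℕ) → ℂ}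
    (hc : ∀ x, HasSum (fun q => c q * S.mon T q x) (f x)) (x : S.Pt T) :
    HasDerivAt (fun y : ℂ => f (S.flow T l y x)) (∑' q, c q * l q.1 * S.mon T q x) 0 ∧
      Summable (fun q => c q * l q.1 * S.mon T q x) := by
  have hp := (hc (S.flow T l 2 x)).summable.norm
  have hm := (hc (S.flow T l (-2) x)).summable.norm
  simp only [mon_flow] at hp hm
  have hu := hp.add hm
  have hbound : ∀ (q : S.Pphi × (T →₀ ℕ)) (y : ℂ), y ∈ Metric.ball (0 : ℂ) 1 →
      ‖c q * (Complex.exp (y * l q.1) * l q.1 * S.mon T q x)‖ ≤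
        ‖c q * (Complex.exp (2 * l q.1) * S.mon T q x)‖ +
        ‖c q * (Complex.exp (-2 * l q.1) * S.mon T q x)‖ := by
    intro q y hy
    have := abs_mul_exp_le (l q.1) (y := y) (by simpa using hy)
    rw [norm_mul, norm_mul, norm_mul (c q), norm_mul (c q), norm_mul _ (S.mon T q x),
      norm_mul _ (S.mon T q x)]
    calc _ ≤ ‖c q‖ * ((‖Complex.exp (2 * l q.1)‖ + ‖Complex.exp (-2 * l q.1)‖) *
        ‖S.mon T q x‖) := by gcongr
      _ = _ := by ring
  have hd := hasDerivAt_tsum_of_isPreconnected (𝕜 := ℂ) (F := ℂ)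
    (g := fun q y => c q * (Complex.exp (y * l q.1) * S.mon T q x))
    (g' := fun q y => c q * (Complex.exp (y * l q.1) * l q.1 * S.mon T q x))
    (t := Metric.ball (0 : ℂ) 1) (y₀ := 0) (y := 0) hu Metric.isOpen_ball
    (convex_ball (0 : ℂ) 1).isPreconnected
    (fun q y _ => by
      have h1 : HasDerivAt (fun y : ℂ => y * (l q.1 : ℂ)) (l q.1 : ℂ) y := by
        simpa using (hasDerivAt_id y).mul_const (l q.1 : ℂ)
      exact (h1.cexp.mul_const _).const_mul _)
    hbound (by simp) (by simpa using (hc x).summable) (by simp)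
  have e1 : (fun q : S.Pphi × (T →₀ ℕ) =>
      c q * (Complex.exp (0 * l q.1) * l q.1 * S.mon T q x)) =
      fun q => c q * l q.1 * S.mon T q x := by
    funext q; simp [mul_assoc]
  refine ⟨?_, ?_⟩
  · rw [e1] at hd
    refine hd.congr_of_eventuallyEq (Filter.Eventually.of_forall fun y => ?_)
    change f (S.flow T l y x) = _
    rw [← (hc (S.flow T l y x)).tsum_eq]
    simp only [mon_flow]
  · rw [← e1]
    exact Summable.of_norm_bounded hu fun q => hbound q 0 (by simp)

/-- The logarithmic derivation of `𝒪(𝒳)` with `z^v ↦ l(v) z^v` and `tᵢ ↦ 0`, as the derivative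
along the flow. -/
def logDer (l : (ι → ℤ) →ₗ[ℤ] ℤ) (f : S.holo T) : S.holo T :=
  ⟨fun x => deriv (fun y : ℂ => f.1 (S.flow T l y x)) 0, by
    obtain ⟨c, hc⟩ := f.2
    refine ⟨fun q => c q * l q.1, fun x => ?_⟩
    obtain ⟨h1, h2⟩ := S.hasDeriv_flow T l hc x
    change HasSum _ (deriv (fun y : ℂ => f.1 (S.flow T l y x)) 0)
    rw [h1.deriv]
    exact h2.hasSum⟩

lemma differentiable_flow (l : (ι → ℤ) →ₗ[ℤ] ℤ) (f : S.holo T) (x : S.Pt T) :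
    DifferentiableAt ℂ (fun y : ℂ => f.1 (S.flow T l y x)) 0 := by
  obtain ⟨c, hc⟩ := f.2
  exact (S.hasDeriv_flow T l hc x).1.differentiableAt

/-- A monomial as an element of `𝒪(𝒳)`. -/
def monH (q : S.Pphi × (T →₀ ℕ)) : S.holo T :=
  ⟨S.mon T q, by
    classical
    refine ⟨Pi.single q 1, fun x => ?_⟩
    have := hasSum_single (f := fun r => (Pi.single q (1 : ℂ) : _ → ℂ) r * S.mon T r x) q
      (fun r hr => by simp [hr])
    simpa using this⟩

/-! ### The base -/

/-- The ring `ℛ = ℂ[P] ⊗ ℂ[t]`. -/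
abbrev R : Type := MvPolynomial T (AddMonoidAlgebra ℂ S.NE)

/-- The ideal `𝓘` of `ℛ` generated by the `z^p`, `p ∈ P` nonzero, and the `tᵢ`. -/
def maxIdeal : Ideal (S.R T) :=
  Ideal.span (((fun p : S.NE => MvPolynomial.C (AddMonoidAlgebra.single p (1 : ℂ))) '' {p | p ≠ 0})
    ∪ Set.range MvPolynomial.X)

/-- The ring `ℛ_k = ℛ / 𝓘^{k+1}`. -/
def Rk (k : ℕ) : Type := S.R T ⧸ S.maxIdeal T ^ (k + 1)

instance (k : ℕ) : CommRing (S.Rk T k) := Ideal.Quotient.commRing _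

/-- The quotient map `ℛ → ℛ_k`. -/
def toRk (k : ℕ) : S.R T →+* S.Rk T k := Ideal.Quotient.mk _

instance (k : ℕ) : Algebra (S.R T) (S.Rk T k) := (S.toRk T k).toAlgebra

/-- The pullback of functions `ℂ[P] → 𝒪(𝒳)` along `𝒳 → Spec ℂ[P]`. -/
def pullP : AddMonoidAlgebra ℂ S.NE →ₐ[ℂ] S.holo T :=
  AddMonoidAlgebra.lift ℂ (S.holo T) S.NE
    { toFun := fun p => S.monH T (⟨(Multiplicative.toAdd p).1, S.NE_le_Pphi p.2⟩, 0)
      map_one' := Subtype.ext (funext fun x => S.mon_zero T x)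
      map_mul' := fun p p' => Subtype.ext (funext fun x => by
        change S.mon T _ x = S.mon T _ x * S.mon T _ x
        rw [← mon_add]
        congr 1) }

/-- The pullback of functions `ℛ → 𝒪(𝒳)` along `𝒳 → 𝒮 = Spec ℛ`. -/
def pull : S.R T →+* S.holo T :=
  MvPolynomial.eval₂Hom (S.pullP T).toRingHom fun i => S.monH T (0, Finsupp.single i 1)

instance : Algebra (S.R T) (S.holo T) := (S.pull T).toAlgebra

/-- The linear functional `v ↦ (s v)_j` on `ℤ^{Σ(1)}`. -/
def coordFun (j : Fin n) : (ι → ℤ) →ₗ[ℤ] ℤ := LinearMap.proj j ∘ₗ S.raySum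

lemma pull_flow (j : Fin n) (r : S.R T) (c : ℂ) (x : S.Pt T) :
    (S.pull T r).1 (S.flow T (S.coordFun j) c x) = (S.pull T r).1 x := by
  have key : ∀ p : AddMonoidAlgebra ℂ S.NE,
      (S.pullP T p).1 (S.flow T (S.coordFun j) c x) = (S.pullP T p).1 x := by
    intro p
    induction p using AddMonoidAlgebra.induction_on with
    | of p =>
      simp only [pullP, AddMonoidAlgebra.lift_of]
      change S.mon T _ _ = S.mon T _ _
      rw [mon_flow]
      have : S.coordFun j p.1 = 0 := by
        simp [coordFun, p.2.1]
      change Complex.exp (c * (S.coordFun j p.1 : ℤ)) * _ = _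
      rw [this]
      simp
    | add p q hp hq =>
      rw [map_add]
      exact congrArg₂ (· + ·) hp hq
    | smul a p hp =>
      rw [map_smul]
      exact congrArg (a * ·) hp
  induction r using MvPolynomial.induction_on with
  | C p => simpa [pull] using key p
  | add p q hp hq =>
    rw [map_add]
    exact congrArg₂ (· + ·) hp hq
  | mul_X p i hp =>
    rw [map_mul]
    refine congrArg₂ (· * ·) hp ?_
    simp [pull, monH, mon, flow]

/-- The logarithmic derivation of `𝒪(𝒳)` relative to `𝒮` given by the `j`-th coordinate on `N`:
it maps `z^v` to `(s v)_j z^v`. -/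
def relDer (j : Fin n) : S.holo T →ₗ[S.R T] S.holo T where
  toFun := S.logDer T (S.coordFun j)
  map_add' f g := Subtype.ext (funext fun x =>
    deriv_fun_add (S.differentiable_flow T _ f x) (S.differentiable_flow T _ g x))
  map_smul' r f := Subtype.ext (funext fun x => by
    have : (fun y : ℂ => (r • f).1 (S.flow T (S.coordFun j) y x)) =
        fun y => (S.pull T r).1 x * f.1 (S.flow T (S.coordFun j) y x) := by
      funext y
      rw [← S.pull_flow T j r y x]
      rfl
    change deriv _ 0 = (S.pull T r).1 x * deriv _ 0
    rw [this, deriv_const_mul _ (S.differentiable_flow T _ f x)])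

/-! ### The `k`-th order family and the twisted de Rham complex -/

/-- The ring of functions `𝒪(𝒳_k)` on `𝒳_k = 𝒳 ×_𝒮 𝒮_k`. -/
def Ok (k : ℕ) : Type := S.Rk T k ⊗[S.R T] S.holo T

instance (k : ℕ) : CommRing (S.Ok T k) := inferInstanceAs (CommRing (S.Rk T k ⊗[S.R T] S.holo T))

instance (k : ℕ) : Algebra (S.Rk T k) (S.Ok T k) :=
  inferInstanceAs (Algebra (S.Rk T k) (S.Rk T k ⊗[S.R T] S.holo T))

/-- The restriction of functions `𝒪(𝒳) → 𝒪(𝒳_k)`. -/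
def toOk (k : ℕ) : S.holo T →+* S.Ok T k :=
  (Algebra.TensorProduct.includeRight : S.holo T →ₐ[S.R T] S.Rk T k ⊗[S.R T] S.holo T).toRingHom

/-- The relative logarithmic derivations on `𝒪(𝒳_k)`. -/
def derOk (k : ℕ) (j : Fin n) : S.Ok T k →ₗ[S.Rk T k] S.Ok T k :=
  (S.relDer T j).baseChange (S.Rk T k)

/-- The relative logarithmic derivations on `𝒪(𝒳_k)[[u]]`. -/
def derU (k : ℕ) (j : Fin n) :
    PowerSeries (S.Ok T k) →ₗ[PowerSeries (S.Rk T k)] PowerSeries (S.Ok T k) where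
  toFun b := PowerSeries.mk fun e => S.derOk T k j (PowerSeries.coeff e b)
  map_add' b b' := by ext e; simp
  map_smul' r b := by
    ext e
    simp only [Algebra.smul_def, PowerSeries.algebraMap_apply'', RingHom.id_apply,
      PowerSeries.coeff_mk, PowerSeries.coeff_mul, PowerSeries.coeff_map, map_sum]
    refine Finset.sum_congr rfl fun p _ => ?_
    rw [← Algebra.smul_def, ← Algebra.smul_def, map_smul]

/-- The ring `ℛ_k[[u]]`. -/
abbrev Rku (k : ℕ) : Type := PowerSeries (S.Rk T k)

/-- The exterior algebra of `ℛ_k[[u]] ⊗ N`, `N = ℤⁿ`. -/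
abbrev Ext (k : ℕ) : Type := ExteriorAlgebra (S.Rku T k) (Fin n → S.Rku T k)

/-- The global sections of `Ω^•_{𝒳_k/𝒮_k}[[u]]`, namely `𝒪(𝒳_k)[[u]] ⊗ ⋀ N`: the module of relative
log differentials is `𝒪(𝒳_k) ⊗ (P_φ^gp / P^gp) = 𝒪(𝒳_k) ⊗ N`, where the class of `v ∈ P_φ`, which
stands for `d log z^v`, is `s(v) ∈ N`. -/
def Forms (k : ℕ) : Type := PowerSeries (S.Ok T k) ⊗[S.Rku T k] S.Ext T k

instance (k : ℕ) : Ring (S.Forms T k) :=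
  inferInstanceAs (Ring (PowerSeries (S.Ok T k) ⊗[S.Rku T k] S.Ext T k))

instance (k : ℕ) : Algebra (S.Rku T k) (S.Forms T k) :=
  inferInstanceAs (Algebra (S.Rku T k) (PowerSeries (S.Ok T k) ⊗[S.Rku T k] S.Ext T k))

/-- The form `b ω`, for `b ∈ 𝒪(𝒳_k)[[u]]` and `ω ∈ ⋀ N`. -/
def form (k : ℕ) (b : PowerSeries (S.Ok T k)) (ω : S.Ext T k) : S.Forms T k :=
  (b ⊗ₜ ω : PowerSeries (S.Ok T k) ⊗[S.Rku T k] S.Ext T k)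

/-- The monomial `d log e_{s 0} ∧ ⋯ ∧ d log e_{s (p - 1)}` in the standard basis of `N`. -/
def dlogs (k : ℕ) {p : ℕ} (s : Fin p → Fin n) : S.Ext T k :=
  ExteriorAlgebra.ιMulti (S.Rku T k) p fun a => Pi.single (s a) 1

/-- The relative de Rham differential `∂`, with `∂(g ω) = ∑_j (D_j g) d log e_j ∧ ω` for constant
`ω ∈ ⋀ N`. -/
def del (k : ℕ) : S.Forms T k →ₗ[S.Rku T k] S.Forms T k :=
  ∑ j, (TensorProduct.map (S.derU T k j)
    (LinearMap.mulLeft (S.Rku T k) (ExteriorAlgebra.ι (S.Rku T k) (Pi.single j 1))) :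
      PowerSeries (S.Ok T k) ⊗[S.Rku T k] S.Ext T k →ₗ[S.Rku T k]
        PowerSeries (S.Ok T k) ⊗[S.Rku T k] S.Ext T k)

/-- A holomorphic function on `𝒳` as an element of `𝒪(𝒳_k)[[u]]`. -/
def toU (k : ℕ) (g : S.holo T) : PowerSeries (S.Ok T k) :=
  PowerSeries.C (S.toOk T k g)

/-- The twisted differential `dF ∧ + u ∂`. -/
def twist (k : ℕ) (F : S.holo T) : S.Forms T k →ₗ[S.Rku T k] S.Forms T k :=
  LinearMap.mulLeft (S.Rku T k) (S.del T k (S.form T k (S.toU T k F) 1)) +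
    (PowerSeries.X : S.Rku T k) • S.del T k

/-- The twisted de Rham cohomology `H(Ω^•_{𝒳_k/𝒮_k}[[u]], dF ∧ + u ∂)`. -/
abbrev Coh (k : ℕ) (F : S.holo T) : Type :=
  LinearMap.ker (S.twist T k F) ⧸
    (LinearMap.range (S.twist T k F)).submoduleOf (LinearMap.ker (S.twist T k F))

/-- The coordinate function `z_i` on `𝒳`. -/
def z (i : ι) : S.holo T := S.monH T (⟨Pi.single i 1, S.single_mem_Pphi i⟩, 0)

/-! ### Weights -/

/-- The weight of `z^v t^α`, where each `z_i` has weight `2` and `t_i` has weight `d i`. -/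
def weight (d : T → ℤ) (v : ι → ℤ) (α : T →₀ ℕ) : ℤ := 2 * ∑ i, v i + α.sum fun i e => e * d i

/-- The elements of weight `w` of `ℛ_k`. -/
def RkWeight (d : T → ℤ) (k : ℕ) (w : ℤ) : AddSubgroup (S.Rk T k) :=
  AddSubgroup.closure {r | ∃ (p : S.NE) (α : T →₀ ℕ) (c : ℂ), weight T d p.1 α = w ∧
    r = S.toRk T k (MvPolynomial.monomial α (AddMonoidAlgebra.single p c))}

/-- The elements of weight `w` of `ℛ_k[[u]]`, where `u` has weight `2`. -/
def RkuWeight (d : T → ℤ) (k : ℕ) (w : ℤ) : Set (S.Rku T k) :=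
  {r | ∀ e : ℕ, PowerSeries.coeff e r ∈ S.RkWeight T d k (w - 2 * e)}

/-- The holomorphic functions of weight `w` on `𝒳`. -/
def holoWeight (d : T → ℤ) (w : ℤ) : Set (S.holo T) :=
  {f | ∃ c : S.Pphi × (T →₀ ℕ) → ℂ, (∀ q, c q ≠ 0 → weight T d q.1.1 q.2 = w) ∧
    ∀ x, HasSum (fun q => c q * S.mon T q x) (f.1 x)}

/-- The forms of weight `w`. The form `g u^e ω`, with `ω` a wedge of `p` of the
`d log e_j`, has weight
`wt(g) + 2 e + 2 (n - p)`: under contraction with the volume form it corresponds to a polyvector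
field of degree `n - p`, and the log derivations have weight `2`. -/
def formWeight (d : T → ℤ) (k : ℕ) (w : ℤ) : AddSubgroup (S.Forms T k) :=
  AddSubgroup.closure {η | ∃ (p : ℕ) (s : Fin p → Fin n) (b : PowerSeries (S.Ok T k)),
    (∀ e : ℕ, ∃ g ∈ S.holoWeight T d (w - 2 * e - 2 * (n - p)),
      PowerSeries.coeff e b = S.toOk T k g) ∧ η = S.form T k b (S.dlogs T k s)}

/-- The cohomology classes of weight `w`: those of the cocycles of weight `w`. -/
def cohWeight (d : T → ℤ) (k : ℕ) (F : S.holo T) (w : ℤ) : Set (S.Coh T k F) :=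
  {h | ∃ η : LinearMap.ker (S.twist T k F), η.1 ∈ S.formWeight T d k w ∧
    h = Submodule.Quotient.mk η}

/-! ### The monomials `φ_i` and the universal unfolding -/

variable {μ : ℕ} (σ : Fin μ → Finset ι)

/-- The cone `τ_i`: the intersection of `σ_i` with all the `σ_j`, `j > i`, that meet it
in dimension `n - 1`. -/
def tau (n : ℕ) (i : Fin μ) : Finset ι :=
  (σ i).filter fun r => ∀ j, i < j → (σ i ∩ σ j).card + 1 = n → r ∈ σ j

/-- `σ` lists the `n`-dimensional cones without repetition, and `τ_i ⊆ σ_j` implies `i ≤ j`. -/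
def IsGoodOrder : Prop :=
  Function.Injective σ ∧ (∀ s, s ∈ Set.range σ ↔ s ∈ S.cones ∧ s.card = n) ∧
    ∀ i j, tau σ n i ⊆ σ j → i ≤ j

/-- The weight degree of `φ_i`. -/
def phiDeg (n : ℕ) (i : Fin μ) : ℤ := 2 * (tau σ n i).card

/-- The index set of the parameters `t_i`: those `i` for which `φ_i` does not have degree `2`. -/
abbrev Param (n : ℕ) : Type := {i : Fin μ // phiDeg σ n i ≠ 2}

/-- The weight degree of `t_i`. -/
def paramDeg (n : ℕ) (i : Param σ n) : ℤ := 2 - phiDeg σ n i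

/-- The monomial `φ_i = P(τ_i)`, the product of the coordinates of the rays of `τ_i`. -/
def phi (i : Fin μ) : S.holo (Param σ n) := ∏ r ∈ tau σ n i, S.z (Param σ n) r

/-- The superpotential `F = ∑ z_i + ∑ t_i φ_i` of the universal unfolding. -/
def superF : S.holo (Param σ n) :=
  ∑ i, S.z (Param σ n) i +
    ∑ i : Param σ n, S.monH (Param σ n) (0, Finsupp.single i 1) * S.phi σ i

/-- The form `φ_i Ω`, where `Ω = d log e_1 ∧ ⋯ ∧ d log e_n`. -/
def phiForm (k : ℕ) (i : Fin μ) : S.Forms (Param σ n) k :=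
  S.form (Param σ n) k (S.toU (Param σ n) k (S.phi σ i))
    (S.dlogs (Param σ n) k (id : Fin n → Fin n))

/-- The Hodge bundle `ℋ^F_k` of the `k`-th order universal unfolding. -/
abbrev Hodge (k : ℕ) : Type := S.Coh (Param σ n) k (S.superF σ)

end SmoothCompleteFan

end LogLG

end

open scoped TensorProduct

noncomputable section

/-! Modulo `𝓘` and `u` the twisted complex is a Koszul complex. The term `u ∂` disappears, each `t_i
φ_i` contributes nothing, and the differential becomes `∑_s z_s ρ_s ∧` on the functions of the
central fibre. These form an analytic Stanley–Reisner ring: `z^{φ(m)} z^{φ(m')}` is `z^{φ(m+m')}`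
when `m` and `m'` lie in a common cone, and zero otherwise.

The given order of the maximal cones is a shelling: every cone `γ` lies in exactly one interval `τ_i
⊆ γ ⊆ σ_i` (`IsGoodOrder.exists_index`, `IsGoodOrder.index_le`). Hence the monomials of the central
fibre split into blocks, the `i`-th one consisting of `φ_i` times the monomials in `z_r`, `r ∈ σ_i`.
Multiplication by `z_s` never lowers the block, and it has a component inside block `i` only for `s
∈ σ_i`. So on block `i`, up to higher blocks, one sees the Koszul complex of the coordinates of
`ℂⁿ`, because the `ρ_r`, `r ∈ σ_i`, form a basis of `N`. It is contracted by Euler's homotopy: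
differentiate the monomial divided by `φ_i` along `z_r`, contract the form with the covector dual to
`ρ_r`, sum over `r`, and divide by the Euler weight, which is the degree of the monomial over `φ_i`
plus `n - p` on `p`-forms. That weight vanishes only at `φ_i Ω`.

With `h` this homotopy, `d` the twisted differential and `Q` the projection to the multiples of the
`φ_i Ω`, the error `d h + h d + Q - 1` is strictly triangular for the blocks modulo `𝓘` and `u`
(`strict_triangular`). Its power `μ (k + 1)` is therefore divisible by `u`. As the forms are
`u`-adically complete, an abstract lemma (`IsPerturbedContraction.eq_zero`,
`IsPerturbedContraction.exists_of_closed`) identifies the cohomology with the image of `Q`, and that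
image is free on the `φ_i Ω`.

All operators must preserve convergence. Projectivity provides a degree that is positive on the
nonzero elements of `P_φ`. Since `P` is finitely generated, a series converges at every point
exactly when `∑ |c_q| M ^ deg q` is finite for all `M ≥ 1`. This condition survives bounded weights
combined with injective reindexing that reads each coefficient off an exponent of no smaller degree
(`IsEntireCo.reindex`).

For the weights, let the element `2` of the weight torus act. Because `F` and `u` have weight `2`,
this action preserves the coefficients of exact top forms. A cocycle of weight `w` has a volume
coefficient that is an eigenvector for `2 ^ w`. Comparing its expansion with the rescaled one, the
independence of the classes makes each `r_i` an eigenvector for `2 ^ (w - deg φ_i)`, and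
eigenvectors are homogeneous since the powers of `2` are distinct. -/

/-- The lattice points of a polyhedral cone cut out by finitely many integral inequalities form a
finitely generated monoid. -/
theorem AddSubmonoid.exists_finset_of_halfspaces {ι J : Type*} [Finite ι] [Finite J]
    (κ : J → (ι → ℤ) →+ ℤ) : ∃ G : Finset (ι → ℤ),
      ∀ v, v ∈ AddSubmonoid.closure (G : Set (ι → ℤ)) ↔ ∀ j, 0 ≤ κ j v := by
  classical
  let castHom : (ι → ℕ) →+ (ι → ℤ) :=
    { toFun := fun x i => (x i : ℤ)
      map_zero' := by ext; simp
      map_add' := by intros; ext; simp }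
  let diff : (ι ⊕ ι ⊕ J → ℕ) →+ (ι → ℤ) :=
    { toFun := fun x i => (x (Sum.inl i) : ℤ) - x (Sum.inr (Sum.inl i))
      map_zero' := by ext; simp
      map_add' := by intros; ext; simp; ring }
  let f : (ι ⊕ ι ⊕ J → ℕ) →+ (J → ℤ) :=
    { toFun := fun x j => κ j (diff x)
      map_zero' := by ext; simp
      map_add' := by intros; ext; simp }
  let g : (ι ⊕ ι ⊕ J → ℕ) →+ (J → ℤ) :=
    { toFun := fun x j => (x (Sum.inr (Sum.inr j)) : ℤ)
      map_zero' := by ext; simp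
      map_add' := by intros; ext; simp }
  -- Natural variables record the positive part of `v`, its negative part, and one slack per
  -- inequality. The solutions of `κ j v = slack j` are the equalizer of two homomorphisms out of a
  -- power of `ℕ`, which is finitely generated.
  obtain ⟨G, hG⟩ := (AddSubmonoid.fg_eqLocusM f g).map diff
  refine ⟨G, fun v => ?_⟩
  rw [hG, AddSubmonoid.mem_map]
  constructor
  · rintro ⟨x, hx, rfl⟩ j
    have : κ j (diff x) = (x (Sum.inr (Sum.inr j)) : ℤ) := congrFun hx j
    rw [this]
    positivity
  · intro hv
    refine ⟨Sum.elim (fun i => (v i).toNat) (Sum.elim (fun i => (-v i).toNat)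
      fun j => (κ j v).toNat), ?_, ?_⟩
    · have hd : diff (Sum.elim (fun i => (v i).toNat) (Sum.elim (fun i => (-v i).toNat)
          fun j => (κ j v).toNat)) = v := by
        ext i
        change (((v i).toNat : ℤ) - ((-v i).toNat : ℤ)) = v i
        omega
      ext j
      change κ j (diff _) = (((κ j v).toNat : ℕ) : ℤ)
      rw [hd, Int.toNat_of_nonneg (hv j)]
    · ext i
      change (((v i).toNat : ℤ) - ((-v i).toNat : ℤ)) = v i
      omega

namespace LogLG

namespace SmoothCompleteFan

variable {n : ℕ} {ι : Type} [Fintype ι] [DecidableEq ι] (S : SmoothCompleteFan n ι)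

/-! ### The combinatorics of the fan -/

lemma tphi_nonneg (m : Fin n → ℤ) (i : ι) : 0 ≤ S.tphi m i := (S.exists_lift m).choose_spec.1 i

/-- The rays of the smallest cone containing a lattice point. -/
def supp (m : Fin n → ℤ) : Finset ι := Finset.univ.filter fun i => S.tphi m i ≠ 0

lemma mem_supp {m : Fin n → ℤ} {i : ι} : i ∈ S.supp m ↔ S.tphi m i ≠ 0 := by simp [supp]

lemma supp_mem_cones (m : Fin n → ℤ) : S.supp m ∈ S.cones := by
  obtain ⟨σ, hσ, h⟩ := (S.exists_lift m).choose_spec.2.1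
  refine S.face_mem σ hσ _ fun i hi => ?_
  by_contra h'
  exact S.mem_supp.1 hi (h i h')

lemma raySum_single (r : ι) (c : ℤ) : S.raySum (Pi.single r c) = c • S.ray r := by
  simp [raySum, Fintype.linearCombination_apply_single]

lemma raySum_eq_sum (v : ι → ℤ) : S.raySum v = ∑ i, v i • S.ray i := by
  simp [raySum, Fintype.linearCombination_apply]

lemma tphi_eq_of_nonneg {m : Fin n → ℤ} {v : ι → ℤ} {σ : Finset ι} (hσ : σ ∈ S.cones)
    (hv : ∀ i, 0 ≤ v i) (hv' : ∀ i ∉ σ, v i = 0) (h : S.raySum v = m) : S.tphi m = v := by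
  rw [← h]
  exact S.tphi_raySum hv ⟨σ, hσ, hv'⟩

/-- Coordinate functionals of a cone. -/
lemma exists_dual {σ : Finset ι} (hσ : σ ∈ S.cones) : ∃ ξ : ι → (Fin n → ℤ) →ₗ[ℤ] ℤ,
    ∀ r ∈ σ, ∀ s ∈ σ, ξ r (S.ray s) = if r = s then 1 else 0 := by
  obtain ⟨b, e, he, hb⟩ := S.smooth σ hσ
  refine ⟨fun i => if h : i ∈ σ then b.coord (e ⟨i, h⟩) else 0, fun r hr s hs => ?_⟩
  simp only [dif_pos hr]
  rw [hb ⟨s, hs⟩, Module.Basis.coord_apply, Module.Basis.repr_self,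
    Finsupp.single_apply]
  by_cases h : r = s
  · subst h; simp
  · have : e ⟨s, hs⟩ ≠ e ⟨r, hr⟩ := fun h' => h (by simpa using (he h').symm)
    simp [h, this]

lemma dual_raySum {σ : Finset ι} {ξ : ι → (Fin n → ℤ) →ₗ[ℤ] ℤ}
    (hξ : ∀ r ∈ σ, ∀ s ∈ σ, ξ r (S.ray s) = if r = s then 1 else 0) {v : ι → ℤ}
    (hv : ∀ i ∉ σ, v i = 0) {r : ι} (hr : r ∈ σ) : ξ r (S.raySum v) = v r := by
  rw [raySum_eq_sum, map_sum, Finset.sum_eq_single r]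
  · rw [map_smul, hξ r hr r hr]
    simp
  · intro s _ hs
    by_cases h : s ∈ σ
    · rw [map_smul, hξ r hr s h, if_neg hs.symm, smul_zero]
    · simp [hv s h]
  · simp

lemma card_le {σ : Finset ι} (hσ : σ ∈ S.cones) : σ.card ≤ n := by
  obtain ⟨b, e, he, hb⟩ := S.smooth σ hσ
  simpa using Fintype.card_le_of_injective e he

/-- The sum of the primitive generators of a set of rays. -/
def raysSum (γ : Finset ι) : Fin n → ℤ := ∑ r ∈ γ, S.ray r

lemma raySum_indicator (γ : Finset ι) :
    S.raySum (fun i => if i ∈ γ then 1 else 0) = S.raysSum γ := by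
  rw [raySum_eq_sum, raysSum, ← Finset.sum_filter_add_sum_filter_not Finset.univ (· ∈ γ)]
  rw [Finset.sum_congr rfl (g := fun i => S.ray i) fun i hi => by
    simp [(Finset.mem_filter.1 hi).2]]
  rw [Finset.sum_eq_zero (s := Finset.univ.filter (· ∉ γ)) fun i hi => by
    simp [(Finset.mem_filter.1 hi).2], add_zero]
  simp

lemma tphi_raysSum {γ : Finset ι} (hγ : γ ∈ S.cones) :
    S.tphi (S.raysSum γ) = fun i => if i ∈ γ then 1 else 0 :=
  S.tphi_eq_of_nonneg hγ (fun i => by split_ifs <;> simp) (fun i hi => by simp [hi])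
    (S.raySum_indicator γ)

/-- Moving a little from an interior point of a cone in any direction, one stays in the
star of that cone. -/
lemma exists_star {γ : Finset ι} (hγ : γ ∈ S.cones) (v : Fin n → ℤ) :
    ∃ τ ∈ S.cones, γ ⊆ τ ∧ ∃ K : ℕ, ∀ i ∉ τ, S.tphi (K • S.raysSum γ + v) i = 0 := by
  set m := S.raysSum γ with hm
  -- Pigeonhole: there are finitely many supports, so one cone `τ` occurs for infinitely many `K`.
  obtain ⟨τ, hτ⟩ := Finite.exists_infinite_fiber (fun K : ℕ => S.supp (K • m + v))
  rw [Set.infinite_coe_iff] at hτ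
  have hfib : ∀ K ∈ (fun K : ℕ => S.supp (K • m + v)) ⁻¹' {τ},
      ∀ i ∉ τ, S.tphi (K • m + v) i = 0 := by
    intro K hK i hi
    by_contra h
    have : S.supp (K • m + v) = τ := hK
    exact hi (this ▸ S.mem_supp.2 h)
  obtain ⟨K, hK⟩ := hτ.nonempty
  have hτc : τ ∈ S.cones := by
    have : S.supp (K • m + v) = τ := hK
    exact this ▸ S.supp_mem_cones _
  obtain ⟨ξ, hξ⟩ := S.exists_dual hτc
  have hval : ∀ K ∈ (fun K : ℕ => S.supp (K • m + v)) ⁻¹' {τ}, ∀ r ∈ τ,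
      (K : ℤ) * ξ r m + ξ r v = S.tphi (K • m + v) r := by
    intro K hK r hr
    rw [← S.dual_raySum hξ (hfib K hK) hr, raySum_tphi, map_add, map_nsmul, nsmul_eq_mul]
  -- The `r`-th coordinate of `K • m + v` is affine in `K` and nonnegative for unboundedly many `K`,
  -- so its slope is nonnegative.
  have hnn : ∀ r ∈ τ, 0 ≤ ξ r m := by
    intro r hr
    by_contra hneg
    obtain ⟨K', hK', hlt⟩ := hτ.exists_gt ((ξ r v).toNat + 1)
    have h1 := hval K' hK' r hr
    have h2 := S.tphi_nonneg (K' • m + v) r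
    rw [← h1] at h2
    have h3 : (K' : ℤ) > ξ r v := by
      have := Int.self_le_toNat (ξ r v)
      omega
    have h4 : (0 : ℤ) ≤ K' := by positivity
    nlinarith
  obtain ⟨K', hK', hlt⟩ := hτ.exists_gt K
  -- Subtracting two points of the same fibre writes a nonzero multiple of `m` through the rays of
  -- `τ`. Thus `m` lies in `τ`, and uniqueness of `tphi` then forces `γ ⊆ τ`.
  have hmem : S.raySum (fun i => if i ∈ τ then ξ i m else 0) = m := by
    have hpos : ((K' : ℤ) - K) ≠ 0 := by omega
    have hsm : ((K' : ℤ) - K) • S.raySum (fun i => if i ∈ τ then ξ i m else 0) =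
        ((K' : ℤ) - K) • m := by
      have h1 : ((K' : ℤ) - K) • m = S.raySum (S.tphi (K' • m + v) - S.tphi (K • m + v)) := by
        rw [map_sub, raySum_tphi, raySum_tphi, sub_smul]
        simp
      rw [h1, ← map_smul]
      congr 1
      ext i
      by_cases hi : i ∈ τ
      · simp only [Pi.smul_apply, hi, if_true, smul_eq_mul, Pi.sub_apply]
        rw [← hval K' hK' i hi, ← hval K hK i hi]
        ring
      · rw [Pi.sub_apply, hfib K' hK' i hi, hfib K hK i hi]
        simp [hi]
    exact smul_right_injective _ hpos hsm
  refine ⟨τ, hτc, fun r hr => ?_, K, hfib K hK⟩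
  by_contra hrτ
  have h1 := S.tphi_eq_of_nonneg hτc (fun i => by
    split_ifs with h
    · exact hnn i h
    · rfl) (fun i hi => by simp [hi]) hmem
  have h2 := congrFun (h1.symm.trans (S.tphi_raysSum hγ)) r
  simp [hr, hrτ] at h2

/-- A cone whose rays generate the lattice has full dimension. -/
lemma card_eq_of_span {τ : Finset ι} (hτ : τ ∈ S.cones)
    (h : ∀ v : Fin n → ℤ, ∃ c : ι → ℤ, (∀ i ∉ τ, c i = 0) ∧ S.raySum c = v) : τ.card = n := by
  obtain ⟨b, e, he, hb⟩ := S.smooth τ hτ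
  have hsurj : Function.Surjective e := by
    intro j
    by_contra hj
    push Not at hj
    obtain ⟨c, hc, hcv⟩ := h (b j)
    have h1 : b.coord j (S.raySum c) = 0 := by
      rw [raySum_eq_sum, map_sum]
      refine Finset.sum_eq_zero fun i _ => ?_
      by_cases hi : i ∈ τ
      · rw [hb ⟨i, hi⟩, map_smul, Module.Basis.coord_apply, Module.Basis.repr_self,
          Finsupp.single_eq_of_ne (hj ⟨i, hi⟩).symm, smul_zero]
      · simp [hc i hi]
    rw [hcv] at h1
    simp at h1
  have := Fintype.card_of_bijective ⟨he, hsurj⟩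
  simpa using this

/-- Every cone of the fan is a face of a cone of full dimension. -/
lemma exists_maximal {γ : Finset ι} (hγ : γ ∈ S.cones) :
    ∃ τ ∈ S.cones, γ ⊆ τ ∧ τ.card = n := by
  classical
  obtain ⟨τ, hτ, hmax⟩ := Finset.exists_max_image
    (Finset.univ.filter fun τ : Finset ι => τ ∈ S.cones ∧ γ ⊆ τ) Finset.card
    ⟨γ, by simp [hγ]⟩
  simp only [Finset.mem_filter, Finset.mem_univ, true_and] at hτ hmax
  refine ⟨τ, hτ.1, hτ.2, S.card_eq_of_span hτ.1 fun v => ?_⟩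
  -- By maximality the star of `τ` reduces to `τ`, so every lattice vector is an integral
  -- combination of its rays.
  obtain ⟨τ', hτ', hsub, K, hK⟩ := S.exists_star hτ.1 v
  have heq : τ = τ' := Finset.eq_of_subset_of_card_le hsub (hmax τ' ⟨hτ', hτ.2.trans hsub⟩)
  subst heq
  refine ⟨fun i => S.tphi (K • S.raysSum τ + v) i - K * (if i ∈ τ then 1 else 0),
    fun i hi => by simp only [hK i hi, hi, if_false]; simp, ?_⟩
  have : (fun i => S.tphi (K • S.raysSum τ + v) i - K * (if i ∈ τ then 1 else 0)) =
      S.tphi (K • S.raysSum τ + v) - (K : ℤ) • fun i => if i ∈ τ then (1 : ℤ) else 0 := by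
    ext i; simp
  rw [this, map_sub, map_smul, raySum_tphi, raySum_indicator]
  simp

/-- Across each facet of a cone of full dimension there is another cone of full dimension. -/
lemma exists_neighbor {σ : Finset ι} (hσ : σ ∈ S.cones) (hn : σ.card = n) {r : ι} (hr : r ∈ σ) :
    ∃ τ ∈ S.cones, τ.card = n ∧ σ.erase r ⊆ τ ∧ r ∉ τ := by
  have hγ : σ.erase r ∈ S.cones := S.face_mem σ hσ _ (Finset.erase_subset _ _)
  -- Leave `σ` through the facet opposite to `r`. If the new maximal cone contained `r` it would be
  -- `σ` itself, but the coordinate along `r` of the displaced point is `-1`.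
  obtain ⟨τ₀, hτ₀, hsub, K, hK⟩ := S.exists_star hγ (-S.ray r)
  obtain ⟨τ, hτ, hsub', hτn⟩ := S.exists_maximal hτ₀
  refine ⟨τ, hτ, hτn, hsub.trans hsub', fun hrτ => ?_⟩
  have heq : σ = τ := by
    refine Finset.eq_of_subset_of_card_le (fun s hs => ?_) (by omega)
    by_cases h : s = r
    · exact h ▸ hrτ
    · exact hsub' (hsub (Finset.mem_erase.2 ⟨h, hs⟩))
  subst heq
  obtain ⟨ξ, hξ⟩ := S.exists_dual hσ
  have h1 := S.dual_raySum hξ (fun i hi => hK i fun h => hi (hsub' h)) hr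
  have h2 := S.tphi_nonneg (K • S.raysSum (σ.erase r) + -S.ray r) r
  rw [raySum_tphi] at h1
  have h3 : ξ r (S.raysSum (σ.erase r)) = 0 := by
    rw [raysSum, map_sum]
    refine Finset.sum_eq_zero fun s hs => ?_
    rw [hξ r hr s (Finset.mem_of_mem_erase hs), if_neg (Finset.ne_of_mem_erase hs).symm]
  rw [← h1, map_add, map_nsmul, h3, map_neg, hξ r hr r hr] at h2
  simp at h2

lemma tphi_add_of_subset {m m' : Fin n → ℤ} {σ : Finset ι} (hσ : σ ∈ S.cones)
    (h : S.supp m ⊆ σ) (h' : S.supp m' ⊆ σ) : S.tphi (m + m') = S.tphi m + S.tphi m' := by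
  refine S.tphi_eq_of_nonneg hσ (fun i => add_nonneg (S.tphi_nonneg _ _) (S.tphi_nonneg _ _))
    (fun i hi => ?_) (by simp [raySum_tphi])
  have h1 : S.tphi m i = 0 := by by_contra h2; exact hi (h (S.mem_supp.2 h2))
  have h3 : S.tphi m' i = 0 := by by_contra h2; exact hi (h' (S.mem_supp.2 h2))
  simp [h1, h3]

lemma tphi_ray (r : ι) : S.tphi (S.ray r) = Pi.single r 1 := by
  refine S.tphi_eq_of_nonneg (S.singleton_mem r) (fun i => ?_) (fun i hi => ?_) ?_
  · by_cases h : i = r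
    · subst h; simp
    · simp [h]
  · rw [Finset.mem_singleton] at hi
    simp [hi]
  · simp [raySum_single]

lemma supp_ray (r : ι) : S.supp (S.ray r) = {r} := by
  ext i
  rw [mem_supp, tphi_ray, Finset.mem_singleton, Pi.single_apply]
  simp

lemma tphi_add_ray {m : Fin n → ℤ} {σ : Finset ι} (hσ : σ ∈ S.cones)
    (h : S.supp m ⊆ σ) {r : ι} (hr : r ∈ σ) :
    S.tphi (m + S.ray r) = S.tphi m + Pi.single r 1 := by
  rw [S.tphi_add_of_subset hσ h (by simpa [supp_ray] using hr), tphi_ray]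

lemma tphi_sub_ray {m : Fin n → ℤ} {r : ι} (hr : r ∈ S.supp m) :
    S.tphi (m - S.ray r) = S.tphi m - Pi.single r 1 := by
  refine S.tphi_eq_of_nonneg (S.supp_mem_cones m) (fun i => ?_) (fun i hi => ?_) ?_
  · have h0 := S.tphi_nonneg m i
    by_cases h : i = r
    · subst h
      have := S.mem_supp.1 hr
      simp only [Pi.sub_apply, Pi.single_eq_same]
      omega
    · simpa [h] using h0
  · have h1 : S.tphi m i = 0 := by by_contra h2; exact hi (S.mem_supp.2 h2)
    have h2 : i ≠ r := fun h => hi (h ▸ hr)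
    simp [h1, h2]
  · simp [raySum_tphi, raySum_single]

lemma tphi_injective : Function.Injective S.tphi :=
  Function.LeftInverse.injective S.raySum_tphi

/-! ### The index of a lattice point in the shelling -/

variable {μ : ℕ} {σ : Fin μ → Finset ι}

section Shelling

variable {S}

lemma IsGoodOrder.mem_cones (hσ : S.IsGoodOrder σ) (i : Fin μ) : σ i ∈ S.cones := ((hσ.2.1 (σ i)).1 ⟨i, rfl⟩).1

lemma IsGoodOrder.card_eq (hσ : S.IsGoodOrder σ) (i : Fin μ) : (σ i).card = n := ((hσ.2.1 (σ i)).1 ⟨i, rfl⟩).2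

/-- Take the least `i` with `γ ⊆ σ i`. If a ray `r` of `τ_i` were missing from `γ`, the neighbour of
`σ i` across the facet opposite to `r` would still contain `γ`. It would then come later in the
order, and the definition of `τ_i` would put `r` into it. -/
lemma IsGoodOrder.exists_index (hσ : S.IsGoodOrder σ) {γ : Finset ι} (hγ : γ ∈ S.cones) :
    ∃ i, tau σ n i ⊆ γ ∧ γ ⊆ σ i := by
  classical
  obtain ⟨τ, hτ, hsub, hn⟩ := S.exists_maximal hγ
  obtain ⟨i₀, hi₀⟩ := (hσ.2.1 τ).2 ⟨hτ, hn⟩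
  obtain ⟨i, hi, hmin⟩ := Finset.exists_min_image (Finset.univ.filter fun i => γ ⊆ σ i) id
    ⟨i₀, by simp [hi₀, hsub]⟩
  simp only [Finset.mem_filter, Finset.mem_univ, true_and, id] at hi hmin
  refine ⟨i, fun r hr => ?_, hi⟩
  by_contra hrγ
  obtain ⟨hr1, hr2⟩ := Finset.mem_filter.1 hr
  obtain ⟨τ', hτ', hn', hsub', hr'⟩ := S.exists_neighbor (hσ.mem_cones i) (hσ.card_eq i) hr1
  obtain ⟨j, rfl⟩ := (hσ.2.1 τ').2 ⟨hτ', hn'⟩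
  have hγj : γ ⊆ σ j := fun s hs => hsub' (Finset.mem_erase.2 ⟨fun h => hrγ (h ▸ hs), hi hs⟩)
  have hne : i ≠ j := fun h => hr' (h ▸ hr1)
  have hcap : σ i ∩ σ j = (σ i).erase r := by
    ext s
    rw [Finset.mem_inter, Finset.mem_erase]
    constructor
    · rintro ⟨h1, h2⟩
      exact ⟨fun h => hr' (h ▸ h2), h1⟩
    · rintro ⟨h1, h2⟩
      exact ⟨h2, hsub' (Finset.mem_erase.2 ⟨h1, h2⟩)⟩
  have hcard := Finset.card_erase_add_one hr1
  rw [hσ.card_eq i] at hcard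
  exact hr' (hr2 j (lt_of_le_of_ne (hmin j hγj) hne) (by rw [hcap, hcard]))

lemma IsGoodOrder.index_le (hσ : S.IsGoodOrder σ) {γ γ' : Finset ι} {i j : Fin μ} (hi : tau σ n i ⊆ γ)
    (hj : γ' ⊆ σ j) (h : γ ⊆ γ') : i ≤ j :=
  hσ.2.2 i j (hi.trans (h.trans hj))

end Shelling

open Classical in
/-- The index `i` of the block `[τ_i, σ_i]` of the shelling that contains the smallest cone
of a lattice point. -/
def idx (hσ : S.IsGoodOrder σ) (m : Fin n → ℤ) : Fin μ :=
  (hσ.exists_index (S.supp_mem_cones m)).choose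

section

variable {S} (hσ : S.IsGoodOrder σ)

lemma tau_subset_supp (m : Fin n → ℤ) : tau σ n (S.idx hσ m) ⊆ S.supp m :=
  (hσ.exists_index (S.supp_mem_cones m)).choose_spec.1

lemma supp_subset (m : Fin n → ℤ) : S.supp m ⊆ σ (S.idx hσ m) :=
  (hσ.exists_index (S.supp_mem_cones m)).choose_spec.2

lemma idx_eq_of {m : Fin n → ℤ} {i : Fin μ} (h1 : tau σ n i ⊆ S.supp m) (h2 : S.supp m ⊆ σ i) :
    S.idx hσ m = i :=
  le_antisymm (hσ.index_le (tau_subset_supp hσ m) h2 subset_rfl)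
    (hσ.index_le h1 (supp_subset hσ m) subset_rfl)

lemma idx_mono {m m' : Fin n → ℤ} (h : S.supp m ⊆ S.supp m') : S.idx hσ m ≤ S.idx hσ m' :=
  hσ.index_le (tau_subset_supp hσ m) (supp_subset hσ m') h

end

lemma tau_subset {ι : Type} [DecidableEq ι] {n μ : ℕ} {σ : Fin μ → Finset ι} (i : Fin μ) : tau σ n i ⊆ σ i := Finset.filter_subset _ _

end SmoothCompleteFan

end LogLG

end

open scoped TensorProduct

noncomputable section

namespace LogLG

namespace SmoothCompleteFan

variable {n : ℕ} {ι : Type} [Fintype ι] [DecidableEq ι] (S : SmoothCompleteFan n ι)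

/-! ### Nef divisors and effective curves -/

lemma exists_dual_basis {σ : Finset ι} (hσ : σ ∈ S.cones) (hn : σ.card = n) :
    ∃ ξ : ι → (Fin n → ℤ) →ₗ[ℤ] ℤ,
      (∀ r ∈ σ, ∀ s ∈ σ, ξ r (S.ray s) = if r = s then 1 else 0) ∧
      ∀ m, ∑ r ∈ σ, ξ r m • S.ray r = m := by
  obtain ⟨ξ, hξ⟩ := S.exists_dual hσ
  refine ⟨ξ, hξ, fun m => ?_⟩
  obtain ⟨b, e, he, hb⟩ := S.smooth σ hσ
  have hbij : Function.Bijective e :=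
    (Fintype.bijective_iff_injective_and_card e).2 ⟨he, by simp [hn]⟩
  have hm : m = ∑ r : σ, b.repr m (e r) • S.ray r := by
    conv_lhs => rw [← b.sum_repr m]
    rw [← hbij.sum_comp fun j => b.repr m j • b j]
    simp [hb]
  have hc : ∀ r : σ, ξ r m = b.repr m (e r) := by
    intro r
    conv_lhs => rw [hm]
    rw [map_sum, Finset.sum_eq_single r]
    · rw [map_smul, hξ r r.2 r r.2]; simp
    · intro s _ hs
      rw [map_smul, hξ r r.2 s s.2, if_neg fun h => hs (Subtype.ext h.symm), smul_zero]
    · simp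
  conv_rhs => rw [hm]
  rw [← Finset.sum_coe_sort σ fun r => ξ r m • S.ray r]
  exact Finset.sum_congr rfl fun r _ => by rw [hc r]

open Classical in
/-- The coordinate functionals of a cone of full dimension. -/
def dual (σ : Finset ι) : ι → (Fin n → ℤ) →ₗ[ℤ] ℤ :=
  if h : σ ∈ S.cones ∧ σ.card = n then (S.exists_dual_basis h.1 h.2).choose else 0

/-- The linear extension of `tphi` from a cone of full dimension. -/
def lin (σ : Finset ι) : (Fin n → ℤ) →ₗ[ℤ] (ι → ℤ) :=
  LinearMap.pi fun i => if i ∈ σ then S.dual σ i else 0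

lemma lin_apply (σ : Finset ι) (m : Fin n → ℤ) (i : ι) :
    S.lin σ m i = if i ∈ σ then S.dual σ i m else 0 := by
  rw [lin, LinearMap.pi_apply]
  split_ifs <;> rfl

section

variable {S} {σ : Finset ι}

lemma dual_ray (hσ : σ ∈ S.cones) (hn : σ.card = n) {r s : ι} (hr : r ∈ σ) (hs : s ∈ σ) :
    S.dual σ r (S.ray s) = if r = s then 1 else 0 := by
  rw [dual, dif_pos ⟨hσ, hn⟩]
  exact (S.exists_dual_basis hσ hn).choose_spec.1 r hr s hs

lemma sum_dual (hσ : σ ∈ S.cones) (hn : σ.card = n) (m : Fin n → ℤ) :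
    ∑ r ∈ σ, S.dual σ r m • S.ray r = m := by
  rw [dual, dif_pos ⟨hσ, hn⟩]
  exact (S.exists_dual_basis hσ hn).choose_spec.2 m

lemma raySum_lin (hσ : σ ∈ S.cones) (hn : σ.card = n) (m : Fin n → ℤ) :
    S.raySum (S.lin σ m) = m := by
  rw [raySum_eq_sum]
  conv_rhs => rw [← sum_dual hσ hn m]
  simp only [lin_apply, ite_smul, zero_smul, Finset.sum_ite_mem, Finset.univ_inter]

lemma tphi_eq_lin (hσ : σ ∈ S.cones) (hn : σ.card = n) {m : Fin n → ℤ}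
    (h : ∀ i ∈ σ, 0 ≤ S.lin σ m i) : S.tphi m = S.lin σ m := by
  refine S.tphi_eq_of_nonneg hσ (fun i => ?_) (fun i hi => by simp [lin_apply, hi])
    (raySum_lin hσ hn m)
  by_cases hi : i ∈ σ
  · exact h i hi
  · simp [lin_apply, hi]

lemma lin_raySum (hσ : σ ∈ S.cones) (hn : σ.card = n) {v : ι → ℤ} (hv : ∀ i ∉ σ, v i = 0) :
    S.lin σ (S.raySum v) = v := by
  ext i
  rw [lin_apply]
  split_ifs with hi
  · exact S.dual_raySum (fun r hr s hs => dual_ray hσ hn hr hs) hv hi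
  · exact (hv i hi).symm

lemma lin_eq_tphi (hσ : σ ∈ S.cones) (hn : σ.card = n) {m : Fin n → ℤ} (h : S.supp m ⊆ σ) :
    S.lin σ m = S.tphi m := by
  conv_lhs => rw [← S.raySum_tphi m]
  refine lin_raySum hσ hn fun i hi => ?_
  by_contra h'
  exact hi (h (S.mem_supp.2 h'))

end

/-- The relation that expresses the generator of a ray through those of a cone of full
dimension. -/
def wall (σ : Finset ι) (r : ι) : ι → ℤ := Pi.single r 1 - S.lin σ (S.ray r)

lemma sum_smul_wall (σ : Finset ι) (v : ι → ℤ) :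
    ∑ r, v r • S.wall σ r = v - S.lin σ (S.raySum v) := by
  simp only [wall, smul_sub, Finset.sum_sub_distrib, raySum_eq_sum, map_sum, map_smul]
  congr 1
  ext i
  simp [Finset.sum_apply, Pi.single_apply]

lemma wall_eq_zero {σ : Finset ι} (hσ : σ ∈ S.cones) (hn : σ.card = n) {r : ι} (hr : r ∈ σ) :
    S.wall σ r = 0 := by
  rw [wall, lin_eq_tphi hσ hn (by simpa [supp_ray] using hr), tphi_ray, sub_self]

/-- The relation is the convexity defect of `tphi` between the ray and a point `M` deep inside `σ`:
adding the ray to `M` does not leave `σ`, where `tphi` agrees with `lin`. -/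
lemma exists_wall_eq {σ : Finset ι} (hσ : σ ∈ S.cones) (hn : σ.card = n) (r : ι) :
    ∃ M : Fin n → ℤ, σ ⊆ S.supp M ∧
      S.wall σ r = S.tphi (S.ray r) + S.tphi M - S.tphi (S.ray r + M) := by
  -- Large enough to outweigh every negative coordinate of the ray with respect to `σ`.
  set K : ℤ := 1 + ∑ i, |S.lin σ (S.ray r) i| with hK
  have hKpos : 0 < K := by
    have : 0 ≤ ∑ i, |S.lin σ (S.ray r) i| := Finset.sum_nonneg fun i _ => abs_nonneg _
    omega
  have hle : ∀ i, 0 ≤ S.lin σ (S.ray r) i + K := by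
    intro i
    have h1 := Finset.single_le_sum (f := fun i => |S.lin σ (S.ray r) i|)
      (fun i _ => abs_nonneg _) (Finset.mem_univ i)
    have h2 := neg_abs_le (S.lin σ (S.ray r) i)
    omega
  have hind : S.lin σ (S.raysSum σ) = fun i => if i ∈ σ then 1 else 0 := by
    rw [← raySum_indicator, lin_raySum hσ hn fun i hi => by simp [hi]]
  have hM : S.tphi (K • S.raysSum σ) = fun i => if i ∈ σ then K else 0 := by
    rw [tphi_eq_lin hσ hn, map_smul, hind]
    · ext i; simp
    · intro i hi
      rw [map_smul, hind]
      simp [hi, hKpos.le]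
  refine ⟨K • S.raysSum σ, fun i hi => ?_, ?_⟩
  · rw [mem_supp, hM]
    simp [hi, hKpos.ne']
  · have h2 : S.tphi (S.ray r + K • S.raysSum σ) =
        S.lin σ (S.ray r) + S.tphi (K • S.raysSum σ) := by
      rw [tphi_eq_lin hσ hn, map_add, hM, map_smul, hind]
      · congr 1
        ext i; simp
      · intro i hi
        rw [map_add, map_smul, hind]
        simpa [hi] using hle i
    rw [h2, tphi_ray, wall]
    abel

lemma plFun_eq (a : ι → ℤ) (m : Fin n → ℤ) : S.plFun a m = a ⬝ᵥ S.tphi m := rfl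

/-- Each relation `wall σ r` is a convexity defect of `tphi`. Conversely the defect at `m, m'` is a
nonnegative combination of the relations of a maximal cone containing `m + m'`. This turns nefness
into finitely many linear inequalities. -/
lemma isNef_iff (a : ι → ℤ) :
    S.IsNef a ↔ ∀ σ ∈ S.cones, σ.card = n → ∀ r, 0 ≤ a ⬝ᵥ S.wall σ r := by
  constructor
  · intro ha σ hσ hn r
    obtain ⟨M, -, hM⟩ := S.exists_wall_eq hσ hn r
    have := ha (S.ray r) M
    simp only [plFun_eq] at this
    rw [hM, dotProduct_sub, dotProduct_add]
    linarith
  · intro ha m m'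
    obtain ⟨σ, hσ, hsub, hn⟩ := S.exists_maximal (S.supp_mem_cones (m + m'))
    have h1 : S.tphi m + S.tphi m' - S.tphi (m + m') =
        ∑ r, (S.tphi m + S.tphi m') r • S.wall σ r := by
      rw [sum_smul_wall, ← lin_eq_tphi hσ hn hsub, map_add S.raySum, raySum_tphi, raySum_tphi]
    have h2 : 0 ≤ a ⬝ᵥ (S.tphi m + S.tphi m' - S.tphi (m + m')) := by
      rw [h1, dotProduct_sum]
      refine Finset.sum_nonneg fun r _ => ?_
      rw [dotProduct_smul, smul_eq_mul]
      exact mul_nonneg (add_nonneg (S.tphi_nonneg _ _) (S.tphi_nonneg _ _)) (ha σ hσ hn r)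
    simp only [plFun_eq]
    rw [dotProduct_sub, dotProduct_add] at h2
    linarith

/-- A divisor that is positive on all the nontrivial wall relations. -/
def IsAmple (a : ι → ℤ) : Prop :=
  ∀ σ ∈ S.cones, σ.card = n → ∀ r ∉ σ, 0 < a ⬝ᵥ S.wall σ r

/-- If a strictly convex function vanished on `wall σ r`, the ray `r` and an interior point of `σ`
would share a cone, which by maximality is `σ`. -/
lemma exists_isAmple (hS : S.IsProjective) : ∃ a, S.IsAmple a := by
  obtain ⟨a, ha, hstrict⟩ := hS
  refine ⟨a, fun σ hσ hn r hr => lt_of_le_of_ne ((S.isNef_iff a).1 ha σ hσ hn r) fun h => hr ?_⟩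
  obtain ⟨M, hsub, hM⟩ := S.exists_wall_eq hσ hn r
  rw [hM, dotProduct_sub, dotProduct_add] at h
  obtain ⟨τ, hτ, h1, h2⟩ := hstrict (S.ray r) M (by simp only [plFun_eq]; linarith)
  have hστ : σ ⊆ τ := fun i hi => by
    by_contra h'
    exact S.mem_supp.1 (hsub hi) (h2 i h')
  have heq : σ = τ := Finset.eq_of_subset_of_card_le hστ (by rw [hn]; exact S.card_le hτ)
  by_contra h'
  have := h1 r (heq ▸ h')
  simp [tphi_ray] at this

/-- There are finitely many relations and `a` is at least `1` on each nontrivial one, so a multiple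
of `a` absorbs the values of `b`. -/
lemma exists_isNef_add {a : ι → ℤ} (ha : S.IsAmple a) (b : ι → ℤ) :
    ∃ N : ℕ, S.IsNef ((N : ℤ) • a + b) := by
  classical
  refine ⟨∑ σ : Finset ι, ∑ r, (b ⬝ᵥ S.wall σ r).natAbs,
    (S.isNef_iff _).2 fun σ hσ hn r => ?_⟩
  by_cases hr : r ∈ σ
  · simp [S.wall_eq_zero hσ hn hr]
  · have h1 := ha σ hσ hn r hr
    have h2 : (b ⬝ᵥ S.wall σ r).natAbs ≤
        ∑ σ : Finset ι, ∑ r, (b ⬝ᵥ S.wall σ r).natAbs :=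
      (Finset.single_le_sum (f := fun r => (b ⬝ᵥ S.wall σ r).natAbs)
        (fun _ _ => Nat.zero_le _) (Finset.mem_univ r)).trans
      (Finset.single_le_sum (f := fun σ => ∑ r, (b ⬝ᵥ S.wall σ r).natAbs)
        (fun _ _ => Nat.zero_le _) (Finset.mem_univ σ))
    rw [add_dotProduct, smul_dotProduct, smul_eq_mul]
    set N := ∑ σ : Finset ι, ∑ r, (b ⬝ᵥ S.wall σ r).natAbs
    have h3 : (N : ℤ) * 1 ≤ N * (a ⬝ᵥ S.wall σ r) := by gcongr; omega
    omega

lemma mem_NE {β : ι → ℤ} :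
    β ∈ S.NE ↔ S.raySum β = 0 ∧ ∀ a, S.IsNef a → 0 ≤ a ⬝ᵥ β := Iff.rfl

lemma isNef_of_isAmple {a : ι → ℤ} (ha : S.IsAmple a) : S.IsNef a := by
  refine (S.isNef_iff a).2 fun σ hσ hn r => ?_
  by_cases hr : r ∈ σ
  · simp [S.wall_eq_zero hσ hn hr]
  · exact (ha σ hσ hn r hr).le

/-- For large `N` the divisor `N a - β` is nef. Pairing it with `β` gives `N (a · β) ≥ β · β > 0`.
-/
lemma pos_of_mem_NE {a : ι → ℤ} (ha : S.IsAmple a) {β : ι → ℤ} (hβ : β ∈ S.NE) (h0 : β ≠ 0) :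
    0 < a ⬝ᵥ β := by
  obtain ⟨N, hN⟩ := S.exists_isNef_add ha (-β)
  have h1 := hβ.2 _ hN
  change 0 ≤ ((N : ℤ) • a + -β) ⬝ᵥ β at h1
  rw [add_dotProduct, neg_dotProduct, smul_dotProduct, smul_eq_mul] at h1
  have h2 : 0 < β ⬝ᵥ β := by
    refine lt_of_le_of_ne (Finset.sum_nonneg fun i _ => mul_self_nonneg _) fun h => h0 ?_
    exact dotProduct_self_eq_zero.1 h.symm
  have h3 : (0 : ℤ) ≤ N := by positivity
  by_contra h4
  nlinarith

/-- There is an integral functional that is positive on the nonzero elements of `P_φ`. -/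
lemma exists_degree (hS : S.IsProjective) :
    ∃ δ : (ι → ℤ) →+ ℤ, ∀ v ∈ S.Pphi, v ≠ 0 → 0 < δ v := by
  obtain ⟨a, ha⟩ := S.exists_isAmple hS
  obtain ⟨σ, hσ, -, hn⟩ := S.exists_maximal S.empty_mem
  obtain ⟨N, hN⟩ := S.exists_isNef_add ha 1
  -- On `P` the term with `lin` drops out and `δ` is the sum of `a`, which is positive there, and of
  -- the nef divisor `N a + 1`. On vectors with nonnegative entries the first summand is nonnegative
  -- because `a` is nef, and the second is the sum of the entries. Every element of `P_φ` is a sum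
  -- of one vector of each kind.
  let δ : (ι → ℤ) →+ ℤ :=
    { toFun := fun v => ((N : ℤ) + 1) * (a ⬝ᵥ (v - S.lin σ (S.raySum v))) + 1 ⬝ᵥ v
      map_zero' := by simp
      map_add' := fun v w => by
        simp only [map_add, dotProduct_add, dotProduct_sub]
        ring }
  have hδ : ∀ v, δ v = ((N : ℤ) + 1) * (a ⬝ᵥ (v - S.lin σ (S.raySum v))) + 1 ⬝ᵥ v :=
    fun _ => rfl
  have hpos : ∀ v : ι → ℤ, (∀ i, 0 ≤ v i) → 0 ≤ δ v ∧ (v ≠ 0 → 0 < δ v) := by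
    intro v hv
    have h1 : 0 ≤ a ⬝ᵥ (v - S.lin σ (S.raySum v)) := by
      rw [← sum_smul_wall, dotProduct_sum]
      refine Finset.sum_nonneg fun r _ => ?_
      rw [dotProduct_smul, smul_eq_mul]
      exact mul_nonneg (hv r) ((S.isNef_iff a).1 (S.isNef_of_isAmple ha) σ hσ hn r)
    have h2 : 0 ≤ ((N : ℤ) + 1) * (a ⬝ᵥ (v - S.lin σ (S.raySum v))) := by positivity
    have h3 : (1 : ι → ℤ) ⬝ᵥ v = ∑ i, v i := by simp [dotProduct]
    have h4 : 0 ≤ ∑ i, v i := Finset.sum_nonneg fun i _ => hv i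
    rw [hδ, h3]
    refine ⟨by linarith, fun h0 => ?_⟩
    have h5 : 0 < ∑ i, v i := by
      refine lt_of_le_of_ne h4 fun h => h0 ?_
      ext i
      exact (Finset.sum_eq_zero_iff_of_nonneg fun i _ => hv i).1 h.symm i (Finset.mem_univ i)
    linarith
  have hNE : ∀ p ∈ S.NE, p ≠ 0 → 0 < δ p := by
    intro p hp h0
    have h1 := S.pos_of_mem_NE ha hp h0
    have h2 := hp.2 _ hN
    change 0 ≤ ((N : ℤ) • a + 1) ⬝ᵥ p at h2
    rw [add_dotProduct, smul_dotProduct, smul_eq_mul] at h2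
    rw [hδ, hp.1, map_zero, sub_zero]
    linarith
  refine ⟨δ, fun v hv h0 => ?_⟩
  have h1 : v = S.tphi (S.raySum v) + (v - S.tphi (S.raySum v)) := by abel
  obtain ⟨h2, h3⟩ := hpos (S.tphi (S.raySum v)) (S.tphi_nonneg _)
  by_cases h4 : v - S.tphi (S.raySum v) = 0
  · rw [sub_eq_zero] at h4
    rw [h4]
    exact h3 (h4 ▸ h0)
  · have := hNE _ hv h4
    rw [h1, map_add]
    linarith

/-- The monoid of effective curve classes is finitely generated. -/
lemma exists_NE_generators : ∃ G : Finset (ι → ℤ), AddSubmonoid.closure (G : Set (ι → ℤ)) = S.NE := by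
  classical
  let dotHom : (ι → ℤ) → (ι → ℤ) →+ ℤ := fun a =>
    { toFun := fun v => a ⬝ᵥ v
      map_zero' := dotProduct_zero _
      map_add' := fun v w => dotProduct_add _ _ _ }
  let J := {σ : Finset ι // σ ∈ S.cones ∧ σ.card = n} × ι
  -- The duality is used twice: generators `A` of the nef monoid give finitely many inequalities for
  -- `P`, and these in turn give generators of `P`.
  obtain ⟨A, hA⟩ := AddSubmonoid.exists_finset_of_halfspaces
    (fun j : J => dotHom (S.wall j.1.1 j.2))
  have hA' : ∀ a, a ∈ AddSubmonoid.closure (A : Set (ι → ℤ)) ↔ S.IsNef a := by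
    intro a
    rw [hA, isNef_iff]
    constructor
    · intro h σ hσ hn r
      rw [dotProduct_comm]
      exact h (⟨σ, hσ, hn⟩, r)
    · rintro h ⟨⟨σ, hσ, hn⟩, r⟩
      change 0 ≤ S.wall σ r ⬝ᵥ a
      rw [dotProduct_comm]
      exact h σ hσ hn r
  let coordHom : Fin n → (ι → ℤ) →+ ℤ := fun j =>
    (Pi.evalAddMonoidHom _ j).comp S.raySum.toAddMonoidHom
  obtain ⟨G, hG⟩ := AddSubmonoid.exists_finset_of_halfspaces
    (Sum.elim (fun a : A => dotHom a) (Sum.elim (fun j : Fin n => coordHom j)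
      fun j : Fin n => -coordHom j))
  refine ⟨G, ?_⟩
  ext β
  rw [hG, mem_NE]
  constructor
  · intro h
    refine ⟨?_, fun a ha => ?_⟩
    · ext j
      have h1 : 0 ≤ S.raySum β j := h (Sum.inr (Sum.inl j))
      have h2 : 0 ≤ -S.raySum β j := h (Sum.inr (Sum.inr j))
      simp only [Pi.zero_apply]
      omega
    · rw [← hA'] at ha
      induction ha using AddSubmonoid.closure_induction with
      | mem a ha => exact h (Sum.inl ⟨a, ha⟩)
      | zero => simp
      | add a b _ _ h1 h2 => rw [add_dotProduct]; linarith
  · rintro ⟨h1, h2⟩ (a | j | j)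
    · exact h2 a ((hA' a).1 (AddSubmonoid.subset_closure a.2))
    · change 0 ≤ S.raySum β j
      simp [h1]
    · change 0 ≤ -S.raySum β j
      simp [h1]

end SmoothCompleteFan

end LogLG

end

open scoped TensorProduct

noncomputable section

namespace LogLG

namespace SmoothCompleteFan

variable {n : ℕ} {ι : Type} [Fintype ι] [DecidableEq ι] (S : SmoothCompleteFan n ι)

/-! ### Coefficients of holomorphic functions -/

section Fourier

variable (T : Type)

/-- The point of `𝒳` given by a point of the compact torus. -/
def torusPt (y : UnitAddTorus (ι ⊕ T)) : S.Pt T :=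
  ({ toFun := fun v => ∏ i, fourier ((Multiplicative.toAdd v : S.Pphi).1 i) (y (Sum.inl i))
     map_one' := by simp
     map_mul' := fun v w => by
      simp only [toAdd_mul, AddSubmonoid.coe_add, Pi.add_apply, fourier_add,
        Finset.prod_mul_distrib] },
    fun i => fourier 1 (y (Sum.inr i)))

/-- The exponent of a monomial as an integral vector. -/
def expo (q : S.Pphi × (T →₀ ℕ)) : ι ⊕ T → ℤ := Sum.elim q.1.1 fun i => (q.2 i : ℤ)

lemma expo_injective : Function.Injective (S.expo T) := by
  rintro ⟨v, α⟩ ⟨w, β⟩ h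
  refine Prod.ext (Subtype.ext (funext fun i => congrFun h (Sum.inl i)))
    (Finsupp.ext fun i => ?_)
  have := congrFun h (Sum.inr i)
  simpa [expo] using this

lemma mon_torusPt [Fintype T] (q : S.Pphi × (T →₀ ℕ)) (y : UnitAddTorus (ι ⊕ T)) :
    S.mon T q (S.torusPt T y) = UnitAddTorus.mFourier (S.expo T q) y := by
  simp only [mon, torusPt, UnitAddTorus.mFourier, ContinuousMap.coe_mk, Fintype.prod_sum_type]
  congr 1
  rw [Finsupp.prod_fintype _ _ (by simp)]
  refine Finset.prod_congr rfl fun i _ => ?_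
  simp [expo, fourier_apply, AddCircle.toCircle_nsmul]

/-- On the compact torus the monomials restrict to distinct Fourier modes and the series converges
uniformly. The inner product with a mode extracts its coefficient. -/
lemma coefficients_eq_zero [Fintype T] {c : S.Pphi × (T →₀ ℕ) → ℂ}
    (hc : ∀ x, HasSum (fun q => c q * S.mon T q x) 0) : c = 0 := by
  have hnorm : Summable fun q => ‖c q‖ := by
    have h := (hc (S.torusPt T 0)).summable.norm
    refine h.congr fun q => ?_
    rw [norm_mul, mon_torusPt]
    simp [UnitAddTorus.mFourier]
  have hs : Summable fun q => c q • UnitAddTorus.mFourier (S.expo T q) := by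
    refine Summable.of_norm ?_
    simpa [norm_smul, UnitAddTorus.mFourier_norm] using hnorm
  have h0 : ∑' q, c q • UnitAddTorus.mFourier (S.expo T q) = 0 := by
    ext y
    have h1 := (ContinuousMap.hasSum_apply hs.hasSum y)
    have h2 := hc (S.torusPt T y)
    simp only [mon_torusPt] at h2
    exact h1.unique h2
  have hsum := hs.hasSum
  rw [h0] at hsum
  let _ : MeasureTheory.MeasureSpace UnitAddCircle := ⟨AddCircle.haarAddCircle⟩
  have : MeasureTheory.IsProbabilityMeasure
      (MeasureTheory.volume : MeasureTheory.Measure UnitAddCircle) :=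
    inferInstanceAs (MeasureTheory.IsProbabilityMeasure AddCircle.haarAddCircle)
  have hL : HasSum (fun q => c q • UnitAddTorus.mFourierLp 2 (S.expo T q)) 0 := by
    have := hsum.mapL (ContinuousMap.toLp (E := ℂ) 2 MeasureTheory.volume ℂ)
    simp only [map_smul, map_zero] at this
    exact this
  ext q
  have hI := hL.mapL (innerSL ℂ (UnitAddTorus.mFourierLp 2 (S.expo T q)))
  have hon := UnitAddTorus.orthonormal_mFourier (d := ι ⊕ T)
  rw [orthonormal_iff_ite] at hon
  have hI2 : HasSum (fun q' => if q' = q then c q' else 0) (0 : ℂ) := by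
    simp only [map_zero] at hI
    refine hI.congr_fun ?_
    intro q'
    rw [map_smul, innerSL_apply_apply, hon]
    by_cases h : q' = q
    · simp [h]
    · have h' : S.expo T q ≠ S.expo T q' := fun e => h (S.expo_injective T e.symm)
      simp [h, h']
  have := hI2.unique (hasSum_single q fun q' h => if_neg h)
  simpa using this.symm

end Fourier

/-- An integral functional that is positive on the nonzero elements of `P_φ`. -/
def degHom (hS : S.IsProjective) : (ι → ℤ) →+ ℤ := (S.exists_degree hS).choose

section

variable {S} (hS : S.IsProjective)

lemma degHom_pos {v : ι → ℤ} (hv : v ∈ S.Pphi) (h : v ≠ 0) : 0 < S.degHom hS v :=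
  (S.exists_degree hS).choose_spec v hv h

lemma degHom_nonneg {v : ι → ℤ} (hv : v ∈ S.Pphi) : 0 ≤ S.degHom hS v := by
  by_cases h : v = 0
  · simp [h]
  · exact (degHom_pos hS hv h).le

lemma eq_zero_of_add_eq_zero (hS : S.IsProjective) {v w : ι → ℤ} (hv : v ∈ S.Pphi) (hw : w ∈ S.Pphi) (h : v + w = 0) :
    v = 0 := by
  by_contra h0
  have h1 := degHom_pos hS hv h0
  have h2 := degHom_nonneg hS hw
  have h3 := congrArg (S.degHom hS) h
  rw [map_add, map_zero] at h3
  omega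

variable (T : Type)

/-- The degree of a monomial. -/
def mdeg (q : S.Pphi × (T →₀ ℕ)) : ℕ := (S.degHom hS q.1.1).toNat + q.2.degree

lemma mdeg_add (q r : S.Pphi × (T →₀ ℕ)) : mdeg hS T (q + r) = mdeg hS T q + mdeg hS T r := by
  have h1 := degHom_nonneg hS q.1.2
  have h2 := degHom_nonneg hS r.1.2
  simp only [mdeg, Prod.fst_add, Prod.snd_add, AddSubmonoid.coe_add, map_add]
  omega

/-- The point of `𝒳` at which each monomial of degree `d` takes the value `M ^ d`. -/
def radiusPt (M : ℝ) : S.Pt T :=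
  ({ toFun := fun v => (M : ℂ) ^ (S.degHom hS (Multiplicative.toAdd v : S.Pphi).1).toNat
     map_one' := by simp
     map_mul' := fun v w => by
      have h1 := degHom_nonneg hS (Multiplicative.toAdd v : S.Pphi).2
      have h2 := degHom_nonneg hS (Multiplicative.toAdd w : S.Pphi).2
      rw [← pow_add, toAdd_mul, AddSubmonoid.coe_add, map_add, Int.toNat_add h1 h2] },
    fun _ => M)

lemma mon_radiusPt (M : ℝ) (q : S.Pphi × (T →₀ ℕ)) :
    S.mon T q (radiusPt hS T M) = (M : ℂ) ^ mdeg hS T q := by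
  simp only [mon, radiusPt, mdeg, pow_add, MonoidHom.coe_mk, OneHom.coe_mk, toAdd_ofAdd]
  congr 1
  rw [Finsupp.prod, Finset.prod_pow_eq_pow_sum, Finsupp.degree_apply]

lemma mem_closure_generators {G : Finset (ι → ℤ)}
    (hG : AddSubmonoid.closure (G : Set (ι → ℤ)) = S.NE) {v : ι → ℤ} (hv : v ∈ S.Pphi) :
    v ∈ AddSubmonoid.closure ((G : Set (ι → ℤ)) ∪ Set.range fun r => Pi.single r 1) := by
  have h1 : v = (∑ r, (S.tphi (S.raySum v) r).toNat • Pi.single r 1) +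
      (v - S.tphi (S.raySum v)) := by
    have : (∑ r, (S.tphi (S.raySum v) r).toNat • (Pi.single r 1 : ι → ℤ)) =
        S.tphi (S.raySum v) := by
      ext i
      simp [Finset.sum_apply, Pi.single_apply, S.tphi_nonneg]
    rw [this]
    abel
  rw [h1]
  refine add_mem (sum_mem fun r _ => nsmul_mem (AddSubmonoid.subset_closure ?_) _) ?_
  · exact Or.inr ⟨r, rfl⟩
  · have h2 : v - S.tphi (S.raySum v) ∈ S.NE := hv
    rw [← hG] at h2
    exact AddSubmonoid.closure_mono Set.subset_union_left h2

/-- `P_φ` is generated by the finitely many generators of `P` together with the basis vectors. It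
suffices that `M` dominate `1`, the values at these generators and the parameters, since every
nonzero generator has degree at least `1`. -/
lemma exists_radius_le [Fintype T] (x : S.Pt T) :
    ∃ M : ℝ, 1 ≤ M ∧ ∀ q, ‖S.mon T q x‖ ≤ M ^ mdeg hS T q := by
  classical
  obtain ⟨G, hG⟩ := S.exists_NE_generators
  set A : Finset (ι → ℤ) := G ∪ Finset.univ.image fun r => Pi.single r 1 with hA
  let y : (ι → ℤ) → ℝ := fun v => if h : v ∈ S.Pphi then ‖x.1 (Multiplicative.ofAdd ⟨v, h⟩)‖ else 0
  have hy0 : ∀ v, 0 ≤ y v := fun v => by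
    simp only [y]
    split_ifs
    · exact norm_nonneg _
    · rfl
  set M : ℝ := 1 + ∑ v ∈ A, y v + ∑ i, ‖x.2 i‖ with hM
  have hAs : 0 ≤ ∑ v ∈ A, y v := Finset.sum_nonneg fun v _ => hy0 v
  have hTs : 0 ≤ ∑ i, ‖x.2 i‖ := Finset.sum_nonneg fun v _ => norm_nonneg _
  have hM1 : 1 ≤ M := by linarith
  refine ⟨M, hM1, fun q => ?_⟩
  have hP : ∀ v ∈ AddSubmonoid.closure ((G : Set (ι → ℤ)) ∪ Set.range fun r => Pi.single r 1),
      ∃ h : v ∈ S.Pphi, ‖x.1 (Multiplicative.ofAdd ⟨v, h⟩)‖ ≤ M ^ (S.degHom hS v).toNat := by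
    intro v hv
    induction hv using AddSubmonoid.closure_induction with
    | mem v hv =>
      have hvP : v ∈ S.Pphi := by
        rcases hv with hv | ⟨r, rfl⟩
        · exact S.NE_le_Pphi (hG ▸ AddSubmonoid.subset_closure hv)
        · exact S.single_mem_Pphi r
      refine ⟨hvP, ?_⟩
      by_cases h0 : v = 0
      · subst h0
        have : (Multiplicative.ofAdd (⟨0, hvP⟩ : S.Pphi)) = 1 := rfl
        simp [this]
      · have h1 := degHom_pos hS hvP h0
        have hvA : v ∈ A := by
          rw [hA, Finset.mem_union, Finset.mem_image]
          rcases hv with hv | ⟨r, rfl⟩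
          · exact Or.inl hv
          · exact Or.inr ⟨r, Finset.mem_univ _, rfl⟩
        have h2 := Finset.single_le_sum (fun v _ => hy0 v) hvA
        simp only [y, hvP, dif_pos] at h2
        calc _ ≤ M := by linarith
          _ = M ^ 1 := (pow_one _).symm
          _ ≤ _ := pow_le_pow_right₀ hM1 (by omega)
    | zero =>
      refine ⟨zero_mem _, ?_⟩
      have : (Multiplicative.ofAdd (⟨0, zero_mem _⟩ : S.Pphi)) = 1 := rfl
      simp [this]
    | add v w _ _ hv hw =>
      obtain ⟨h1, h2⟩ := hv
      obtain ⟨h3, h4⟩ := hw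
      refine ⟨add_mem h1 h3, ?_⟩
      have : (Multiplicative.ofAdd (⟨v + w, add_mem h1 h3⟩ : S.Pphi)) =
        Multiplicative.ofAdd ⟨v, h1⟩ * Multiplicative.ofAdd ⟨w, h3⟩ := rfl
      rw [this, map_mul, norm_mul, map_add,
        Int.toNat_add (degHom_nonneg hS h1) (degHom_nonneg hS h3), pow_add]
      exact mul_le_mul h2 h4 (norm_nonneg _) (by positivity)
  rw [mon, norm_mul, mdeg, pow_add]
  refine mul_le_mul (hP _ (mem_closure_generators hG q.1.2)).2 ?_ (norm_nonneg _) (by positivity)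
  rw [Finsupp.prod, norm_prod, Finsupp.degree_apply, ← Finset.prod_pow_eq_pow_sum]
  refine Finset.prod_le_prod (fun _ _ => norm_nonneg _) fun i _ => ?_
  rw [norm_pow]
  refine pow_le_pow_left₀ (norm_nonneg _) ?_ _
  have := Finset.single_le_sum (fun i _ => norm_nonneg (x.2 i)) (Finset.mem_univ i)
  linarith

/-- The growth condition that characterizes the coefficients of holomorphic functions. -/
def IsEntire (c : S.Pphi × (T →₀ ℕ) → ℂ) : Prop :=
  ∀ M : ℝ, 1 ≤ M → Summable fun q => ‖c q‖ * M ^ mdeg hS T q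

lemma IsEntire.summable [Fintype T] {c : S.Pphi × (T →₀ ℕ) → ℂ} (hc : IsEntire hS T c)
    (x : S.Pt T) : Summable fun q => c q * S.mon T q x := by
  obtain ⟨M, hM, h⟩ := exists_radius_le hS T x
  refine Summable.of_norm_bounded (hc M hM) fun q => ?_
  rw [norm_mul]
  exact mul_le_mul_of_nonneg_left (h q) (norm_nonneg _)

/-- For each `M` a single point is enough: at `radiusPt` every monomial of degree `d` takes the
value `M ^ d`. -/
lemma isEntire_of_summable {c : S.Pphi × (T →₀ ℕ) → ℂ}
    (h : ∀ x, Summable fun q => c q * S.mon T q x) : IsEntire hS T c := by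
  intro M hM
  have h1 := (h (radiusPt hS T M)).norm
  refine h1.congr fun q => ?_
  rw [norm_mul, mon_radiusPt, norm_pow, Complex.norm_real, Real.norm_of_nonneg (by linarith)]

/-- The holomorphic function with given coefficients. -/
def ofCoeff [Fintype T] (c : S.Pphi × (T →₀ ℕ) → ℂ) (hc : IsEntire hS T c) : S.holo T :=
  ⟨fun x => ∑' q, c q * S.mon T q x, c, fun x => (hc.summable hS T x).hasSum⟩

end

section Coeff

variable {S} {T : Type}

/-- The coefficients of a holomorphic function. -/
def coeff (f : S.holo T) : S.Pphi × (T →₀ ℕ) → ℂ := f.2.choose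

lemma hasSum_coeff (f : S.holo T) (x : S.Pt T) :
    HasSum (fun q => coeff f q * S.mon T q x) (f.1 x) := f.2.choose_spec x

lemma add_left_injective' (q₀ : S.Pphi × (T →₀ ℕ)) :
    Function.Injective fun q : S.Pphi × (T →₀ ℕ) => q₀ + q := by
  intro q r h
  have h1 : q₀ + q = q₀ + r := h
  refine Prod.ext (Subtype.ext ?_) ?_
  · have := congrArg (fun z => (z.1 : ι → ℤ)) h1
    simpa using this
  · have := congrArg Prod.snd h1
    simpa using this

variable [Fintype T]

lemma coeff_eq {f : S.holo T} {c : S.Pphi × (T →₀ ℕ) → ℂ}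
    (h : ∀ x, HasSum (fun q => c q * S.mon T q x) (f.1 x)) : coeff f = c := by
  have := S.coefficients_eq_zero T (c := coeff f - c) fun x => by
    simpa [sub_mul] using (hasSum_coeff f x).sub (h x)
  exact sub_eq_zero.1 this

lemma coeff_ext {T : Type} {f g : S.holo T} (h : ∀ q, coeff f q = coeff g q) : f = g := by
  refine Subtype.ext (funext fun x => ?_)
  have h1 := hasSum_coeff f x
  rw [funext h] at h1
  exact h1.unique (hasSum_coeff g x)

lemma coeff_add (f g : S.holo T) : coeff (f + g) = coeff f + coeff g :=
  coeff_eq fun x => by simpa [add_mul] using (hasSum_coeff f x).add (hasSum_coeff g x)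

lemma coeff_smul (a : ℂ) (f : S.holo T) : coeff (a • f) = a • coeff f :=
  coeff_eq fun x => by simpa [mul_assoc] using (hasSum_coeff f x).mul_left a

lemma coeff_zero : coeff (0 : S.holo T) = 0 :=
  coeff_eq fun x => by simp [hasSum_zero]

lemma coeff_sub (f g : S.holo T) : coeff (f - g) = coeff f - coeff g :=
  coeff_eq fun x => by simpa [sub_mul] using (hasSum_coeff f x).sub (hasSum_coeff g x)

lemma coeff_sum {J : Type*} (s : Finset J) (f : J → S.holo T) :
    coeff (∑ j ∈ s, f j) = ∑ j ∈ s, coeff (f j) := by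
  classical
  induction s using Finset.induction_on with
  | empty => simp [coeff_zero]
  | insert a s ha ih => rw [Finset.sum_insert ha, Finset.sum_insert ha, coeff_add, ih]

lemma coeff_ofCoeff (hS : S.IsProjective) (c : S.Pphi × (T →₀ ℕ) → ℂ) (hc : IsEntire hS T c) :
    coeff (ofCoeff hS T c hc) = c :=
  coeff_eq fun x => (hc.summable hS T x).hasSum

lemma isEntire_coeff {T : Type} (hS : S.IsProjective) (f : S.holo T) : IsEntire hS T (coeff f) :=
  isEntire_of_summable hS T fun x => (hasSum_coeff f x).summable

lemma coeff_monH_mul (q₀ : S.Pphi × (T →₀ ℕ)) (f : S.holo T) :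
    coeff (S.monH T q₀ * f) = Function.extend (fun q => q₀ + q) (coeff f) 0 := by
  refine coeff_eq fun x => ?_
  have hinj := add_left_injective' q₀
  rw [← hinj.hasSum_iff]
  · have h := (hasSum_coeff f x).mul_left (S.mon T q₀ x)
    refine h.congr_fun fun q => ?_
    simp only [Function.comp, hinj.extend_apply, mon_add]
    ring
  · intro q hq
    rw [Function.extend_apply' _ _ _ (by simpa using hq)]
    simp

lemma coeff_monH_mul_add (q₀ q : S.Pphi × (T →₀ ℕ)) (f : S.holo T) :
    coeff (S.monH T q₀ * f) (q₀ + q) = coeff f q := by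
  rw [coeff_monH_mul, (add_left_injective' q₀).extend_apply]

lemma coeff_monH_mul_of_forall_ne {q₀ q : S.Pphi × (T →₀ ℕ)} (h : ∀ r, q₀ + r ≠ q)
    (f : S.holo T) : coeff (S.monH T q₀ * f) q = 0 := by
  rw [coeff_monH_mul, Function.extend_apply' _ _ _ (by simpa using h)]
  rfl

lemma coeff_monH (q : S.Pphi × (T →₀ ℕ)) [DecidableEq (S.Pphi × (T →₀ ℕ))] :
    coeff (S.monH T q) = Pi.single q 1 := by
  refine coeff_eq fun x => ?_
  have := hasSum_single (f := fun r => (Pi.single q (1 : ℂ) : _ → ℂ) r * S.mon T r x) q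
    (fun r hr => by simp [hr])
  simpa [monH] using this

end Coeff

end SmoothCompleteFan

end LogLG

end

open scoped TensorProduct

noncomputable section

namespace LogLG

namespace SmoothCompleteFan

variable {n : ℕ} {ι : Type} [Fintype ι] [DecidableEq ι] (S : SmoothCompleteFan n ι)

/-! ### Coefficients over the base -/

section BaseMonomials

variable (T : Type)

/-- The exponents `(p, α)` of the monomials `z^p t^α` of the base. -/
abbrev BaseExp : Type := S.NE × (T →₀ ℕ)

variable {T}

/-- The exponent of the monomial `z^p t^α` on the total space. -/
def baseExp (w : S.BaseExp T) : S.Pphi × (T →₀ ℕ) := (⟨w.1.1, S.NE_le_Pphi w.1.2⟩, w.2)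

lemma tphi_mem_Pphi (m : Fin n → ℤ) : S.tphi m ∈ S.Pphi := by
  change S.tphi m - S.tphi (S.raySum (S.tphi m)) ∈ S.NE
  rw [raySum_tphi, sub_self]
  exact zero_mem _

/-- The exponent of the monomial `z^{φ(m)} z^p t^α`. -/
def key (m : Fin n → ℤ) (w : S.BaseExp T) : S.Pphi × (T →₀ ℕ) :=
  (⟨S.tphi m, S.tphi_mem_Pphi m⟩, 0) + S.baseExp w

lemma baseExp_add (w w' : S.BaseExp T) :
    S.baseExp (w + w') = S.baseExp w + S.baseExp w' := rfl

lemma key_fst (m : Fin n → ℤ) (w : S.BaseExp T) : ((S.key m w).1 : ι → ℤ) = S.tphi m + w.1.1 := rfl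

lemma key_snd (m : Fin n → ℤ) (w : S.BaseExp T) : (S.key m w).2 = w.2 := zero_add _

lemma baseExp_add_key (w₀ w : S.BaseExp T) (m : Fin n → ℤ) :
    S.baseExp w₀ + S.key m w = S.key m (w₀ + w) := by
  rw [key, key, baseExp_add]
  abel

lemma raySum_key (m : Fin n → ℤ) (w : S.BaseExp T) : S.raySum (S.key m w).1.1 = m := by
  rw [key_fst, map_add, raySum_tphi, w.1.2.1, add_zero]

lemma key_injective {m m' : Fin n → ℤ} {w w' : S.BaseExp T} (h : S.key m w = S.key m' w') :
    m = m' ∧ w = w' := by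
  have h1 : m = m' := by rw [← S.raySum_key m w, h, raySum_key]
  subst h1
  refine ⟨rfl, Prod.ext (Subtype.ext ?_) ?_⟩
  · have := congrArg (fun q => (q.1 : ι → ℤ)) h
    simpa [key_fst] using this
  · rw [← S.key_snd m w, h, key_snd]

lemma exists_key (q : S.Pphi × (T →₀ ℕ)) : ∃ m w, S.key m w = q := by
  refine ⟨S.raySum q.1.1, (⟨q.1.1 - S.tphi (S.raySum q.1.1), q.1.2⟩, q.2), ?_⟩
  refine Prod.ext (Subtype.ext ?_) (S.key_snd _ _)
  exact add_sub_cancel _ _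

/-- The exponents of monomials on the total space as pairs of a point of `N` and an exponent
of the base. -/
def keyEquiv : (Fin n → ℤ) × S.BaseExp T ≃ S.Pphi × (T →₀ ℕ) :=
  Equiv.ofBijective (fun x => S.key x.1 x.2)
    ⟨fun x y h => Prod.ext (S.key_injective h).1 (S.key_injective h).2, fun q => by
      obtain ⟨m, w, h⟩ := S.exists_key q
      exact ⟨(m, w), h⟩⟩

lemma exists_of_baseExp_add {w₀ w : S.BaseExp T} {m : Fin n → ℤ} {q : S.Pphi × (T →₀ ℕ)}
    (h : S.baseExp w₀ + q = S.key m w) : ∃ w', w₀ + w' = w ∧ q = S.key m w' := by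
  obtain ⟨m', w', rfl⟩ := S.exists_key q
  rw [baseExp_add_key] at h
  obtain ⟨rfl, h2⟩ := S.key_injective h
  exact ⟨w', h2, rfl⟩

lemma baseExp_eq_zero_of_add (hS : S.IsProjective) {w w' : S.BaseExp T} (h : w + w' = 0) :
    w = 0 := by
  refine Prod.ext (Subtype.ext ?_) ?_
  · have := congrArg (fun w => (w.1 : ι → ℤ)) h
    exact eq_zero_of_add_eq_zero hS (S.NE_le_Pphi w.1.2) (S.NE_le_Pphi w'.1.2) this
  · have := congrArg Prod.snd h
    simpa using (add_eq_zero.1 this).1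

/-- The monomial `z^p t^α` as a function on the total space. -/
def baseMon (w : S.BaseExp T) : S.holo T := S.monH T (S.baseExp w)

/-- The function `z^{φ(m)}`. -/
def theta (m : Fin n → ℤ) : S.holo T := S.monH T (S.key m 0)

end BaseMonomials

section Co

variable {S} {T : Type}

/-- The coefficient of `z^{φ(m)} z^p t^α`. -/
def co (f : S.holo T) (m : Fin n → ℤ) (w : S.BaseExp T) : ℂ := coeff f (S.key m w)

lemma co_ext {f g : S.holo T} (h : ∀ m w, co f m w = co g m w) : f = g :=
  coeff_ext fun q => by
    obtain ⟨m, w, rfl⟩ := S.exists_key q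
    exact h m w

variable [Fintype T]

lemma co_add (f g : S.holo T) (m : Fin n → ℤ) (w : S.BaseExp T) :
    co (f + g) m w = co f m w + co g m w := by simp [co, coeff_add]

lemma co_sub (f g : S.holo T) (m : Fin n → ℤ) (w : S.BaseExp T) :
    co (f - g) m w = co f m w - co g m w := by simp [co, coeff_sub]

lemma co_smul (a : ℂ) (f : S.holo T) (m : Fin n → ℤ) (w : S.BaseExp T) :
    co (a • f) m w = a * co f m w := by simp [co, coeff_smul]

lemma co_zero (m : Fin n → ℤ) (w : S.BaseExp T) : co (0 : S.holo T) m w = 0 := by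
  simp [co, coeff_zero]

lemma co_sum {J : Type*} (s : Finset J) (f : J → S.holo T) (m : Fin n → ℤ) (w : S.BaseExp T) :
    co (∑ j ∈ s, f j) m w = ∑ j ∈ s, co (f j) m w := by simp [co, coeff_sum]

lemma co_baseMon_mul_add (w₀ w : S.BaseExp T) (f : S.holo T) (m : Fin n → ℤ) :
    co (S.baseMon w₀ * f) m (w₀ + w) = co f m w := by
  rw [co, baseMon, ← baseExp_add_key, coeff_monH_mul_add]
  rfl

lemma co_baseMon_mul_of_ne {w₀ w : S.BaseExp T} (h : ∀ w', w₀ + w' ≠ w) (f : S.holo T)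
    (m : Fin n → ℤ) : co (S.baseMon w₀ * f) m w = 0 := by
  refine coeff_monH_mul_of_forall_ne (fun r hr => ?_) f
  obtain ⟨w', h1, -⟩ := S.exists_of_baseExp_add hr
  exact h w' h1

open Classical in
lemma co_theta (m₀ m : Fin n → ℤ) (w : S.BaseExp T) :
    co (S.theta m₀) m w = if m = m₀ ∧ w = 0 then 1 else 0 := by
  rw [co, theta, coeff_monH, Pi.single_apply]
  refine if_congr ⟨fun h => S.key_injective h, ?_⟩ rfl rfl
  rintro ⟨rfl, rfl⟩
  rfl

end Co

/-! ### Construction of functions from coefficients -/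

section OfCo

variable {S} (hS : S.IsProjective) {T : Type}

/-- The growth condition of `IsEntire`, in terms of `co`. -/
def IsEntireCo (c : (Fin n → ℤ) → S.BaseExp T → ℂ) : Prop :=
  ∀ M : ℝ, 1 ≤ M → Summable fun x : (Fin n → ℤ) × S.BaseExp T =>
    ‖c x.1 x.2‖ * M ^ mdeg hS T (S.key x.1 x.2)

lemma isEntireCo_co (f : S.holo T) : IsEntireCo hS (co f) := fun M hM =>
  (S.keyEquiv.summable_iff (f := fun q => ‖coeff f q‖ * M ^ mdeg hS T q)).2
    (isEntire_coeff hS f M hM)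

/-- Reindexing coefficients injectively, without raising degrees, and multiplying them
by bounded factors. -/
lemma IsEntireCo.reindex {c : (Fin n → ℤ) → S.BaseExp T → ℂ} (hc : IsEntireCo hS c)
    (g : (Fin n → ℤ) → S.BaseExp T → ℂ)
    (j : (Fin n → ℤ) × S.BaseExp T → (Fin n → ℤ) × S.BaseExp T) (C : ℝ)
    (hC : ∀ m w, ‖g m w‖ ≤ C)
    (hinj : ∀ x y, g x.1 x.2 ≠ 0 → g y.1 y.2 ≠ 0 → j x = j y → x = y)
    (hdeg : ∀ x, g x.1 x.2 ≠ 0 →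
      mdeg hS T (S.key x.1 x.2) ≤ mdeg hS T (S.key (j x).1 (j x).2)) :
    IsEntireCo hS fun m w => g m w * c (j (m, w)).1 (j (m, w)).2 := by
  intro M hM
  set s : Set ((Fin n → ℤ) × S.BaseExp T) := {x | g x.1 x.2 ≠ 0}
  have h1 : Summable fun x : s =>
      ‖c (j x).1 (j x).2‖ * M ^ mdeg hS T (S.key (j x).1 (j x).2) :=
    (hc M hM).comp_injective (i := fun x : s => j x)
      fun x y h => Subtype.ext (hinj x y x.2 y.2 h)
  have h2 := (summable_subtype_iff_indicator (s := s) (f := fun x =>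
    ‖c (j x).1 (j x).2‖ * M ^ mdeg hS T (S.key (j x).1 (j x).2))).1 h1
  refine Summable.of_nonneg_of_le (fun x => by positivity) (fun x => ?_) (h2.mul_left C)
  by_cases hx : x ∈ s
  · rw [Set.indicator_of_mem hx, norm_mul, mul_assoc]
    have h0 : 0 ≤ C := (norm_nonneg _).trans (hC x.1 x.2)
    refine mul_le_mul (hC _ _) ?_ (by positivity) h0
    exact mul_le_mul_of_nonneg_left (pow_le_pow_right₀ hM (hdeg x hx)) (norm_nonneg _)
  · have : g x.1 x.2 = 0 := by simpa [s] using hx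
    simp [Set.indicator_of_notMem hx, this]

variable [Fintype T]

lemma IsEntireCo.isEntire {T : Type} {c : (Fin n → ℤ) → S.BaseExp T → ℂ}
    (hc : IsEntireCo hS c) :
    IsEntire hS T fun q => c (S.keyEquiv.symm q).1 (S.keyEquiv.symm q).2 := fun M hM =>
  (S.keyEquiv.summable_iff).1 (by
    refine (hc M hM).congr fun x => ?_
    simp only [Function.comp, Equiv.symm_apply_apply]
    rfl)

/-- The holomorphic function with given coefficients. -/
def ofCo (c : (Fin n → ℤ) → S.BaseExp T → ℂ) (hc : IsEntireCo hS c) : S.holo T :=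
  ofCoeff hS T (fun q => c (S.keyEquiv.symm q).1 (S.keyEquiv.symm q).2)
    (hc.isEntire hS)

lemma co_ofCo (c : (Fin n → ℤ) → S.BaseExp T → ℂ) (hc : IsEntireCo hS c) (m : Fin n → ℤ)
    (w : S.BaseExp T) : co (ofCo hS c hc) m w = c m w := by
  rw [co, ofCo, coeff_ofCoeff]
  have : S.keyEquiv.symm (S.key m w) = (m, w) :=
    (Equiv.symm_apply_eq _).2 rfl
  rw [this]

end OfCo

/-! ### The action of the base ring -/

section BaseRing

variable {T : Type}

/-- A monomial of the base ring. -/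
def rmon (w : S.BaseExp T) (a : ℂ) : S.R T :=
  MvPolynomial.monomial w.2 (AddMonoidAlgebra.single w.1 a)

lemma rmon_mul (w w' : S.BaseExp T) (a b : ℂ) :
    S.rmon w a * S.rmon w' b = S.rmon (w + w') (a * b) := by
  rw [rmon, rmon, MvPolynomial.monomial_mul, AddMonoidAlgebra.single_mul_single]
  rfl

/-- Additive induction on the base ring. -/
lemma rmon_induction {p : S.R T → Prop} (hadd : ∀ r s, p r → p s → p (r + s))
    (hmon : ∀ w a, p (S.rmon w a)) (r : S.R T) : p r := by
  induction r using MvPolynomial.induction_on' with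
  | monomial α x =>
    induction x using AddMonoidAlgebra.induction_linear with
    | zero =>
      have := hmon (0, α) 0
      rwa [rmon, AddMonoidAlgebra.single_zero] at this
    | add f g hf hg => rw [map_add]; exact hadd _ _ hf hg
    | single w a => exact hmon (w, α) a
  | add r s hr hs => exact hadd r s hr hs

lemma smul_eq (r : S.R T) (f : S.holo T) : r • f = S.pull T r * f := rfl

lemma pull_rmon (w : S.BaseExp T) (a : ℂ) : S.pull T (S.rmon w a) = a • S.baseMon w := by
  refine Subtype.ext (funext fun x => ?_)
  rw [pull, rmon, MvPolynomial.coe_eval₂Hom, MvPolynomial.eval₂_monomial]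
  have h1 : (S.pullP T).toRingHom (AddMonoidAlgebra.single w.1 a) =
      a • S.monH T (⟨w.1.1, S.NE_le_Pphi w.1.2⟩, 0) := by
    change S.pullP T (AddMonoidAlgebra.single w.1 a) = _
    rw [pullP, AddMonoidAlgebra.lift_single]
    rfl
  rw [h1]
  have h2 : ∀ α : T →₀ ℕ, ((α.prod fun i e => S.monH T (0, Finsupp.single i 1) ^ e : S.holo T)).1 x =
      S.mon T (0, α) x := by
    intro α
    rw [Finsupp.prod, ← Subalgebra.coe_val, map_prod, Finset.prod_apply]
    simp only [map_pow, Pi.pow_apply]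
    simp only [mon]
    rw [show (Multiplicative.ofAdd ((0 : S.Pphi), α).1) = 1 from rfl, map_one, one_mul, Finsupp.prod]
    refine Finset.prod_congr rfl fun i _ => ?_
    simp only [Subalgebra.coe_val, monH, mon]
    rw [show (Multiplicative.ofAdd ((0 : S.Pphi), Finsupp.single i 1).1) = 1 from rfl, map_one,
      one_mul, Finsupp.prod_single_index (by simp), pow_one]
  change (a * S.mon T _ x) * ((w.2.prod fun i e => S.monH T (0, Finsupp.single i 1) ^ e :
    S.holo T)).1 x = a * S.mon T _ x
  rw [h2, mul_assoc, ← mon_add]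
  congr 2
  exact Prod.ext (add_zero _) (zero_add _)

lemma rmon_smul (w : S.BaseExp T) (a : ℂ) (f : S.holo T) :
    S.rmon w a • f = a • (S.baseMon w * f) := by
  rw [smul_eq, pull_rmon, smul_mul_assoc]

/-- A `ℂ`-linear map that commutes with multiplication by the monomials of the base is linear over
the base ring. -/
def linearOfMonomials (A : S.holo T →ₗ[ℂ] S.holo T)
    (h : ∀ w f, A (S.baseMon w * f) = S.baseMon w * A f) : S.holo T →ₗ[S.R T] S.holo T where
  toFun := A
  map_add' := map_add A
  map_smul' r f := by
    simp only [RingHom.id_apply]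
    induction r using S.rmon_induction with
    | hadd r s hr hs => rw [add_smul, map_add, hr, hs, add_smul]
    | hmon w a => rw [rmon_smul, map_smul, h, rmon_smul]

/-- The coefficient of a monomial in an element of the base ring. -/
def rcoeff (r : S.R T) (w : S.BaseExp T) : ℂ := (MvPolynomial.coeff w.2 r).coeff w.1

lemma rcoeff_add (r s : S.R T) (w : S.BaseExp T) :
    S.rcoeff (r + s) w = S.rcoeff r w + S.rcoeff s w := by
  simp [rcoeff]

open Classical in
lemma rcoeff_rmon (w w' : S.BaseExp T) (a : ℂ) :
    S.rcoeff (S.rmon w a) w' = if w = w' then a else 0 := by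
  rw [rcoeff, rmon, MvPolynomial.coeff_monomial]
  by_cases h1 : w.2 = w'.2
  · rw [if_pos h1, AddMonoidAlgebra.coeff_single, Finsupp.single_apply]
    refine if_congr ⟨fun h => Prod.ext h h1, fun h => congrArg Prod.fst h⟩ rfl rfl
  · rw [if_neg h1, if_neg fun h => h1 (congrArg Prod.snd h)]
    rfl

variable {S}

lemma co_smul_theta [Fintype T] (r : S.R T) (m : Fin n → ℤ) (w : S.BaseExp T) :
    co (r • S.theta m) m w = S.rcoeff r w := by
  classical
  induction r using S.rmon_induction with
  | hadd r s hr hs => rw [add_smul, co_add, hr, hs, rcoeff_add]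
  | hmon w' a =>
    rw [rmon_smul, co_smul, rcoeff_rmon]
    by_cases h : ∃ w'', w' + w'' = w
    · obtain ⟨w'', rfl⟩ := h
      rw [co_baseMon_mul_add, co_theta]
      by_cases h0 : w'' = 0
      · simp [h0]
      · have : w' ≠ w' + w'' := fun h => h0 (by simpa using h)
        simp [h0, this]
    · push Not at h
      rw [co_baseMon_mul_of_ne h, if_neg fun e => h 0 (by simpa using e), mul_zero]

end BaseRing

end SmoothCompleteFan

end LogLG

end

open scoped TensorProduct

noncomputable section

namespace LogLG

namespace SmoothCompleteFan

variable {n : ℕ} {ι : Type} [Fintype ι] [DecidableEq ι] (S : SmoothCompleteFan n ι)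

/-! ### The powers of the ideal of the base point -/

section Deep

variable {T : Type}

/-- The exponent `w` is the sum of at least `k` nonzero exponents. -/
def Deep : ℕ → S.BaseExp T → Prop
  | 0, _ => True
  | k + 1, w => ∃ w₀ w', w₀ ≠ 0 ∧ w = w₀ + w' ∧ Deep k w'

lemma Deep.add {k : ℕ} {w : S.BaseExp T} (h : S.Deep k w) (v : S.BaseExp T) :
    S.Deep k (v + w) := by
  induction k generalizing w with
  | zero => trivial
  | succ k ih =>
    obtain ⟨w₀, w', h0, rfl, h1⟩ := h
    exact ⟨w₀, v + w', h0, by abel, ih h1⟩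

lemma deep_one_iff {w : S.BaseExp T} (hS : S.IsProjective) : S.Deep 1 w ↔ w ≠ 0 := by
  constructor
  · rintro ⟨w₀, w', h0, rfl, -⟩ h
    exact h0 (S.baseExp_eq_zero_of_add hS h)
  · intro h
    exact ⟨w, 0, h, by simp, trivial⟩

lemma rmon_mem_maxIdeal {w : S.BaseExp T} (h : w ≠ 0) (a : ℂ) : S.rmon w a ∈ S.maxIdeal T := by
  by_cases hp : w.1 = 0
  · have hα : w.2 ≠ 0 := fun h' => h (Prod.ext hp h')
    obtain ⟨i, hi⟩ := Finsupp.ne_iff.1 hα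
    have h1 : w = (0, Finsupp.single i 1) + (w.1, w.2 - Finsupp.single i 1) := by
      refine Prod.ext (by simp) ?_
      simp only [Prod.snd_add]
      rw [add_tsub_cancel_of_le]
      simpa [Finsupp.single_le_iff, Nat.one_le_iff_ne_zero] using hi
    rw [h1, ← one_mul a, ← rmon_mul]
    refine Ideal.mul_mem_right _ _ (Ideal.subset_span (Or.inr ⟨i, ?_⟩))
    rfl
  · have h1 : w = (w.1, 0) + (0, w.2) := by ext <;> simp
    rw [h1, ← one_mul a, ← rmon_mul]
    refine Ideal.mul_mem_right _ _ (Ideal.subset_span (Or.inl ⟨w.1, hp, ?_⟩))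
    rfl

lemma rmon_mem_pow {k : ℕ} {w : S.BaseExp T} (h : S.Deep k w) (a : ℂ) :
    S.rmon w a ∈ S.maxIdeal T ^ k := by
  induction k generalizing w a with
  | zero => simp
  | succ k ih =>
    obtain ⟨w₀, w', h0, rfl, h1⟩ := h
    rw [← one_mul a, ← rmon_mul, pow_succ']
    exact Ideal.mul_mem_mul (S.rmon_mem_maxIdeal h0 1) (ih h1 a)

lemma maxIdeal_le {J : Ideal (S.R T)} (h : ∀ w ≠ 0, S.rmon w 1 ∈ J) : S.maxIdeal T ≤ J := by
  refine Ideal.span_le.2 ?_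
  rintro _ (⟨p, hp, rfl⟩ | ⟨i, rfl⟩)
  · exact h (p, 0) fun h' => hp (congrArg Prod.fst h')
  · refine h (0, Finsupp.single i 1) fun h' => ?_
    have := congrArg Prod.snd h'
    simp at this

lemma sum_rmon (r : S.R T) : ∃ s : Finset (S.BaseExp T), r = ∑ w ∈ s, S.rmon w (S.rcoeff r w) := by
  classical
  have key : ∃ s : Finset (S.BaseExp T), (∀ w ∉ s, S.rcoeff r w = 0) ∧
      r = ∑ w ∈ s, S.rmon w (S.rcoeff r w) := by
    have zero : ∀ w : S.BaseExp T, S.rmon w 0 = 0 := fun w => by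
      rw [rmon, AddMonoidAlgebra.single_zero, map_zero]
    have radd : ∀ (w : S.BaseExp T) a b, S.rmon w (a + b) = S.rmon w a + S.rmon w b := fun w a b => by
      rw [rmon, AddMonoidAlgebra.single_add, map_add]; rfl
    induction r using S.rmon_induction with
    | hadd r s hr hs =>
      obtain ⟨A, hA, hA'⟩ := hr
      obtain ⟨B, hB, hB'⟩ := hs
      refine ⟨A ∪ B, fun w hw => ?_, ?_⟩
      · rw [Finset.mem_union, not_or] at hw
        rw [rcoeff_add, hA w hw.1, hB w hw.2, add_zero]
      · simp only [rcoeff_add, radd, Finset.sum_add_distrib]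
        rw [← Finset.sum_subset Finset.subset_union_left fun w _ hw => by rw [hA w hw, zero],
          ← Finset.sum_subset Finset.subset_union_right fun w _ hw => by rw [hB w hw, zero],
          ← hA', ← hB']
    | hmon w a =>
      refine ⟨{w}, fun w' hw' => ?_, ?_⟩
      · rw [rcoeff_rmon, if_neg fun h => hw' (by simp [h])]
      · rw [Finset.sum_singleton, rcoeff_rmon, if_pos rfl]
  obtain ⟨s, -, h⟩ := key
  exact ⟨s, h⟩

lemma mem_pow_of_rcoeff {k : ℕ} {r : S.R T} (h : ∀ w, ¬S.Deep k w → S.rcoeff r w = 0) :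
    r ∈ S.maxIdeal T ^ k := by
  obtain ⟨s, hs⟩ := S.sum_rmon r
  rw [hs]
  refine sum_mem fun w _ => ?_
  by_cases hw : S.Deep k w
  · exact S.rmon_mem_pow hw _
  · rw [h w hw, rmon, AddMonoidAlgebra.single_zero, map_zero]
    exact zero_mem _

variable [Fintype T]

/-- The functions whose monomials are all divisible by `k` nontrivial monomials of the base. -/
def deepSubmodule (k : ℕ) : Submodule (S.R T) (S.holo T) where
  carrier := {f | ∀ m w, ¬S.Deep k w → co f m w = 0}
  zero_mem' := fun m w _ => co_zero m w
  add_mem' := fun hf hg m w hw => by rw [co_add, hf m w hw, hg m w hw, add_zero]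
  smul_mem' := fun r f hf m w hw => by
    induction r using S.rmon_induction with
    | hadd r s hr hs => rw [add_smul, co_add, hr, hs, add_zero]
    | hmon w' a =>
      rw [rmon_smul, co_smul]
      by_cases h : ∃ w'', w' + w'' = w
      · obtain ⟨w'', rfl⟩ := h
        rw [co_baseMon_mul_add, hf m w'' fun h => hw (h.add S w'), mul_zero]
      · push Not at h
        rw [co_baseMon_mul_of_ne h, mul_zero]

/-- Only this inclusion is needed: it certifies from the coefficients that a function does not lie
in `𝓘 ^ k 𝒪(𝒳)`. -/
lemma pow_smul_top_le (k : ℕ) :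
    (S.maxIdeal T ^ k • ⊤ : Submodule (S.R T) (S.holo T)) ≤ S.deepSubmodule k := by
  induction k with
  | zero => exact fun f _ m w hw => (hw trivial).elim
  | succ k ih =>
    rw [pow_succ', Submodule.mul_smul]
    refine (Submodule.smul_mono le_rfl ih).trans (Submodule.smul_le.2 fun r hr f hf => ?_)
    have hle : S.maxIdeal T ≤
        (S.deepSubmodule (k + 1)).comap (LinearMap.toSpanSingleton (S.R T) (S.holo T) f) := by
      refine S.maxIdeal_le fun w₀ h0 => ?_
      rw [Submodule.mem_comap, LinearMap.toSpanSingleton_apply]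
      intro m w hw
      rw [rmon_smul, co_smul]
      by_cases h : ∃ w', w₀ + w' = w
      · obtain ⟨w', rfl⟩ := h
        rw [co_baseMon_mul_add, hf m w' fun h => hw ⟨w₀, w', h0, rfl, h⟩, mul_zero]
      · push Not at h
        rw [co_baseMon_mul_of_ne h, mul_zero]
    exact hle hr

/-- The source of linear independence over `ℛ_k`: the coefficients of `r` can be read off the
multiple `r z^{φ(m)}`. -/
lemma mem_pow_of_smul_theta {k : ℕ} {r : S.R T} {m : Fin n → ℤ}
    (h : r • S.theta m ∈ (S.maxIdeal T ^ k • ⊤ : Submodule (S.R T) (S.holo T))) :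
    r ∈ S.maxIdeal T ^ k :=
  S.mem_pow_of_rcoeff fun w hw => by
    rw [← co_smul_theta r m w]
    exact S.pow_smul_top_le k h m w hw

end Deep

/-! ### Dividing entire series by generators of the ideal of the base point -/

section Generators

variable {T : Type} [Fintype T]

/-- Finitely many monomials generate the ideal of the base point. -/
lemma exists_base_generators (T : Type) [Fintype T] : ∃ Γ : Finset (S.BaseExp T),
    (∀ γ ∈ Γ, γ ≠ 0) ∧ ∀ w ≠ 0, ∃ γ ∈ Γ, ∃ w', γ + w' = w := by
  classical
  obtain ⟨G, hG⟩ := S.exists_NE_generators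
  have hdiv : ∀ p ∈ AddSubmonoid.closure (G : Set (ι → ℤ)), p = 0 ∨
      ∃ g ∈ G, g ≠ 0 ∧ ∃ p' ∈ AddSubmonoid.closure (G : Set (ι → ℤ)), g + p' = p := by
    intro p hp
    induction hp using AddSubmonoid.closure_induction with
    | mem p hp =>
      by_cases h : p = 0
      · exact Or.inl h
      · exact Or.inr ⟨p, hp, h, 0, zero_mem _, add_zero _⟩
    | zero => exact Or.inl rfl
    | add p q _ hq' hp hq =>
      rcases hp with rfl | ⟨g, hg, h0, p', hp', rfl⟩
      · simpa using hq
      · exact Or.inr ⟨g, hg, h0, p' + q, add_mem hp' hq', by abel⟩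
  let toW : (ι → ℤ) → S.BaseExp T := fun g => if h : g ∈ S.NE then (⟨g, h⟩, 0) else 0
  refine ⟨(G.image toW ∪ Finset.univ.image fun i => ((0 : S.NE), Finsupp.single i 1)).filter (· ≠ 0),
    fun γ hγ => (Finset.mem_filter.1 hγ).2, fun w hw => ?_⟩
  by_cases hp : w.1 = 0
  · have hα : w.2 ≠ 0 := fun h' => hw (Prod.ext hp h')
    obtain ⟨i, hi⟩ := Finsupp.ne_iff.1 hα
    refine ⟨(0, Finsupp.single i 1), ?_, (w.1, w.2 - Finsupp.single i 1), ?_⟩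
    · rw [Finset.mem_filter, Finset.mem_union, Finset.mem_image, Finset.mem_image]
      refine ⟨Or.inr ⟨i, Finset.mem_univ _, rfl⟩, fun h => ?_⟩
      have := congrArg Prod.snd h
      simp at this
    · refine Prod.ext (by simp) ?_
      simp only [Prod.snd_add]
      rw [add_tsub_cancel_of_le]
      simpa [Finsupp.single_le_iff, Nat.one_le_iff_ne_zero] using hi
  · have hmem : w.1.1 ∈ AddSubmonoid.closure (G : Set (ι → ℤ)) := hG.ge w.1.2
    rcases hdiv _ hmem with h | ⟨g, hg, h0, p', hp', hgp⟩
    · exact (hp (Subtype.ext h)).elim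
    · have hgNE : g ∈ S.NE := hG.le (AddSubmonoid.subset_closure hg)
      refine ⟨(⟨g, hgNE⟩, 0), ?_, (⟨p', hG.le hp'⟩, w.2), ?_⟩
      · rw [Finset.mem_filter, Finset.mem_union, Finset.mem_image, Finset.mem_image]
        refine ⟨Or.inl ⟨g, hg, by simp [toW, hgNE]⟩, fun h => h0 ?_⟩
        exact congrArg (fun w => (w.1 : ι → ℤ)) h
      · exact Prod.ext (Subtype.ext hgp) (zero_add _)

/-- A function without monomials outside the ideal of the base point is a combination of the
generators of that ideal. -/
lemma exists_decomposition (hS : S.IsProjective) {Γ : Finset (S.BaseExp T)}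
    (hΓ : ∀ γ ∈ Γ, γ ≠ 0) (hΓ' : ∀ w ≠ 0, ∃ γ ∈ Γ, ∃ w', γ + w' = w) (f : S.holo T)
    (hf : ∀ m, co f m 0 = 0) : ∃ g : S.BaseExp T → S.holo T,
      f = ∑ γ ∈ Γ, S.rmon γ 1 • g γ ∧
        ∀ m, (∀ w, co f m w = 0) → ∀ γ w, co (g γ) m w = 0 := by
  classical
  -- Each nonzero exponent is assigned to one generator dividing it, and `g γ` collects the
  -- quotients of the terms assigned to `γ`. Division is injective on these terms and does not raise
  -- degrees, so the result is again entire.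
  choose! pick hpick hpick' using hΓ'
  have hent : ∀ γ : S.BaseExp T, IsEntireCo hS fun m w =>
      (if pick (γ + w) = γ then (1 : ℂ) else 0) * co f m (γ + w) := by
    intro γ
    refine (isEntireCo_co hS f).reindex hS (fun m w => if pick (γ + w) = γ then (1 : ℂ) else 0)
      (fun x => (x.1, γ + x.2)) 1 (fun m w => by split_ifs <;> simp) (fun x y _ _ h => ?_)
      fun x _ => ?_
    · exact Prod.ext (Prod.mk.inj h).1 (by simpa using (Prod.mk.inj h).2)
    · rw [← baseExp_add_key, mdeg_add]
      exact Nat.le_add_left _ _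
  refine ⟨fun γ => ofCo hS _ (hent γ), co_ext fun m w => ?_, fun m hm γ w => ?_⟩
  · rw [co_sum]
    simp only [rmon_smul, co_smul, one_mul]
    by_cases hw : w = 0
    · subst hw
      rw [hf, Finset.sum_eq_zero fun γ hγ => co_baseMon_mul_of_ne (fun w' h' =>
        hΓ γ hγ (S.baseExp_eq_zero_of_add hS h')) _ _]
    · obtain ⟨w', hw'⟩ := hpick' w hw
      rw [Finset.sum_eq_single_of_mem (pick w) (hpick w hw)]
      · have e := co_baseMon_mul_add (pick w) w' (ofCo hS _ (hent (pick w))) m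
        rw [hw', co_ofCo, hw', if_pos rfl, one_mul] at e
        exact e.symm
      · intro γ hγ hne
        by_cases h : ∃ w'', γ + w'' = w
        · obtain ⟨w'', rfl⟩ := h
          rw [co_baseMon_mul_add, co_ofCo, if_neg hne.symm, zero_mul]
        · push Not at h
          exact co_baseMon_mul_of_ne h _ _
  · rw [co_ofCo, hm, mul_zero]

lemma mem_smul_top_iff (hS : S.IsProjective) (f : S.holo T) :
    f ∈ (S.maxIdeal T • ⊤ : Submodule (S.R T) (S.holo T)) ↔ ∀ m, co f m 0 = 0 := by
  constructor
  · intro h m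
    have h1 := S.pow_smul_top_le (T := T) 1
    rw [pow_one] at h1
    exact h1 h m 0 fun h => (S.deep_one_iff hS).1 h rfl
  · intro h
    obtain ⟨Γ, hΓ, hΓ'⟩ := S.exists_base_generators T
    obtain ⟨g, hg, -⟩ := S.exists_decomposition hS hΓ hΓ' f h
    rw [hg]
    exact sum_mem fun γ hγ => Submodule.smul_mem_smul (S.rmon_mem_maxIdeal (hΓ γ hγ) 1) trivial

/-- A function supported on the multiples of `z^{φ(m)}` is, to any finite order, a multiple of
`z^{φ(m)}`. -/
lemma exists_sub_smul_theta_mem (hS : S.IsProjective) (m₀ : Fin n → ℤ) (k : ℕ) (f : S.holo T)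
    (hf : ∀ m ≠ m₀, ∀ w, co f m w = 0) : ∃ r : S.R T,
      f - r • S.theta m₀ ∈ (S.maxIdeal T ^ k • ⊤ : Submodule (S.R T) (S.holo T)) := by
  classical
  induction k generalizing f with
  | zero =>
    refine ⟨0, ?_⟩
    rw [pow_zero, Ideal.one_eq_top, Submodule.top_smul]
    trivial
  | succ k ih =>
    obtain ⟨Γ, hΓ, hΓ'⟩ := S.exists_base_generators T
    set a := co f m₀ 0 with ha
    have hbm0 : ∀ g : S.holo T, S.rmon (0 : S.BaseExp T) a • g = a • g := by
      intro g
      rw [rmon_smul]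
      congr 1
      have : S.baseMon (0 : S.BaseExp T) = 1 :=
        Subtype.ext (funext fun x => S.mon_zero T x)
      rw [this, one_mul]
    have h1 : ∀ m ≠ m₀, ∀ w, co (f - a • S.theta m₀) m w = 0 := by
      intro m hm w
      rw [co_sub, co_smul, hf m hm, co_theta, if_neg fun h => hm h.1, mul_zero, sub_zero]
    have h2 : ∀ m, co (f - a • S.theta m₀) m 0 = 0 := by
      intro m
      by_cases hm : m = m₀
      · subst hm
        rw [co_sub, co_smul, co_theta, if_pos ⟨rfl, rfl⟩, mul_one, ha, sub_self]
      · exact h1 m hm 0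
    -- After removal of the constant term, the quotients `g γ` are still supported on `m₀`. The
    -- induction hypothesis approximates them to order `k`, and the factor in `𝓘` gains one more
    -- order.
    obtain ⟨g, hg, hg'⟩ := S.exists_decomposition hS hΓ hΓ' _ h2
    choose r hr using fun γ => ih (g γ) fun m hm w => hg' m (h1 m hm) γ w
    refine ⟨S.rmon 0 a + ∑ γ ∈ Γ, S.rmon γ 1 * r γ, ?_⟩
    have h3 : f - (S.rmon 0 a + ∑ γ ∈ Γ, S.rmon γ 1 * r γ) • S.theta m₀ =
        ∑ γ ∈ Γ, S.rmon γ 1 • (g γ - r γ • S.theta m₀) := by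
      simp only [smul_sub, Finset.sum_sub_distrib, ← hg, add_smul, hbm0, Finset.sum_smul, mul_smul]
      abel
    rw [h3, pow_succ', Submodule.mul_smul]
    exact sum_mem fun γ hγ => Submodule.smul_mem_smul (S.rmon_mem_maxIdeal (hΓ γ hγ) 1) (hr γ)

end Generators

/-! ### Operators on functions given by weighted shifts of `N` -/

section Op

variable {S} (hS : S.IsProjective) {T : Type}

/-- Weights `g` and a shift `κ` of the lattice that define an operator on functions. -/
structure IsShift (g : (Fin n → ℤ) → ℂ) (κ : (Fin n → ℤ) → (Fin n → ℤ)) : Prop where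
  bounded : ∃ C : ℝ, ∀ m, ‖g m‖ ≤ C
  inj : ∀ m m', g m ≠ 0 → g m' ≠ 0 → κ m = κ m' → m = m'
  deg_le : ∀ m, g m ≠ 0 → ∃ v ∈ S.Pphi, S.tphi (κ m) = S.tphi m + v

lemma IsShift.isEntireCo {g : (Fin n → ℤ) → ℂ} {κ : (Fin n → ℤ) → (Fin n → ℤ)}
    (h : IsShift (S := S) g κ) (f : S.holo T) : IsEntireCo hS fun m w => g m * co f (κ m) w := by
  obtain ⟨C, hC⟩ := h.bounded
  refine (isEntireCo_co hS f).reindex hS (fun m _ => g m) (fun x => (κ x.1, x.2)) C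
    (fun m _ => hC m) (fun x y hx hy hxy => ?_) fun x hx => ?_
  · exact Prod.ext (h.inj _ _ hx hy (Prod.mk.inj hxy).1) (Prod.mk.inj hxy).2
  · obtain ⟨v, hv, hv'⟩ := h.deg_le x.1 hx
    have : S.key (κ x.1) x.2 = (⟨v, hv⟩, 0) + S.key x.1 x.2 := by
      refine Prod.ext (Subtype.ext ?_) ?_
      · change S.tphi (κ x.1) + x.2.1.1 = v + (S.tphi x.1 + x.2.1.1)
        rw [hv']
        abel
      · simp [key_snd]
    simp only
    rw [this, mdeg_add]
    exact Nat.le_add_left _ _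

variable [Fintype T]

/-- The operator that takes the function with coefficients `c m` to the function with
coefficients `g m * c (κ m)`. -/
def shiftOp {g : (Fin n → ℤ) → ℂ} {κ : (Fin n → ℤ) → (Fin n → ℤ)}
    (h : IsShift (S := S) g κ) : S.holo T →ₗ[S.R T] S.holo T :=
  S.linearOfMonomials
    { toFun := fun f => ofCo hS _ (h.isEntireCo hS f)
      map_add' := fun f f' => co_ext fun m w => by
        simp only [co_ofCo, co_add, mul_add]
      map_smul' := fun a f => co_ext fun m w => by
        simp only [co_ofCo, co_smul, RingHom.id_apply]
        ring }
    fun w₀ f => co_ext fun m w => by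
      simp only [LinearMap.coe_mk, AddHom.coe_mk, co_ofCo]
      by_cases h : ∃ w', w₀ + w' = w
      · obtain ⟨w', rfl⟩ := h
        rw [co_baseMon_mul_add, co_baseMon_mul_add, co_ofCo]
      · push Not at h
        rw [co_baseMon_mul_of_ne h, co_baseMon_mul_of_ne h, mul_zero]

lemma co_shiftOp {g : (Fin n → ℤ) → ℂ} {κ : (Fin n → ℤ) → (Fin n → ℤ)}
    (h : IsShift (S := S) g κ) (f : S.holo T) (m : Fin n → ℤ) (w : S.BaseExp T) :
    co (shiftOp hS h f) m w = g m * co f (κ m) w := by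
  change co (ofCo hS _ (h.isEntireCo hS f)) m w = _
  rw [co_ofCo]

end Op

section Mul

variable {S} {T : Type} [Fintype T]

lemma co_z_mul_of_mem {r : ι} {m : Fin n → ℤ} (hr : r ∈ S.supp m) (f : S.holo T) :
    co (S.z T r * f) m 0 = co f (m - S.ray r) 0 := by
  have : S.key m (0 : S.BaseExp T) =
      (⟨Pi.single r 1, S.single_mem_Pphi r⟩, 0) + S.key (m - S.ray r) 0 := by
    refine Prod.ext (Subtype.ext ?_) rfl
    change S.tphi m + 0 = Pi.single r 1 + (S.tphi (m - S.ray r) + 0)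
    rw [S.tphi_sub_ray hr]
    abel
  rw [co, this, z, coeff_monH_mul_add]
  rfl

/-- The relation of the Stanley–Reisner ring. A product `z_r z^{φ(m')}` is `z^{φ(m)}` times `z` to
the convexity defect at the two vectors, an element of `P`. As `P` is pointed, the product survives
on the central fibre only if the defect is zero, and then `r` lies in the support of `m`. -/
lemma co_z_mul_of_notMem (hS : S.IsProjective) {r : ι} {m : Fin n → ℤ} (hr : r ∉ S.supp m)
    (f : S.holo T) : co (S.z T r * f) m 0 = 0 := by
  refine coeff_monH_mul_of_forall_ne (fun q hq => hr ?_) f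
  obtain ⟨m', w', rfl⟩ := S.exists_key q
  have h1 : Pi.single r 1 + (S.tphi m' + w'.1.1) = S.tphi m := by
    have := congrArg (fun q => (q.1 : ι → ℤ)) hq
    simpa [key_fst] using this
  have h2 : S.ray r + m' = m := by
    have := congrArg S.raySum h1
    rwa [map_add, map_add, raySum_tphi, raySum_tphi, w'.1.2.1, raySum_single, one_smul,
      add_zero] at this
  have h3 : Pi.single r 1 + S.tphi m' - S.tphi m ∈ S.NE := by
    have := add_mem (S.single_mem_Pphi r) (S.tphi_mem_Pphi m')
    change _ - S.tphi (S.raySum _) ∈ S.NE at this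
    -- `h3` is the effectivity of the defect. Next, `h1` says that `w'` and this defect add up to
    -- zero, so `w'` vanishes.
    rwa [map_add, raySum_tphi, raySum_single, one_smul, h2] at this
  have h4 : w'.1.1 = 0 := by
    refine eq_zero_of_add_eq_zero hS (S.NE_le_Pphi w'.1.2) (S.NE_le_Pphi h3) ?_
    rw [← h1]
    abel
  rw [mem_supp, ← h1, h4]
  have := S.tphi_nonneg m' r
  simp only [Pi.add_apply, Pi.single_eq_same, Pi.zero_apply]
  omega

end Mul

end SmoothCompleteFan

end LogLG

end

open scoped TensorProduct

noncomputable section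

namespace LogLG

namespace SmoothCompleteFan

variable {n : ℕ} {ι : Type} [Fintype ι] [DecidableEq ι] {S : SmoothCompleteFan n ι}

/-! ### The operators of the Koszul contraction -/

section Excess

variable {μ : ℕ} {σ : Fin μ → Finset ι}

/-- The exponent of `z_r` in `z^{φ(m)}`, diminished by its exponent in `φ_i`. -/
def exc (S : SmoothCompleteFan n ι) (σ : Fin μ → Finset ι) (i : Fin μ) (m : Fin n → ℤ) (r : ι) :
    ℤ := S.tphi m r - if r ∈ tau σ n i then 1 else 0

/-- The degree of `z^{φ(m)} / φ_i` in the coordinates of `σ_i`. -/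
def tot (S : SmoothCompleteFan n ι) (σ : Fin μ → Finset ι) (i : Fin μ) (m : Fin n → ℤ) : ℤ :=
  ∑ r ∈ σ i, exc S σ i m r

variable (hσ : S.IsGoodOrder σ)

lemma exc_nonneg (m : Fin n → ℤ) (r : ι) : 0 ≤ exc S σ (S.idx hσ m) m r := by
  have h := S.tphi_nonneg m r
  rw [exc]
  split_ifs with hr
  · have := S.mem_supp.1 (tau_subset_supp hσ m hr)
    omega
  · omega

lemma exc_le_tot {m : Fin n → ℤ} {r : ι} (hr : r ∈ σ (S.idx hσ m)) :
    exc S σ (S.idx hσ m) m r ≤ tot S σ (S.idx hσ m) m :=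
  Finset.single_le_sum (f := fun r => exc S σ (S.idx hσ m) m r)
    (fun r _ => exc_nonneg hσ m r) hr

lemma tot_nonneg (m : Fin n → ℤ) : 0 ≤ tot S σ (S.idx hσ m) m :=
  Finset.sum_nonneg fun r _ => exc_nonneg hσ m r

lemma tau_mem_cones (hσ : S.IsGoodOrder σ) (i : Fin μ) : tau σ n i ∈ S.cones :=
  S.face_mem _ (hσ.mem_cones i) _ (tau_subset i)

lemma supp_raysSum {γ : Finset ι} (hγ : γ ∈ S.cones) : S.supp (S.raysSum γ) = γ := by
  ext r
  rw [mem_supp, S.tphi_raysSum hγ]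
  simp

lemma idx_raysSum_tau (i : Fin μ) : S.idx hσ (S.raysSum (tau σ n i)) = i := by
  refine idx_eq_of hσ ?_ ?_ <;> rw [supp_raysSum (tau_mem_cones hσ i)]
  exact tau_subset i

lemma tot_eq_zero_iff {i : Fin μ} {m : Fin n → ℤ} (hm : S.idx hσ m = i) :
    tot S σ i m = 0 ↔ m = S.raysSum (tau σ n i) := by
  subst hm
  constructor
  · intro h
    rw [tot, Finset.sum_eq_zero_iff_of_nonneg fun r _ => exc_nonneg hσ m r] at h
    apply S.tphi_injective
    rw [S.tphi_raysSum (tau_mem_cones hσ _)]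
    ext r
    by_cases hr : r ∈ σ (S.idx hσ m)
    · have := h r hr
      rw [exc] at this
      omega
    · have h1 : S.tphi m r = 0 := by
        by_contra h'
        exact hr (supp_subset hσ m (S.mem_supp.2 h'))
      rw [h1, if_neg fun h => hr (tau_subset _ h)]
  · intro h
    refine Finset.sum_eq_zero fun r _ => ?_
    have := congrFun (S.tphi_raysSum (tau_mem_cones hσ (S.idx hσ m))) r
    rw [← h] at this
    rw [exc, this, sub_self]

lemma tphi_add_ray' {i : Fin μ} {m : Fin n → ℤ} (hm : S.idx hσ m = i) {r : ι} (hr : r ∈ σ i) :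
    S.tphi (m + S.ray r) = S.tphi m + Pi.single r 1 :=
  S.tphi_add_ray (hσ.mem_cones i) (hm ▸ supp_subset hσ m) hr

lemma mem_supp_add_ray {i : Fin μ} {m : Fin n → ℤ} (hm : S.idx hσ m = i) {r : ι} (hr : r ∈ σ i)
    {s : ι} : s ∈ S.supp (m + S.ray r) ↔ s ∈ S.supp m ∨ s = r := by
  rw [mem_supp, mem_supp, tphi_add_ray' hσ hm hr, Pi.add_apply]
  have := S.tphi_nonneg m s
  by_cases h : s = r
  · subst h
    simp only [Pi.single_eq_same, or_true, iff_true]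
    omega
  · simp [h]

lemma idx_add_ray {i : Fin μ} {m : Fin n → ℤ} (hm : S.idx hσ m = i) {r : ι} (hr : r ∈ σ i) :
    S.idx hσ (m + S.ray r) = i := by
  refine idx_eq_of hσ (fun s hs => ?_) fun s hs => ?_
  · exact (mem_supp_add_ray hσ hm hr).2 (Or.inl (tau_subset_supp hσ m (hm ▸ hs)))
  · rcases (mem_supp_add_ray hσ hm hr).1 hs with h | rfl
    · exact hm ▸ supp_subset hσ m h
    · exact hr

lemma supp_sub_ray {m : Fin n → ℤ} {s : ι} (hs : s ∈ S.supp m) :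
    S.supp (m - S.ray s) ⊆ S.supp m := by
  intro r hr
  rw [mem_supp, S.tphi_sub_ray hs] at hr
  rw [mem_supp]
  by_cases h : r = s
  · subst h
    exact S.mem_supp.1 hs
  · simpa [h] using hr

lemma idx_sub_ray_le {m : Fin n → ℤ} {s : ι} (hs : s ∈ S.supp m) :
    S.idx hσ (m - S.ray s) ≤ S.idx hσ m := idx_mono hσ (supp_sub_ray hs)

/-- Dividing by `z_s` leaves the block exactly when it removes a ray of `τ_i`, that is, when `z_s`
does not divide the quotient of the monomial by `φ_i`. -/
lemma idx_sub_ray_iff {i : Fin μ} {m : Fin n → ℤ} (hm : S.idx hσ m = i) {s : ι}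
    (hs : s ∈ S.supp m) : S.idx hσ (m - S.ray s) = i ↔ exc S σ i m s ≠ 0 := by
  have h0 := S.mem_supp.1 hs
  have h1 := S.tphi_nonneg m s
  constructor
  · intro h
    rw [exc]
    split_ifs with hst
    · have := S.mem_supp.1 (tau_subset_supp hσ (m - S.ray s) (h.symm ▸ hst))
      rw [S.tphi_sub_ray hs, Pi.sub_apply, Pi.single_eq_same] at this
      exact this
    · simpa using h0
  · intro h
    refine idx_eq_of hσ (fun r hr => ?_) ((supp_sub_ray hs).trans (hm ▸ supp_subset hσ m))
    rw [mem_supp, S.tphi_sub_ray hs]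
    by_cases hrs : r = s
    · subst hrs
      simp only [exc, hr, if_true] at h
      simpa using h
    · have := S.mem_supp.1 (tau_subset_supp hσ m (hm ▸ hr))
      simpa [hrs] using this

lemma exc_sub_ray {i : Fin μ} {m : Fin n → ℤ} {s : ι} (hs : s ∈ S.supp m) (r : ι) :
    exc S σ i (m - S.ray s) r = exc S σ i m r - if r = s then 1 else 0 := by
  rw [exc, exc, S.tphi_sub_ray hs, Pi.sub_apply, Pi.single_apply]
  ring

lemma exc_add_ray {i : Fin μ} {m : Fin n → ℤ} (hm : S.idx hσ m = i) {r : ι} (hr : r ∈ σ i)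
    (s : ι) : exc S σ i (m + S.ray r) s = exc S σ i m s + if s = r then 1 else 0 := by
  rw [exc, exc, tphi_add_ray' hσ hm hr, Pi.add_apply, Pi.single_apply]
  ring

lemma tot_sub_ray {i : Fin μ} {m : Fin n → ℤ} {s : ι} (hs : s ∈ S.supp m) (hsi : s ∈ σ i) :
    tot S σ i (m - S.ray s) = tot S σ i m - 1 := by
  simp only [tot, exc_sub_ray hs, Finset.sum_sub_distrib, Finset.sum_ite_eq', hsi, if_true]

end Excess

section Operators

variable {μ : ℕ} {σ : Fin μ → Finset ι} (hS : S.IsProjective) (hσ : S.IsGoodOrder σ)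

lemma isShift_id {g : (Fin n → ℤ) → ℂ} (C : ℝ) (h : ∀ m, ‖g m‖ ≤ C) :
    IsShift (S := S) g id where
  bounded := ⟨C, h⟩
  inj _ _ _ _ h := h
  deg_le _ _ := ⟨0, zero_mem _, (add_zero _).symm⟩

lemma norm_ite_le_one (p : Prop) [Decidable p] : ‖(if p then (1 : ℂ) else 0)‖ ≤ 1 := by
  split_ifs <;> simp

lemma norm_inv_add_le (a : ℤ) (ha : 0 ≤ a) (e : ℕ) : ‖((a : ℂ) + e)⁻¹‖ ≤ 1 := by
  lift a to ℕ using ha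
  rw [norm_inv]
  have : (((a : ℤ) : ℂ) + e) = ((a + e : ℕ) : ℂ) := by push_cast; rfl
  rw [this, Complex.norm_natCast]
  rcases Nat.eq_zero_or_pos (a + e) with h | h
  · simp [h]
  · exact inv_le_one_of_one_le₀ (by exact_mod_cast h)

/-- The operator is `∂/∂z_r` on the quotient by `φ_i`, divided by the Euler weight. The weights are
bounded by `2` since `exc ≤ tot`. When `tot + e = 0` the convention `0⁻¹ = 0` makes the weight
vanish. -/
lemma isShift_hop (i : Fin μ) (r : ι) (e : ℕ) : IsShift (S := S)
    (fun m => if S.idx hσ m = i ∧ r ∈ σ i then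
      ((exc S σ i m r : ℂ) + 1) * ((tot S σ i m : ℂ) + e)⁻¹ else 0) (fun m => m + S.ray r) where
  bounded := by
    refine ⟨2, fun m => ?_⟩
    split_ifs with h
    · obtain ⟨rfl, hr⟩ := h
      have h1 := exc_nonneg hσ m r
      have h2 := exc_le_tot hσ hr
      generalize exc S σ (S.idx hσ m) m r = x at h1 h2
      generalize tot S σ (S.idx hσ m) m = t at h2
      lift x to ℕ using h1
      lift t to ℕ using (by omega)
      rw [norm_mul, norm_inv]
      have e1 : (((x : ℤ) : ℂ) + 1) = ((x + 1 : ℕ) : ℂ) := by push_cast; rfl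
      have e2 : (((t : ℤ) : ℂ) + e) = ((t + e : ℕ) : ℂ) := by push_cast; rfl
      rw [e1, e2, Complex.norm_natCast, Complex.norm_natCast]
      rcases Nat.eq_zero_or_pos (t + e) with h | h
      · simp [h]
      · rw [← div_eq_mul_inv, div_le_iff₀ (by exact_mod_cast h)]
        have : x + 1 ≤ 2 * (t + e) := by omega
        exact_mod_cast this
    · simp
  inj _ _ _ _ h := by simpa using h
  deg_le m hm := by
    have h : S.idx hσ m = i ∧ r ∈ σ i := by
      by_contra h
      exact hm (if_neg h)
    exact ⟨Pi.single r 1, S.single_mem_Pphi r, tphi_add_ray' hσ h.1 h.2⟩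

variable (T : Type) [Fintype T]

/-- The projection to the monomials of the `i`-th block of the shelling. -/
def proj (i : Fin μ) : S.holo T →ₗ[S.R T] S.holo T :=
  shiftOp hS (isShift_id (g := fun m => if S.idx hσ m = i then 1 else 0) 1
    fun _ => norm_ite_le_one _)

/-- The projection to the multiples of `φ_i`. -/
def projPhi (_ : S.IsGoodOrder σ) (i : Fin μ) : S.holo T →ₗ[S.R T] S.holo T :=
  shiftOp hS (isShift_id (g := fun m => if m = S.raysSum (tau σ n i) then 1 else 0) 1
    fun _ => norm_ite_le_one _)

/-- The `r`-th component of the Koszul contraction on the `i`-th block. -/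
def hop (i : Fin μ) (r : ι) (e : ℕ) : S.holo T →ₗ[S.R T] S.holo T :=
  shiftOp hS (isShift_hop hσ i r e)

/-- Division by the Euler weight on the `i`-th block. -/
def eulerInv (i : Fin μ) (e : ℕ) : S.holo T →ₗ[S.R T] S.holo T :=
  shiftOp hS (isShift_id (g := fun m => if S.idx hσ m = i then ((tot S σ i m : ℂ) + e)⁻¹ else 0) 1
    fun m => by
      split_ifs with h
      · exact norm_inv_add_le _ (h ▸ tot_nonneg hσ m) e
      · simp)

variable {T}

lemma co_proj (i : Fin μ) (f : S.holo T) (m : Fin n → ℤ) (w : S.BaseExp T) :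
    co (proj hS hσ T i f) m w = if S.idx hσ m = i then co f m w else 0 := by
  rw [proj, co_shiftOp]
  split_ifs <;> simp

lemma co_projPhi (i : Fin μ) (f : S.holo T) (m : Fin n → ℤ) (w : S.BaseExp T) :
    co (projPhi hS T hσ i f) m w = if m = S.raysSum (tau σ n i) then co f m w else 0 := by
  rw [projPhi, co_shiftOp]
  split_ifs <;> simp

lemma co_hop (i : Fin μ) (r : ι) (e : ℕ) (f : S.holo T) (m : Fin n → ℤ) (w : S.BaseExp T) :
    co (hop hS hσ T i r e f) m w = if S.idx hσ m = i ∧ r ∈ σ i then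
      ((exc S σ i m r : ℂ) + 1) * ((tot S σ i m : ℂ) + e)⁻¹ * co f (m + S.ray r) w else 0 := by
  rw [hop, co_shiftOp]
  split_ifs <;> simp

lemma co_eulerInv (i : Fin μ) (e : ℕ) (f : S.holo T) (m : Fin n → ℤ) (w : S.BaseExp T) :
    co (eulerInv hS hσ T i e f) m w =
      if S.idx hσ m = i then ((tot S σ i m : ℂ) + e)⁻¹ * co f m w else 0 := by
  rw [eulerInv, co_shiftOp]
  split_ifs <;> simp

lemma sum_proj (f : S.holo T) : ∑ i, proj hS hσ T i f = f :=
  co_ext fun m w => by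
    rw [co_sum]
    simp [co_proj]

lemma proj_proj (i j : Fin μ) (f : S.holo T) :
    proj hS hσ T i (proj hS hσ T j f) = if i = j then proj hS hσ T i f else 0 :=
  co_ext fun m w => by
    by_cases h : i = j
    · subst h
      rw [if_pos rfl, co_proj, co_proj]
      split_ifs <;> rfl
    · rw [if_neg h, co_zero, co_proj, co_proj]
      split_ifs with h1 h2
      · exact (h (h1.symm.trans h2)).elim
      · rfl
      · rfl

lemma proj_hop (j i : Fin μ) (r : ι) (e : ℕ) (f : S.holo T) :
    proj hS hσ T j (hop hS hσ T i r e f) = if j = i then hop hS hσ T i r e f else 0 :=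
  co_ext fun m w => by
    by_cases h : j = i
    · subst h
      rw [if_pos rfl, co_proj, co_hop]
      split_ifs with h1 h2 h3 <;> tauto
    · rw [if_neg h, co_zero, co_proj, co_hop]
      split_ifs with h1 h2
      · exact (h (h1.symm.trans h2.1)).elim
      · rfl
      · rfl

lemma hop_proj (i j : Fin μ) (r : ι) (e : ℕ) (f : S.holo T) :
    hop hS hσ T i r e (proj hS hσ T j f) = if j = i then hop hS hσ T i r e f else 0 :=
  co_ext fun m w => by
    rw [co_hop, co_proj]
    by_cases h1 : S.idx hσ m = i ∧ r ∈ σ i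
    · rw [if_pos h1, idx_add_ray hσ h1.1 h1.2]
      by_cases h : j = i
      · rw [if_pos h, if_pos h.symm, co_hop, if_pos h1]
      · rw [if_neg h, if_neg (Ne.symm h), co_zero, mul_zero]
    · rw [if_neg h1]
      split_ifs
      · rw [co_hop, if_neg h1]
      · rw [co_zero]

lemma proj_projPhi (i j : Fin μ) (f : S.holo T) :
    proj hS hσ T j (projPhi hS T hσ i f) = if j = i then projPhi hS T hσ i f else 0 :=
  co_ext fun m w => by
    rw [co_proj, co_projPhi]
    by_cases h : m = S.raysSum (tau σ n i)
    · subst h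
      rw [idx_raysSum_tau]
      by_cases h' : j = i
      · rw [if_pos h', if_pos h'.symm, co_projPhi]
      · rw [if_neg h', if_neg (Ne.symm h'), co_zero]
    · rw [if_neg h, ite_self]
      split_ifs
      · rw [co_projPhi, if_neg h]
      · rw [co_zero]

lemma projPhi_proj (i j : Fin μ) (f : S.holo T) :
    projPhi hS T hσ i (proj hS hσ T j f) = if j = i then projPhi hS T hσ i f else 0 :=
  co_ext fun m w => by
    rw [co_projPhi, co_proj]
    by_cases h : m = S.raysSum (tau σ n i)
    · subst h
      rw [idx_raysSum_tau, if_pos rfl]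
      by_cases h' : j = i
      · rw [if_pos h', if_pos h'.symm, co_projPhi, if_pos rfl]
      · rw [if_neg h', if_neg (Ne.symm h'), co_zero]
    · rw [if_neg h]
      split_ifs
      · rw [co_projPhi, if_neg h]
      · rw [co_zero]

lemma projPhi_projPhi (i j : Fin μ) (f : S.holo T) :
    projPhi hS T hσ i (projPhi hS T hσ j f) = if j = i then projPhi hS T hσ i f else 0 :=
  co_ext fun m w => by
    rw [co_projPhi, co_projPhi]
    by_cases h : j = i
    · subst h
      rw [if_pos rfl, co_projPhi]
      split_ifs <;> rfl
    · rw [if_neg h, co_zero]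
      split_ifs with h1 h2
      · have := congrArg (S.idx hσ) (h1.symm.trans h2)
        rw [idx_raysSum_tau, idx_raysSum_tau] at this
        exact (h this.symm).elim
      · rfl
      · rfl

/-- `φ_i` is the least monomial of its block, so its quotient by `φ_i` is constant and every
derivative kills it. -/
lemma hop_projPhi (i j : Fin μ) (r : ι) (e : ℕ) (f : S.holo T) :
    hop hS hσ T i r e (projPhi hS T hσ j f) = 0 :=
  co_ext fun m w => by
    rw [co_hop, co_zero, co_projPhi]
    split_ifs with h1 h2
    · have hij : i = j := by
        rw [← idx_add_ray hσ h1.1 h1.2, h2, idx_raysSum_tau]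
      subst hij
      have h3 := exc_add_ray hσ h1.1 h1.2 r
      rw [if_pos rfl, h2, exc, S.tphi_raysSum (tau_mem_cones hσ i), sub_self] at h3
      have h4 : ((exc S σ i m r : ℂ) + 1) = 0 := by exact_mod_cast h3.symm
      rw [h4, zero_mul, zero_mul]
    · rw [mul_zero]
    · rfl

/-! ### Identities modulo the ideal of the base point -/

/-- On the central fibre a coefficient of `z_s f` at `m` comes from `m - ρ_s`, whose block is at
most that of `m`. Products therefore never descend, and staying in block `i` requires `s ∈ supp m ⊆
σ i`. -/
lemma co_proj_z_mul_hop {i j : Fin μ} {s : ι} (h : j < i ∨ (j = i ∧ s ∉ σ i)) (r : ι) (e : ℕ)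
    (f : S.holo T) (m : Fin n → ℤ) :
    co (proj hS hσ T j (S.z T s * hop hS hσ T i r e f)) m 0 = 0 := by
  rw [co_proj]
  split_ifs with h1
  · by_cases hs : s ∈ S.supp m
    · rw [co_z_mul_of_mem hs, co_hop]
      split_ifs with h2
      · have h3 := idx_sub_ray_le hσ hs
        rw [h1, h2.1] at h3
        rcases h with h | ⟨rfl, h⟩
        · exact (not_lt_of_ge h3 h).elim
        · exact (h (h1 ▸ supp_subset hσ m hs)).elim
      · rfl
    · exact co_z_mul_of_notMem hS hs _
  · rfl

lemma co_hop_z_mul_proj {i j : Fin μ} {s : ι} (h : j < i ∨ (j = i ∧ s ∉ σ i)) (r : ι) (e : ℕ)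
    (f : S.holo T) (m : Fin n → ℤ) :
    co (hop hS hσ T j r e (S.z T s * proj hS hσ T i f)) m 0 = 0 := by
  rw [co_hop]
  split_ifs with h1
  · have h1' := idx_add_ray hσ h1.1 h1.2
    by_cases hs : s ∈ S.supp (m + S.ray r)
    · rw [co_z_mul_of_mem hs, co_proj]
      split_ifs with h2
      · have h3 := idx_sub_ray_le hσ hs
        rw [h1', h2] at h3
        rcases h with h | ⟨rfl, h⟩
        · exact (not_lt_of_ge h3 h).elim
        · exact (h (h1' ▸ supp_subset hσ _ hs)).elim
      · rw [mul_zero]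
    · rw [co_z_mul_of_notMem hS hs, mul_zero]
  · rfl

/-- For `r ≠ s`, `∂/∂z_r` commutes with multiplication by `z_s`. The index `e` grows by one because
multiplication by `z_s` raises `tot` by one, so that both sides divide by the same Euler weight. -/
lemma co_hop_z_mul_proj_of_ne {i : Fin μ} {r s : ι} (hr : r ∈ σ i) (hs : s ∈ σ i) (hrs : r ≠ s)
    (e : ℕ) (f : S.holo T) (m : Fin n → ℤ) :
    co (hop hS hσ T i r e (S.z T s * proj hS hσ T i f)) m 0 =
      co (proj hS hσ T i (S.z T s * hop hS hσ T i r (e + 1) f)) m 0 := by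
  rw [co_hop, co_proj]
  by_cases hm : S.idx hσ m = i
  · rw [if_pos ⟨hm, hr⟩, if_pos hm]
    have hm' := idx_add_ray hσ hm hr
    have hiff : s ∈ S.supp (m + S.ray r) ↔ s ∈ S.supp m := by
      rw [mem_supp_add_ray hσ hm hr]
      exact or_iff_left hrs.symm
    by_cases hsm : s ∈ S.supp m
    · have hsm' := hiff.2 hsm
      rw [co_z_mul_of_mem hsm', co_z_mul_of_mem hsm, co_proj, co_hop]
      have e1 : S.idx hσ (m + S.ray r - S.ray s) = i ↔ S.idx hσ (m - S.ray s) = i := by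
        rw [idx_sub_ray_iff hσ hm' hsm', idx_sub_ray_iff hσ hm hsm, exc_add_ray hσ hm hr,
          if_neg hrs.symm, add_zero]
      by_cases h2 : S.idx hσ (m - S.ray s) = i
      · rw [if_pos (e1.2 h2), if_pos ⟨h2, hr⟩, exc_sub_ray hsm, if_neg hrs, tot_sub_ray hsm hs]
        have e2 : m - S.ray s + S.ray r = m + S.ray r - S.ray s := by abel
        rw [e2]
        push_cast
        ring
      · rw [if_neg fun h => h2 (e1.1 h), if_neg fun h => h2 h.1, mul_zero]
    · rw [co_z_mul_of_notMem hS hsm, co_z_mul_of_notMem hS fun h => hsm (hiff.1 h), mul_zero]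
  · rw [if_neg fun h => hm h.1, if_neg hm]

/-- `z_r ∂/∂z_r` multiplies by the exponent `exc`. The monomials whose quotient by `z_r` leaves the
block are those with `exc = 0`, so nothing is lost there. -/
lemma co_proj_z_mul_hop_self {i : Fin μ} {r : ι} (hr : r ∈ σ i) (e : ℕ) (f : S.holo T)
    (m : Fin n → ℤ) :
    co (proj hS hσ T i (S.z T r * hop hS hσ T i r (e + 1) f)) m 0 =
      if S.idx hσ m = i then (exc S σ i m r : ℂ) * (((tot S σ i m : ℂ) + e)⁻¹ * co f m 0)
        else 0 := by
  rw [co_proj]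
  by_cases hm : S.idx hσ m = i
  · rw [if_pos hm, if_pos hm]
    by_cases hrm : r ∈ S.supp m
    · rw [co_z_mul_of_mem hrm, co_hop]
      by_cases h2 : S.idx hσ (m - S.ray r) = i
      · rw [if_pos ⟨h2, hr⟩, exc_sub_ray hrm, if_pos rfl, tot_sub_ray hrm hr, sub_add_cancel]
        push_cast
        ring
      · rw [if_neg fun h => h2 h.1]
        have : exc S σ i m r = 0 := by
          by_contra h
          exact h2 ((idx_sub_ray_iff hσ hm hrm).2 h)
        rw [this, Int.cast_zero, zero_mul]
    · rw [co_z_mul_of_notMem hS hrm]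
      have h1 : S.tphi m r = 0 := by
        by_contra h
        exact hrm (S.mem_supp.2 h)
      have : exc S σ i m r = 0 := by
        rw [exc, h1, if_neg fun h => hrm (tau_subset_supp hσ m (hm ▸ h)), sub_zero]
      rw [this, Int.cast_zero, zero_mul]
  · rw [if_neg hm, if_neg hm]

/-- The commutation relation `∂_r z_r = z_r ∂_r + 1`, after division by the Euler weight. -/
lemma co_hop_z_mul_proj_self {i : Fin μ} {r : ι} (hr : r ∈ σ i) (e : ℕ) (f : S.holo T)
    (m : Fin n → ℤ) :
    co (hop hS hσ T i r e (S.z T r * proj hS hσ T i f)) m 0 =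
      co (proj hS hσ T i (S.z T r * hop hS hσ T i r (e + 1) f) + eulerInv hS hσ T i e f) m 0 := by
  rw [co_add, co_proj_z_mul_hop_self hS hσ hr, co_eulerInv, co_hop]
  by_cases hm : S.idx hσ m = i
  · rw [if_pos ⟨hm, hr⟩, if_pos hm, if_pos hm,
      co_z_mul_of_mem ((mem_supp_add_ray hσ hm hr).2 (Or.inr rfl)), co_proj, add_sub_cancel_right,
      if_pos hm]
    ring
  · rw [if_neg fun h => hm h.1, if_neg hm, if_neg hm, add_zero]

/-- The exponents add up to `tot`, so the left side is `(tot + e) (tot + e)⁻¹`. This is `1` except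
where `tot = e = 0`. There the convention `0⁻¹ = 0` gives `0`, and `projPhi` makes up the
difference. -/
lemma co_sum_proj_z_mul_hop (i : Fin μ) (e : ℕ) (f : S.holo T) (m : Fin n → ℤ) :
    co (∑ r ∈ σ i, proj hS hσ T i (S.z T r * hop hS hσ T i r (e + 1) f) +
      (e : ℂ) • eulerInv hS hσ T i e f) m 0 =
      co (proj hS hσ T i f - if e = 0 then projPhi hS T hσ i f else 0) m 0 := by
  rw [co_add, co_sum, co_smul, co_sub, co_eulerInv, co_proj,
    Finset.sum_congr rfl fun r hr => co_proj_z_mul_hop_self hS hσ hr e f m]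
  by_cases hm : S.idx hσ m = i
  · simp only [if_pos hm]
    rw [← Finset.sum_mul, ← add_mul, ← Int.cast_sum]
    change ((tot S σ i m : ℂ) + e) * _ = _
    have h0 : 0 ≤ tot S σ i m := hm ▸ tot_nonneg hσ m
    have hiff := tot_eq_zero_iff hσ hm
    have hne : ((tot S σ i m : ℂ) + e) = 0 ↔ tot S σ i m = 0 ∧ e = 0 := by
      have : ((tot S σ i m : ℂ) + e) = ((tot S σ i m + e : ℤ) : ℂ) := by push_cast; rfl
      rw [this, Int.cast_eq_zero]
      omega
    by_cases h : tot S σ i m = 0 ∧ e = 0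
    · rw [hne.2 h, zero_mul, if_pos h.2, co_projPhi, if_pos (hiff.1 h.1), sub_self]
    · rw [mul_inv_cancel_left₀ fun h' => h (hne.1 h')]
      by_cases he : e = 0
      · rw [if_pos he, co_projPhi, if_neg fun h' => h ⟨hiff.2 h', he⟩, sub_zero]
      · rw [if_neg he, co_zero, sub_zero]
  · simp only [if_neg hm, Finset.sum_const_zero, mul_zero, add_zero, zero_sub]
    by_cases he : e = 0
    · rw [if_pos he, co_projPhi, if_neg, neg_zero]
      rintro rfl
      exact hm (idx_raysSum_tau hσ i)
    · rw [if_neg he, co_zero, neg_zero]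

end Operators

end SmoothCompleteFan

end LogLG

end

open scoped TensorProduct

noncomputable section

/-! ### Exterior algebra -/

section Exterior

variable {A M J : Type*} [CommRing A] [AddCommGroup M] [Module A M]

/-- The interior product on the exterior algebra. -/
def ExteriorAlgebra.contract (ξ : Module.Dual A M) :
    ExteriorAlgebra A M →ₗ[A] ExteriorAlgebra A M :=
  CliffordAlgebra.contractLeft (Q := (0 : QuadraticForm A M)) ξ

lemma ExteriorAlgebra.contract_ι_mul (ξ : Module.Dual A M) (v : M) (ω : ExteriorAlgebra A M) :
    ExteriorAlgebra.contract ξ (ExteriorAlgebra.ι A v * ω) =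
      ξ v • ω - ExteriorAlgebra.ι A v * ExteriorAlgebra.contract ξ ω :=
  CliffordAlgebra.contractLeft_ι_mul (Q := (0 : QuadraticForm A M)) ξ v ω

/-- The Euler identity of the exterior algebra. -/
lemma ExteriorAlgebra.sum_ι_mul_contract (s : Finset J) (ρ : J → M) (ξ : J → Module.Dual A M)
    (h : ∀ v, ∑ r ∈ s, ξ r v • ρ r = v) {p : ℕ} {ω : ExteriorAlgebra A M} (hω : ω ∈ ⋀[A]^p M) :
    ∑ r ∈ s, ExteriorAlgebra.ι A (ρ r) * ExteriorAlgebra.contract (ξ r) ω = (p : A) • ω := by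
  induction hω using Submodule.pow_induction_on_left' with
  | algebraMap a =>
    have : ∀ r, ExteriorAlgebra.contract (ξ r) (algebraMap A (ExteriorAlgebra A M) a) = 0 :=
      fun r => CliffordAlgebra.contractLeft_algebraMap _ _ _
    simp [this]
  | add x y i hx hy ihx ihy => simp only [map_add, mul_add, Finset.sum_add_distrib, ihx, ihy, smul_add]
  | mem_mul v hv p ω hω ih =>
    obtain ⟨v, rfl⟩ := hv
    simp only [ExteriorAlgebra.contract_ι_mul, mul_sub, Finset.sum_sub_distrib]
    have h1 : ∑ r ∈ s, ExteriorAlgebra.ι A (ρ r) * ξ r v • ω = ExteriorAlgebra.ι A v * ω := by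
      conv_rhs => rw [← h v]
      rw [map_sum, Finset.sum_mul]
      exact Finset.sum_congr rfl fun r _ => by rw [map_smul, smul_mul_assoc, mul_smul_comm]
    have h2 : ∑ r ∈ s, ExteriorAlgebra.ι A (ρ r) *
        (ExteriorAlgebra.ι A v * ExteriorAlgebra.contract (ξ r) ω) =
        -(ExteriorAlgebra.ι A v * ((p : A) • ω)) := by
      rw [← ih, Finset.mul_sum, ← Finset.sum_neg_distrib]
      refine Finset.sum_congr rfl fun r _ => ?_
      rw [← mul_assoc, ← mul_assoc, ← neg_mul,
        eq_neg_of_add_eq_zero_left (ExteriorAlgebra.ι_add_mul_swap (ρ r) v)]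
    rw [h1, h2, sub_neg_eq_add, mul_smul_comm, Nat.cast_succ, add_smul, one_smul, add_comm]

lemma ExteriorAlgebra.ι_mul_mem (v : M) {p : ℕ} {ω : ExteriorAlgebra A M} (hω : ω ∈ ⋀[A]^p M) :
    ExteriorAlgebra.ι A v * ω ∈ ⋀[A]^(p + 1) M := by
  have h : ⋀[A]^(p + 1) M = LinearMap.range (ExteriorAlgebra.ι A (M := M)) * ⋀[A]^p M :=
    pow_succ' _ _
  rw [h]
  exact Submodule.mul_mem_mul ⟨v, rfl⟩ hω

/-- The projection of the exterior algebra to its part of degree `p`. -/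
def ExteriorAlgebra.degreeProj (p : ℕ) : ExteriorAlgebra A M →ₗ[A] ExteriorAlgebra A M :=
  GradedAlgebra.proj (fun i : ℕ => ⋀[A]^i M) p

lemma ExteriorAlgebra.degreeProj_of_mem {p : ℕ} {ω : ExteriorAlgebra A M} (hω : ω ∈ ⋀[A]^p M)
    (q : ℕ) : ExteriorAlgebra.degreeProj q ω = if q = p then ω else 0 := by
  rw [ExteriorAlgebra.degreeProj, GradedAlgebra.proj_apply]
  split_ifs with h
  · subst h
    exact DirectSum.decompose_of_mem_same _ hω
  · exact DirectSum.decompose_of_mem_ne _ hω (Ne.symm h)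

end Exterior

/-! ### Complete modules and homotopies -/

section Complete

variable {A M N : Type*} [CommRing A] [AddCommGroup M] [Module A M] [AddCommGroup N] [Module A N]

/-- The module is separated and complete for the powers of `x`. -/
structure IsXComplete (x : A) (M : Type*) [AddCommGroup M] [Module A M] : Prop where
  haus : ∀ y : M, (∀ s : ℕ, ∃ z, y = x ^ s • z) → y = 0
  sum : ∀ c : ℕ → M, ∃ y, ∀ s, ∃ z, y - ∑ j ∈ Finset.range s, x ^ j • c j = x ^ s • z

lemma IsXComplete.of_equiv {x : A} (h : IsXComplete x M) (e : N ≃ₗ[A] M) : IsXComplete x N where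
  haus y hy := e.map_eq_zero_iff.1 <| h.haus _ fun s => by
    obtain ⟨z, hz⟩ := hy s
    exact ⟨e z, by rw [hz, map_smul]⟩
  sum c := by
    obtain ⟨y, hy⟩ := h.sum fun j => e (c j)
    refine ⟨e.symm y, fun s => ?_⟩
    obtain ⟨z, hz⟩ := hy s
    refine ⟨e.symm z, e.injective ?_⟩
    simpa using hz

lemma IsXComplete.pi {x : A} (h : IsXComplete x M) (J : Type*) : IsXComplete x (J → M) where
  haus y hy := funext fun i => h.haus _ fun s => by
    obtain ⟨z, hz⟩ := hy s
    exact ⟨z i, by rw [hz]; rfl⟩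
  sum c := by
    choose y hy using fun i => h.sum fun j => c j i
    refine ⟨y, fun s => ?_⟩
    choose z hz using fun i => hy i s
    refine ⟨z, funext fun i => ?_⟩
    simpa [Finset.sum_apply] using hz i

/-- A topologically nilpotent perturbation of the identity is bijective. -/
lemma IsXComplete.bijective_one_sub {x : A} (h : IsXComplete x M) {G : Module.End A M}
    {N : ℕ} (hG : ∀ y, ∃ z, (G ^ N) y = x • z) : Function.Bijective (1 - G : Module.End A M) := by
  have hpow : ∀ (s : ℕ) (y : M), ∃ z, ((G ^ N) ^ s) y = x ^ s • z := by
    intro s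
    induction s with
    | zero => exact fun y => ⟨y, by simp⟩
    | succ s ih =>
      intro y
      obtain ⟨z, hz⟩ := ih y
      obtain ⟨z', hz'⟩ := hG z
      refine ⟨z', ?_⟩
      rw [pow_succ', Module.End.mul_apply, hz, map_smul, hz', smul_smul, pow_succ]
  have hbij : Function.Bijective (1 - G ^ N : Module.End A M) := by
    constructor
    · rw [injective_iff_map_eq_zero]
      intro y hy
      have hfix : (G ^ N) y = y := by
        rw [LinearMap.sub_apply, sub_eq_zero] at hy
        exact hy.symm
      refine h.haus y fun s => ?_
      obtain ⟨z, hz⟩ := hpow s y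
      refine ⟨z, ?_⟩
      rw [← hz]
      clear hz z
      induction s with
      | zero => simp
      | succ s ih => rw [pow_succ, Module.End.mul_apply, hfix, ← ih]
    -- The preimage is the limit of the geometric series in `G ^ N`, whose `s`-th term is divisible
    -- by `x ^ s`.
    · intro y
      choose c hc using fun s => hpow s y
      obtain ⟨L, hL⟩ := h.sum c
      refine ⟨L, sub_eq_zero.1 (h.haus _ fun s => ?_)⟩
      obtain ⟨z, hz⟩ := hL s
      have h1 : (1 - G ^ N : Module.End A M) (∑ j ∈ Finset.range s, x ^ j • c j) =
          y - x ^ s • c s := by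
        have h2 := congrArg (fun f : Module.End A M => f y) (mul_neg_geom_sum (G ^ N) s)
        simp only [Module.End.mul_apply, LinearMap.sum_apply] at h2
        simp only [← hc]
        rw [h2]
        simp
      refine ⟨(1 - G ^ N : Module.End A M) z - c s, ?_⟩
      rw [smul_sub, ← map_smul, ← hz, map_sub, h1]
      abel
  -- `1 - G ^ N` factors through `1 - G` on either side, so its bijectivity passes to `1 - G`.
  have e1 : (1 - G ^ N : Module.End A M) = (∑ j ∈ Finset.range N, G ^ j) * (1 - G) :=
    (geom_sum_mul_neg G N).symm
  have e2 : (1 - G ^ N : Module.End A M) = (1 - G) * ∑ j ∈ Finset.range N, G ^ j :=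
    (mul_neg_geom_sum G N).symm
  constructor
  · have := hbij.1
    rw [e1] at this
    exact Function.Injective.of_comp this
  · have := hbij.2
    rw [e2] at this
    exact Function.Surjective.of_comp this

/-- A differential with a homotopy from the identity to a projection `Q`, up to a topologically
nilpotent error, has the image of `Q` for its cohomology. -/
structure IsPerturbedContraction (x : A) (d h Q : Module.End A M) : Prop where
  complete : IsXComplete x M
  d_d : ∀ y, d (d y) = 0
  d_Q : ∀ y, d (Q y) = 0
  h_Q : ∀ y, h (Q y) = 0
  Q_Q : ∀ y, Q (Q y) = Q y
  nilpotent : ∃ N : ℕ, ∀ y, ∃ z, ((d * h + h * d + Q - 1) ^ N) y = x • z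

/-- With `E` the error term, `Q y = d z` implies `d (E z) = -Q y`, because `h Q = 0` and `d Q = 0`.
Iterating, `Q y = d ((-E) ^ s z)` for all `s`, so `Q y` is divisible by every power of `x`. -/
lemma IsPerturbedContraction.eq_zero {x : A} {d h Q : Module.End A M}
    (H : IsPerturbedContraction x d h Q) {y z : M} (hyz : Q y = d z) : Q y = 0 := by
  obtain ⟨N, hN⟩ := H.nilpotent
  set E := d * h + h * d + Q - 1 with hE
  have hstep : ∀ z, d z = Q y → d (E z) = -Q y := by
    intro z hz
    rw [hE]
    simp only [LinearMap.sub_apply, LinearMap.add_apply, Module.End.mul_apply,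
      Module.End.one_apply, map_sub, map_add, H.d_d, H.d_Q, hz, H.h_Q, map_zero]
    simp
  have hstep2 : ∀ (s : ℕ) z, d z = Q y → d (((-E) ^ s) z) = Q y := by
    intro s
    induction s with
    | zero => exact fun z hz => by simpa using hz
    | succ s ih =>
      intro z hz
      rw [pow_succ', Module.End.mul_apply, LinearMap.neg_apply, map_neg, hstep _ (ih z hz), neg_neg]
  refine H.complete.haus _ fun s => ?_
  have hpow : ∀ (s : ℕ) (y : M), ∃ z, ((-E) ^ (N * s)) y = x ^ s • z := by
    intro s
    induction s with
    | zero => exact fun y => ⟨y, by simp⟩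
    | succ s ih =>
      intro y
      obtain ⟨z, hz⟩ := ih y
      obtain ⟨z', hz'⟩ := hN z
      have hexp : (-E) ^ (N * (s + 1)) = (-E) ^ N * (-E) ^ (N * s) := by
        rw [← pow_add]; congr 1; ring
      rw [hexp, Module.End.mul_apply, hz, map_smul, pow_succ]
      rcases Nat.even_or_odd N with hN' | hN'
      · exact ⟨z', by rw [hN'.neg_pow, hz', mul_smul]⟩
      · exact ⟨-z', by rw [hN'.neg_pow, LinearMap.neg_apply, hz', mul_smul, smul_neg, smul_neg,
          smul_neg]⟩
  obtain ⟨w, hw⟩ := hpow s z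
  refine ⟨d w, ?_⟩
  rw [← hstep2 (N * s) z hyz.symm, hw, map_smul]

/-- The operator `Φ = d h + h d + Q` is bijective, so `y = Φ w`. Closedness of `y` gives `d h d w =
0`, whence `Φ (d w) = Q (d w) = Φ (Q (d w))` and `d w = Q (d w)`. This is both exact and in the
image of `Q`, hence zero, leaving `y = Q w + d (h w)`. -/
lemma IsPerturbedContraction.exists_of_closed {x : A} {d h Q : Module.End A M}
    (H : IsPerturbedContraction x d h Q) {y : M} (hy : d y = 0) : ∃ a b, y = Q a + d b := by
  obtain ⟨N, hN⟩ := H.nilpotent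
  set E := d * h + h * d + Q - 1 with hE
  have hΦ : d * h + h * d + Q = 1 - -E := by rw [hE]; abel
  have hbij := H.complete.bijective_one_sub (G := -E) (N := N) fun y => by
    obtain ⟨z, hz⟩ := hN y
    rcases Nat.even_or_odd N with h | h
    · exact ⟨z, by rw [h.neg_pow, hz]⟩
    · exact ⟨-z, by rw [h.neg_pow, LinearMap.neg_apply, hz, smul_neg]⟩
  rw [← hΦ] at hbij
  obtain ⟨w, hw⟩ := hbij.2 y
  simp only [LinearMap.add_apply, Module.End.mul_apply] at hw
  have h1 : d (h (d w)) = 0 := by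
    have := congrArg d hw
    simpa [hy, H.d_d, H.d_Q] using this
  have h2 : d w = Q (d w) := by
    apply hbij.1
    simp only [LinearMap.add_apply, Module.End.mul_apply, H.d_d, H.d_Q, H.h_Q, H.Q_Q, h1, map_zero]
  have h3 : d w = 0 := h2.trans (H.eq_zero h2.symm)
  refine ⟨w, h w, ?_⟩
  rw [← hw, h3, map_zero, add_zero, add_comm]

/-- Nilpotency of an endomorphism that is strictly triangular modulo an ideal. -/
lemma exists_pow_apply_mem {μ : ℕ} {E : Module.End A M} {P : Fin μ → Module.End A M}
    (hP : ∀ y, ∑ i, P i y = y) {a : Ideal A}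
    (hE : ∀ i j, j ≤ i → ∀ y, P j (E (P i y)) ∈ (a • ⊤ : Submodule A M)) (k : ℕ) (y : M) :
    (E ^ (μ * k)) y ∈ (a ^ k • ⊤ : Submodule A M) := by
  have hlin : ∀ (b : Ideal A) (f : Module.End A M) z, z ∈ (b • ⊤ : Submodule A M) →
      f z ∈ (b • ⊤ : Submodule A M) := by
    intro b f z hz
    have := Submodule.mem_map_of_mem (f := f) hz
    rw [Submodule.map_smul''] at this
    exact Submodule.smul_mono le_rfl le_top this
  -- Each application of `E` raises the block strictly modulo `a`, so after `s` steps the blocks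
  -- below `s` are empty.
  have h1 : ∀ (s : ℕ) (j : Fin μ), (j : ℕ) < s → ∀ y, P j ((E ^ s) y) ∈ (a • ⊤ : Submodule A M) := by
    intro s
    induction s with
    | zero => exact fun j hj => (Nat.not_lt_zero _ hj).elim
    | succ s ih =>
      intro j hj y
      rw [pow_succ', Module.End.mul_apply, ← hP ((E ^ s) y), map_sum, map_sum]
      refine sum_mem fun i _ => ?_
      rcases le_or_gt j i with hji | hij
      · exact hE i j hji _
      · have hi : (i : ℕ) < s := by
          have : (i : ℕ) < j := hij
          omega
        exact hlin a (P j) _ (hlin a E _ (ih i hi y))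
  have h2 : ∀ y, (E ^ μ) y ∈ (a • ⊤ : Submodule A M) := by
    intro y
    rw [← hP ((E ^ μ) y)]
    exact sum_mem fun i _ => h1 μ i i.2 y
  induction k with
  | zero =>
    rw [pow_zero, Ideal.one_eq_top, Submodule.top_smul]
    trivial
  | succ k ih =>
    have hexp : E ^ (μ * (k + 1)) = E ^ μ * E ^ (μ * k) := by
      rw [← pow_add]; congr 1; ring
    rw [hexp, Module.End.mul_apply]
    have h3 := Submodule.mem_map_of_mem (f := E ^ μ) ih
    rw [Submodule.map_smul''] at h3
    rw [pow_succ, Submodule.mul_smul]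
    refine Submodule.smul_mono le_rfl ?_ h3
    rintro _ ⟨z, -, rfl⟩
    exact h2 z

end Complete

lemma PowerSeries.isXComplete {A B : Type*} [CommRing A] [CommRing B] [Algebra A B] :
    IsXComplete (PowerSeries.X : PowerSeries A) (PowerSeries B) := by
  have hX : ∀ (s : ℕ) (b : PowerSeries B),
      (PowerSeries.X : PowerSeries A) ^ s • b = PowerSeries.X ^ s * b := by
    intro s b
    rw [Algebra.smul_def, PowerSeries.algebraMap_apply'', map_pow, PowerSeries.map_X]
  constructor
  · intro y hy
    ext e
    obtain ⟨z, hz⟩ := hy (e + 1)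
    rw [hz, hX, PowerSeries.coeff_X_pow_mul']
    simp
  · intro c
    refine ⟨PowerSeries.mk fun e => ∑ j ∈ Finset.range (e + 1), PowerSeries.coeff (e - j) (c j),
      fun s => ?_⟩
    have hdvd : (PowerSeries.X : PowerSeries B) ^ s ∣
        (PowerSeries.mk fun e => ∑ j ∈ Finset.range (e + 1), PowerSeries.coeff (e - j) (c j)) -
          ∑ j ∈ Finset.range s, (PowerSeries.X : PowerSeries A) ^ j • c j := by
      rw [PowerSeries.X_pow_dvd_iff]
      intro e he
      rw [map_sub, PowerSeries.coeff_mk, map_sum, sub_eq_zero]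
      simp only [hX, PowerSeries.coeff_X_pow_mul']
      rw [← Finset.sum_subset (Finset.range_subset_range.2 (Nat.succ_le_of_lt he))
        (f := fun j => if j ≤ e then PowerSeries.coeff (e - j) (c j) else 0)]
      · refine Finset.sum_congr rfl fun j hj => ?_
        rw [Finset.mem_range] at hj
        rw [if_pos (by omega)]
      · intro j _ hj
        rw [Finset.mem_range] at hj
        rw [if_neg (by omega)]
    obtain ⟨z, hz⟩ := hdvd
    exact ⟨z, by rw [hz, hX]⟩

end

open scoped TensorProduct

noncomputable section

namespace LogLG

namespace SmoothCompleteFan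

variable {n : ℕ} {ι : Type} [Fintype ι] [DecidableEq ι] (S : SmoothCompleteFan n ι)

/-! ### Extension of operators from functions on the total space to forms on its thickenings -/

section OkOperators

variable (T : Type) (k : ℕ)

lemma toRk_surjective : Function.Surjective (S.toRk T k) := Ideal.Quotient.mk_surjective

lemma toRk_eq_zero_iff (r : S.R T) : S.toRk T k r = 0 ↔ r ∈ S.maxIdeal T ^ (k + 1) :=
  Ideal.Quotient.eq_zero_iff_mem

lemma toRk_smul_toOk (r : S.R T) (f : S.holo T) :
    S.toRk T k r • S.toOk T k f = S.toOk T k (r • f) := by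
  change S.toRk T k r • ((1 : S.Rk T k) ⊗ₜ[S.R T] f) = (1 : S.Rk T k) ⊗ₜ[S.R T] (r • f)
  rw [TensorProduct.smul_tmul', TensorProduct.tmul_smul, TensorProduct.smul_tmul', smul_eq_mul,
    Algebra.smul_def]
  rfl

lemma toOk_surjective : Function.Surjective (S.toOk T k) := by
  intro x
  induction x using TensorProduct.induction_on with
  | zero => exact ⟨0, map_zero _⟩
  | tmul a f =>
    obtain ⟨r, rfl⟩ := S.toRk_surjective T k a
    refine ⟨r • f, ?_⟩
    rw [← toRk_smul_toOk]
    change S.toRk T k r • ((1 : S.Rk T k) ⊗ₜ[S.R T] f) = _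
    rw [TensorProduct.smul_tmul', smul_eq_mul, mul_one]
  | add x y hx hy =>
    obtain ⟨f, rfl⟩ := hx
    obtain ⟨g, rfl⟩ := hy
    exact ⟨f + g, map_add _ _ _⟩

lemma toOk_eq_zero_iff (f : S.holo T) :
    S.toOk T k f = 0 ↔ f ∈ (S.maxIdeal T ^ (k + 1) • ⊤ : Submodule (S.R T) (S.holo T)) := by
  have h := TensorProduct.quotTensorEquivQuotSMul_mk_tmul (M := S.holo T)
    (S.maxIdeal T ^ (k + 1)) 1 f
  rw [one_smul] at h
  rw [← Submodule.Quotient.mk_eq_zero, ← h, LinearEquiv.map_eq_zero_iff]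
  rfl

/-- The extension to `𝒪(𝒳_k)` of an endomorphism of `𝒪(𝒳)`. -/
def extOk : Module.End (S.R T) (S.holo T) →+* Module.End (S.Rk T k) (S.Ok T k) where
  toFun A := A.baseChange (S.Rk T k)
  map_one' := LinearMap.baseChange_id
  map_mul' _ _ := LinearMap.baseChange_comp _ _
  map_zero' := LinearMap.baseChange_zero
  map_add' := LinearMap.baseChange_add

lemma extOk_toOk (A : Module.End (S.R T) (S.holo T)) (f : S.holo T) :
    S.extOk T k A (S.toOk T k f) = S.toOk T k (A f) := rfl

/-- The coefficientwise extension of an endomorphism to power series. -/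
def coeffwise {A B : Type*} [CommRing A] [CommRing B] [Algebra A B] :
    Module.End A B →+* Module.End (PowerSeries A) (PowerSeries B) where
  toFun f :=
    { toFun := fun b => PowerSeries.mk fun e => f (PowerSeries.coeff e b)
      map_add' := fun b b' => by ext e; simp
      map_smul' := fun r b => by
        ext e
        simp only [Algebra.smul_def, PowerSeries.algebraMap_apply'', RingHom.id_apply,
          PowerSeries.coeff_mk, PowerSeries.coeff_mul, PowerSeries.coeff_map, map_sum]
        refine Finset.sum_congr rfl fun p _ => ?_
        rw [← Algebra.smul_def, ← Algebra.smul_def, map_smul] }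
  map_one' := by ext b e; simp
  map_mul' f g := by ext b e; simp
  map_zero' := by ext b e; simp
  map_add' f g := by ext b e; simp

lemma coeff_coeffwise {A B : Type*} [CommRing A] [CommRing B] [Algebra A B] (f : Module.End A B)
    (b : PowerSeries B) (e : ℕ) :
    PowerSeries.coeff e (coeffwise f b) = f (PowerSeries.coeff e b) :=
  PowerSeries.coeff_mk e fun e => f (PowerSeries.coeff e b)

/-- The extension to `𝒪(𝒳_k)[[u]]` of an endomorphism of `𝒪(𝒳)`. -/
def extU : Module.End (S.R T) (S.holo T) →+*
    Module.End (S.Rku T k) (PowerSeries (S.Ok T k)) :=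
  coeffwise.comp (S.extOk T k)

variable {T k}

lemma coeff_extU (A : Module.End (S.R T) (S.holo T)) {b : PowerSeries (S.Ok T k)} {e : ℕ}
    {f : S.holo T} (h : PowerSeries.coeff e b = S.toOk T k f) :
    PowerSeries.coeff e (S.extU T k A b) = S.toOk T k (A f) := by
  rw [extU, RingHom.comp_apply, coeff_coeffwise, h, extOk_toOk]

variable (T k)

lemma extU_relDer (j : Fin n) : S.extU T k (S.relDer T j) = S.derU T k j := rfl

lemma exists_lift_coeff (b : PowerSeries (S.Ok T k)) :
    ∃ f : ℕ → S.holo T, ∀ e, PowerSeries.coeff e b = S.toOk T k (f e) := by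
  choose f hf using fun e => S.toOk_surjective T k (PowerSeries.coeff e b)
  exact ⟨f, fun e => (hf e).symm⟩

lemma extU_mulLeft (g : S.holo T) (b : PowerSeries (S.Ok T k)) :
    S.extU T k (LinearMap.mulLeft (S.R T) g) b = S.toU T k g * b := by
  obtain ⟨f, hf⟩ := S.exists_lift_coeff T k b
  ext e
  rw [S.coeff_extU _ (hf e), toU, PowerSeries.coeff_C_mul, hf, ← map_mul, LinearMap.mulLeft_apply]

/-- The extension to forms of an endomorphism of `𝒪(𝒳)` and one of `⋀ N`. -/
def opF (A : Module.End (S.R T) (S.holo T)) (β : Module.End (S.Rku T k) (S.Ext T k)) :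
    Module.End (S.Rku T k) (S.Forms T k) :=
  (TensorProduct.map (S.extU T k A) β : PowerSeries (S.Ok T k) ⊗[S.Rku T k] S.Ext T k →ₗ[S.Rku T k]
        PowerSeries (S.Ok T k) ⊗[S.Rku T k] S.Ext T k)

lemma opF_form (A : Module.End (S.R T) (S.holo T)) (β : Module.End (S.Rku T k) (S.Ext T k))
    (b : PowerSeries (S.Ok T k)) (ω : S.Ext T k) :
    S.opF T k A β (S.form T k b ω) = S.form T k (S.extU T k A b) (β ω) := rfl

/-- The form `b ω` as a bilinear map. -/
def formHom : PowerSeries (S.Ok T k) →ₗ[S.Rku T k] S.Ext T k →ₗ[S.Rku T k] S.Forms T k :=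
  TensorProduct.mk (S.Rku T k) (PowerSeries (S.Ok T k)) (S.Ext T k)

lemma formHom_apply (b : PowerSeries (S.Ok T k)) (ω : S.Ext T k) :
    S.formHom T k b ω = S.form T k b ω := rfl

lemma form_mul (b c : PowerSeries (S.Ok T k)) (ω η : S.Ext T k) :
    S.form T k b ω * S.form T k c η = S.form T k (b * c) (ω * η) :=
  Algebra.TensorProduct.tmul_mul_tmul b c ω η

lemma forms_induction {p : S.Forms T k → Prop} (h0 : p 0) (hadd : ∀ x y, p x → p y → p (x + y))
    (hform : ∀ b ω, p (S.form T k b ω)) (x : S.Forms T k) : p x :=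
  TensorProduct.induction_on x h0 hform hadd

lemma opF_opF (A B : Module.End (S.R T) (S.holo T)) (β γ : Module.End (S.Rku T k) (S.Ext T k))
    (y : S.Forms T k) : S.opF T k A β (S.opF T k B γ y) = S.opF T k (A * B) (β * γ) y := by
  induction y using S.forms_induction with
  | h0 => simp only [map_zero]
  | hadd x y hx hy => simp only [map_add, hx, hy]
  | hform b ω => simp only [opF_form, map_mul]; rfl

end OkOperators

/-! ### The twisted differential in coordinates -/

section Twist

variable (T : Type) (k : ℕ)

lemma del_form (b : PowerSeries (S.Ok T k)) (ω : S.Ext T k) :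
    S.del T k (S.form T k b ω) = ∑ j, S.form T k (S.derU T k j b)
      (ExteriorAlgebra.ι (S.Rku T k) (Pi.single j 1) * ω) := by
  have h : S.del T k = ∑ j, S.opF T k (S.relDer T j)
    (LinearMap.mulLeft (S.Rku T k) (ExteriorAlgebra.ι (S.Rku T k) (Pi.single j 1))) := rfl
  rw [h, LinearMap.sum_apply]
  rfl

/-- The twisted derivative in the direction of the `j`-th coordinate of `N`. -/
def nabla (F : S.holo T) (j : Fin n) : Module.End (S.Rku T k) (PowerSeries (S.Ok T k)) :=
  S.extU T k (LinearMap.mulLeft (S.R T) (S.relDer T j F)) +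
    (PowerSeries.X : S.Rku T k) • S.derU T k j

lemma derU_toU (j : Fin n) (f : S.holo T) :
    S.derU T k j (S.toU T k f) = S.toU T k (S.relDer T j f) := by
  ext e
  rw [← extU_relDer, S.coeff_extU (f := if e = 0 then f else 0)]
  · rw [toU, PowerSeries.coeff_C]
    split_ifs <;> simp
  · rw [toU, PowerSeries.coeff_C]
    split_ifs <;> simp

lemma twist_form (F : S.holo T) (b : PowerSeries (S.Ok T k)) (ω : S.Ext T k) :
    S.twist T k F (S.form T k b ω) = ∑ j, S.form T k (S.nabla T k F j b)
      (ExteriorAlgebra.ι (S.Rku T k) (Pi.single j 1) * ω) := by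
  rw [twist, LinearMap.add_apply, LinearMap.mulLeft_apply, LinearMap.smul_apply, del_form, del_form,
    Finset.sum_mul, Finset.smul_sum, ← Finset.sum_add_distrib]
  refine Finset.sum_congr rfl fun j _ => ?_
  rw [form_mul, mul_one, derU_toU, ← extU_mulLeft]
  simp only [← formHom_apply]
  rw [← LinearMap.smul_apply, ← map_smul, ← LinearMap.add_apply, ← map_add]
  rfl

lemma relDer_mul (j : Fin n) (f g : S.holo T) :
    S.relDer T j (f * g) = S.relDer T j f * g + f * S.relDer T j g := by
  refine Subtype.ext (funext fun x => ?_)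
  have h := deriv_fun_mul (S.differentiable_flow T (S.coordFun j) f x)
    (S.differentiable_flow T (S.coordFun j) g x)
  have h' : S.flow T (S.coordFun j) 0 x = x := S.flow_zero T _ x
  rw [h'] at h
  exact h

variable {S T}

lemma coeff_relDer [Fintype T] (j : Fin n) (f : S.holo T) (q : S.Pphi × (T →₀ ℕ)) :
    coeff (S.relDer T j f) q = coeff f q * S.raySum q.1.1 j := by
  refine congrFun (coeff_eq (c := fun q => coeff f q * S.raySum q.1.1 j) fun x => ?_) q
  obtain ⟨h1, h2⟩ := S.hasDeriv_flow T (S.coordFun j) (hasSum_coeff f) x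
  change HasSum _ (deriv (fun y : ℂ => f.1 (S.flow T (S.coordFun j) y x)) 0)
  rw [h1.deriv]
  exact h2.hasSum

lemma relDer_comm [Fintype T] (i j : Fin n) (f : S.holo T) :
    S.relDer T i (S.relDer T j f) = S.relDer T j (S.relDer T i f) :=
  coeff_ext fun q => by simp only [coeff_relDer]; ring

variable (S T)

/-- The cross terms are `u D_i D_j F`, which is symmetric in `i` and `j`; the twisted derivatives
form a flat connection. -/
lemma nabla_comm [Fintype T] (F : S.holo T) (i j : Fin n) (b : PowerSeries (S.Ok T k)) :
    S.nabla T k F i (S.nabla T k F j b) = S.nabla T k F j (S.nabla T k F i b) := by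
  have h1 : ∀ (i j : Fin n) (f : S.holo T), (S.relDer T i * LinearMap.mulLeft (S.R T) f) =
      LinearMap.mulLeft (S.R T) (S.relDer T i f) + LinearMap.mulLeft (S.R T) f * S.relDer T i := by
    intro i j f
    ext1 g
    exact S.relDer_mul T i f g
  have h2 : S.relDer T i * S.relDer T j = S.relDer T j * S.relDer T i := by
    ext1 f; exact relDer_comm i j f
  have h3 : ∀ f g : S.holo T, LinearMap.mulLeft (S.R T) f * LinearMap.mulLeft (S.R T) g =
      LinearMap.mulLeft (S.R T) g * LinearMap.mulLeft (S.R T) f := by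
    intro f g; ext1 h; exact mul_left_comm f g h
  suffices h : S.nabla T k F i * S.nabla T k F j = S.nabla T k F j * S.nabla T k F i from
    congrArg (fun f => f b) h
  simp only [nabla, ← extU_relDer, mul_add, add_mul, mul_smul_comm, smul_mul_assoc, ← map_mul,
    h1 i j, h1 j i, h2, h3 (S.relDer T i F), relDer_comm i j F, map_add, smul_add]
  abel

/-- Commuting derivatives are paired with anticommuting one-forms, so the terms cancel under the
exchange of the two indices. -/
lemma twist_twist [Fintype T] (F : S.holo T) (y : S.Forms T k) :
    S.twist T k F (S.twist T k F y) = 0 := by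
  induction y using S.forms_induction with
  | h0 => simp only [map_zero]
  | hadd x y hx hy => simp only [map_add, hx, hy, add_zero]
  | hform b ω =>
    simp only [twist_form, map_sum]
    rw [← Finset.sum_product']
    refine Finset.sum_involution (fun p _ => (p.2, p.1)) (fun p _ => ?_) (fun p _ hp => ?_)
      (fun p _ => Finset.mem_univ _) (fun p _ => rfl)
    · have := eq_neg_of_add_eq_zero_left (ExteriorAlgebra.ι_add_mul_swap (R := S.Rku T k)
        (Pi.single p.1 1 : Fin n → S.Rku T k) (Pi.single p.2 1))
      rw [← mul_assoc, ← mul_assoc, this, neg_mul, nabla_comm]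
      simp only [← formHom_apply, map_neg]
      exact add_neg_cancel _
    · rintro h
      have h12 : p.2 = p.1 := congrArg Prod.fst h
      apply hp
      rw [h12, ← mul_assoc, ExteriorAlgebra.ι_sq_zero, zero_mul, ← formHom_apply, map_zero]

end Twist

end SmoothCompleteFan

end LogLG

end

open scoped TensorProduct

noncomputable section

namespace LogLG

namespace SmoothCompleteFan

variable {n : ℕ} {ι : Type} [Fintype ι] [DecidableEq ι] (S : SmoothCompleteFan n ι)

/-! ### Completeness of the module of forms -/

section Completeness

variable (T : Type) (k : ℕ)

/-- The basis of `⋀ N` given by the standard basis of `N`. -/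
def extBasis : Module.Basis (Finset (Fin n)) (S.Rku T k) (S.Ext T k) :=
  (Pi.basisFun (S.Rku T k) (Fin n)).ExteriorAlgebra

lemma extBasis_mem (s : Finset (Fin n)) :
    S.extBasis T k s ∈ ⋀[S.Rku T k]^(s.card) (Fin n → S.Rku T k) := by
  have h := ExteriorAlgebra.basis_eq_coe_basis (m := s.card) (Pi.basisFun (S.Rku T k) (Fin n))
    ⟨s, rfl⟩
  rw [extBasis]
  change (Pi.basisFun (S.Rku T k) (Fin n)).ExteriorAlgebra s = _ at h
  rw [h]
  exact Subtype.prop _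

/-- `⋀ N` is free of finite rank, so the forms are a finite power of `𝒪(𝒳_k)[[u]]`. -/
lemma forms_isXComplete : IsXComplete (PowerSeries.X : S.Rku T k) (S.Forms T k) := by
  have e : S.Forms T k ≃ₗ[S.Rku T k] (Finset (Fin n) → PowerSeries (S.Ok T k)) :=
    ((S.extBasis T k).baseChange (PowerSeries (S.Ok T k))).equivFun.restrictScalars (S.Rku T k)
  exact (PowerSeries.isXComplete.pi _).of_equiv e

lemma forms_induction_degree {P : S.Forms T k → Prop} (h0 : P 0)
    (hadd : ∀ x y, P x → P y → P (x + y))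
    (hform : ∀ b, ∀ p ≤ n, ∀ ω ∈ ⋀[S.Rku T k]^p (Fin n → S.Rku T k), P (S.form T k b ω))
    (x : S.Forms T k) : P x := by
  induction x using S.forms_induction with
  | h0 => exact h0
  | hadd x y hx hy => exact hadd x y hx hy
  | hform b ω =>
    rw [← (S.extBasis T k).sum_repr ω, ← formHom_apply, map_sum]
    refine Finset.sum_induction _ P hadd h0 fun s _ => ?_
    exact hform b s.card (by simpa using Finset.card_le_univ s) _
      (Submodule.smul_mem _ _ (S.extBasis_mem T k s))

end Completeness

/-! ### Reduction of the twisted complex to the central fibre -/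

section BaseIdeal

variable (T : Type) (k : ℕ)

/-- The ideal of `ℛ_k[[u]]` generated by `𝓘` and `u`. -/
def baseIdeal : Ideal (S.Rku T k) :=
  Ideal.map ((PowerSeries.C).comp (S.toRk T k)) (S.maxIdeal T) ⊔ Ideal.span {PowerSeries.X}

/-- Modulo `u` the power becomes the image of `𝓘 ^ (k + 1)`, which is zero in `ℛ_k`. -/
lemma baseIdeal_pow_le : S.baseIdeal T k ^ (k + 1) ≤ Ideal.span {PowerSeries.X} := by
  intro x hx
  have h1 := Ideal.mem_map_of_mem (PowerSeries.constantCoeff (R := S.Rk T k)) hx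
  have h2 : Ideal.map (PowerSeries.constantCoeff (R := S.Rk T k)) (S.baseIdeal T k) ≤
      Ideal.map (S.toRk T k) (S.maxIdeal T) := by
    rw [baseIdeal, Ideal.map_sup, Ideal.map_map, Ideal.map_span, Set.image_singleton,
      PowerSeries.constantCoeff_X, sup_le_iff]
    refine ⟨le_of_eq ?_, by simp⟩
    congr 1
  rw [Ideal.map_pow] at h1
  have h3 := Ideal.pow_right_mono h2 (k + 1) h1
  rw [← Ideal.map_pow] at h3
  have h4 : Ideal.map (S.toRk T k) (S.maxIdeal T ^ (k + 1)) = ⊥ :=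
    Ideal.map_quotient_self _
  rw [h4, Ideal.mem_bot] at h3
  rw [Ideal.mem_span_singleton]
  exact PowerSeries.X_dvd_iff.2 h3

lemma X_mem_baseIdeal : (PowerSeries.X : S.Rku T k) ∈ S.baseIdeal T k :=
  Ideal.mem_sup_right (Ideal.mem_span_singleton_self _)

/-- The forms divisible by `𝓘` and `u`. -/
abbrev smallForms : Submodule (S.Rku T k) (S.Forms T k) := S.baseIdeal T k • ⊤

lemma coeff_C_smul {A B : Type*} [CommRing A] [CommRing B] [Algebra A B] (a : A)
    (b : PowerSeries B) (e : ℕ) :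
    PowerSeries.coeff e ((PowerSeries.C a : PowerSeries A) • b) = a • PowerSeries.coeff e b := by
  rw [Algebra.smul_def, PowerSeries.algebraMap_apply'', PowerSeries.map_C,
    PowerSeries.coeff_C_mul, ← Algebra.smul_def]

variable {S T}

/-- One finite set of generators of `𝓘` serves all coefficients in `u` at once, so the
decompositions assemble into a finite sum of power series. -/
lemma form_extU_mem [Fintype T] (hS : S.IsProjective) {A : Module.End (S.R T) (S.holo T)}
    (hA : ∀ f m, co (A f) m 0 = 0) (b : PowerSeries (S.Ok T k)) (ω : S.Ext T k) :
    S.form T k (S.extU T k A b) ω ∈ S.smallForms T k := by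
  obtain ⟨Γ, hΓ, hΓ'⟩ := S.exists_base_generators T
  obtain ⟨f, hf⟩ := S.exists_lift_coeff T k b
  choose g hg _ using fun e => S.exists_decomposition hS hΓ hΓ' (A (f e)) (hA (f e))
  have h : S.extU T k A b = ∑ γ ∈ Γ, (PowerSeries.C (S.toRk T k (S.rmon γ 1)) : S.Rku T k) •
      PowerSeries.mk fun e => S.toOk T k (g e γ) := by
    ext e
    rw [S.coeff_extU _ (hf e), hg, map_sum, map_sum]
    refine Finset.sum_congr rfl fun γ _ => ?_
    rw [coeff_C_smul, PowerSeries.coeff_mk, toRk_smul_toOk]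
  rw [h, ← formHom_apply, map_sum, LinearMap.sum_apply]
  refine sum_mem fun γ hγ => ?_
  rw [map_smul, LinearMap.smul_apply]
  have h1 : (PowerSeries.C (S.toRk T k (S.rmon γ 1)) : S.Rku T k) ∈ S.baseIdeal T k :=
    Ideal.mem_sup_left (Ideal.mem_map_of_mem ((PowerSeries.C).comp (S.toRk T k))
      (S.rmon_mem_maxIdeal (hΓ γ hγ) 1))
  exact Submodule.smul_mem_smul h1 Submodule.mem_top

lemma mk_form_extU_eq [Fintype T] (hS : S.IsProjective) {A B : Module.End (S.R T) (S.holo T)}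
    (hAB : ∀ f m, co (A f) m 0 = co (B f) m 0) (b : PowerSeries (S.Ok T k)) (ω : S.Ext T k) :
    (S.smallForms T k).mkQ (S.form T k (S.extU T k A b) ω) =
      (S.smallForms T k).mkQ (S.form T k (S.extU T k B b) ω) := by
  rw [← sub_eq_zero, ← map_sub, Submodule.mkQ_apply, Submodule.Quotient.mk_eq_zero]
  have h1 := form_extU_mem k hS (A := A - B)
    (fun f m => by rw [LinearMap.sub_apply, co_sub, hAB, sub_self]) b ω
  have h2 : S.form T k (S.extU T k A b) ω =
      S.form T k (S.extU T k (A - B) b) ω + S.form T k (S.extU T k B b) ω := by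
    have h3 : S.extU T k A b = S.extU T k (A - B) b + S.extU T k B b := by
      have h4 : A = (A - B) + B := LinearMap.ext fun f => (sub_add_cancel (A f) (B f)).symm
      conv_lhs => rw [h4, map_add]
      rfl
    rw [h3, ← formHom_apply, map_add]
    rfl
  rwa [h2, add_sub_cancel_right]

/-- The class of `(A b) ω` modulo the forms divisible by `𝓘` and `u`. -/
def reduction (b : PowerSeries (S.Ok T k)) :
    Module.End (S.R T) (S.holo T) →+ S.Ext T k →+ S.Forms T k ⧸ S.smallForms T k :=
  AddMonoidHom.mk' (fun A => AddMonoidHom.mk'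
      (fun ω => (S.smallForms T k).mkQ (S.form T k (S.extU T k A b) ω))
      fun ω η => by rw [← formHom_apply, map_add, map_add]; rfl)
    fun A B => AddMonoidHom.ext fun ω => by
      change (S.smallForms T k).mkQ (S.formHom T k (S.extU T k (A + B) b) ω) = _
      rw [map_add, LinearMap.add_apply, map_add, LinearMap.add_apply, map_add]
      rfl

lemma reduction_apply (b : PowerSeries (S.Ok T k)) (A : Module.End (S.R T) (S.holo T))
    (ω : S.Ext T k) : reduction k b A ω =
      (S.smallForms T k).mkQ (S.form T k (S.extU T k A b) ω) := rfl

lemma reduction_congr [Fintype T] (hS : S.IsProjective) {A B : Module.End (S.R T) (S.holo T)}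
    (hAB : ∀ f m, co (A f) m 0 = co (B f) m 0) (b : PowerSeries (S.Ok T k)) :
    reduction k b A = reduction k b B :=
  AddMonoidHom.ext fun ω => mk_form_extU_eq k hS hAB b ω

lemma reduction_eq_zero [Fintype T] (hS : S.IsProjective) {A : Module.End (S.R T) (S.holo T)}
    (hA : ∀ f m, co (A f) m 0 = 0) (b : PowerSeries (S.Ok T k)) :
    reduction k b A = 0 := by
  rw [reduction_congr k hS (B := 0) (fun f m => by rw [hA, LinearMap.zero_apply, co_zero]), map_zero]

/-- Multiplication by a coordinate. -/
abbrev mulZ (s : ι) : Module.End (S.R T) (S.holo T) := LinearMap.mulLeft (S.R T) (S.z T s)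

/-- The generator of a ray in `⋀¹ N`. -/
def rayE (S : SmoothCompleteFan n ι) (T : Type) (k : ℕ) (s : ι) : Fin n → S.Rku T k :=
  fun j => (S.ray s j : S.Rku T k)

/-- The coordinates on `N` dual to the rays of a maximal cone. -/
def dualE (S : SmoothCompleteFan n ι) (T : Type) (k : ℕ) (τ : Finset ι) (r : ι) :
    Module.Dual (S.Rku T k) (Fin n → S.Rku T k) :=
  Fintype.linearCombination (S.Rku T k) fun j => (S.dual τ r (Pi.single j 1) : S.Rku T k)

lemma dualE_apply (τ : Finset ι) (r : ι) (v : Fin n → S.Rku T k) :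
    dualE S T k τ r v = ∑ j, v j * (S.dual τ r (Pi.single j 1) : S.Rku T k) := by
  simp [dualE, Fintype.linearCombination_apply]

lemma dualE_rayE {τ : Finset ι} (hτ : τ ∈ S.cones) (hn : τ.card = n) {r s : ι} (hr : r ∈ τ)
    (hs : s ∈ τ) : dualE S T k τ r (rayE S T k s) = if r = s then 1 else 0 := by
  have h := S.dual_ray hτ hn hr hs
  have h1 : S.ray s = ∑ j, S.ray s j • (Pi.single j 1 : Fin n → ℤ) := by
    ext j; simp [Finset.sum_apply, Pi.single_apply]
  rw [h1, map_sum] at h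
  simp only [map_smul, smul_eq_mul] at h
  rw [dualE_apply]
  have := congrArg (Int.cast : ℤ → S.Rku T k) h
  push_cast at this
  exact this

lemma sum_dualE {τ : Finset ι} (hτ : τ ∈ S.cones) (hn : τ.card = n) (v : Fin n → S.Rku T k) :
    ∑ r ∈ τ, dualE S T k τ r v • rayE S T k r = v := by
  have h1 : ∀ j l : Fin n, ∑ r ∈ τ, S.dual τ r (Pi.single j 1) * S.ray r l =
      if l = j then 1 else 0 := by
    intro j l
    have := congrFun (S.sum_dual hτ hn (Pi.single j 1)) l
    simpa [Finset.sum_apply, Pi.single_apply] using this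
  ext1 l
  simp only [Finset.sum_apply, Pi.smul_apply, smul_eq_mul, dualE_apply, rayE, Finset.sum_mul]
  rw [Finset.sum_comm]
  have h2 : ∀ j, ∑ r ∈ τ, v j * (S.dual τ r (Pi.single j 1) : S.Rku T k) * (S.ray r l : S.Rku T k)
      = if l = j then v j else 0 := by
    intro j
    have := congrArg (Int.cast : ℤ → S.Rku T k) (h1 j l)
    push_cast at this
    simp only [mul_assoc, ← Finset.mul_sum, this]
    split_ifs <;> simp
  simp only [h2]
  simp

lemma ι_rayE (s : ι) : ExteriorAlgebra.ι (S.Rku T k) (rayE S T k s) =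
    ∑ j, S.ray s j • ExteriorAlgebra.ι (S.Rku T k) (Pi.single j 1 : Fin n → S.Rku T k) := by
  have h : rayE S T k s = ∑ j, S.ray s j • (Pi.single j 1 : Fin n → S.Rku T k) := by
    ext1 j
    simp [Finset.sum_apply, Pi.single_apply, rayE]
  rw [h, map_sum]
  simp only [map_zsmul]

/-- The derivatives of `F` are those of `∑ z_i` along the central fibre. -/
def IsUnfolding (F : S.holo T) : Prop := ∀ j f m,
  co (S.relDer T j F * f) m 0 = co (∑ s, S.ray s j • (S.z T s * f)) m 0

/-- On the central fibre `u ∂` vanishes and `D_j F` is `∑_s (ρ_s)_j z_s`. Collecting the coordinate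
one-forms into the vectors `ρ_s` leaves the Koszul differential. -/
lemma mk_twist_form [Fintype T] (hS : S.IsProjective) {F : S.holo T} (hF : IsUnfolding F)
    (A : Module.End (S.R T) (S.holo T)) (b : PowerSeries (S.Ok T k)) (ω : S.Ext T k) :
    (S.smallForms T k).mkQ (S.twist T k F (S.form T k (S.extU T k A b) ω)) =
      ∑ s, reduction k b (mulZ s * A) (ExteriorAlgebra.ι _ (rayE S T k s) * ω) := by
  have hX : ∀ j, (S.smallForms T k).mkQ (S.form T k (S.nabla T k F j (S.extU T k A b))
      (ExteriorAlgebra.ι (S.Rku T k) (Pi.single j 1) * ω)) =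
      ∑ s, reduction k b (S.ray s j • (mulZ s * A))
        (ExteriorAlgebra.ι (S.Rku T k) (Pi.single j 1) * ω) := by
    intro j
    rw [nabla, LinearMap.add_apply, ← formHom_apply, map_add, LinearMap.add_apply, map_add,
      LinearMap.smul_apply, map_smul, LinearMap.smul_apply]
    have h0 : (S.smallForms T k).mkQ ((PowerSeries.X : S.Rku T k) •
        S.formHom T k (S.derU T k j (S.extU T k A b))
          (ExteriorAlgebra.ι (S.Rku T k) (Pi.single j 1) * ω)) = 0 := by
      rw [Submodule.mkQ_apply, Submodule.Quotient.mk_eq_zero]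
      exact Submodule.smul_mem_smul (S.X_mem_baseIdeal T k) Submodule.mem_top
    rw [h0, add_zero, formHom_apply, ← Module.End.mul_apply, ← map_mul, ← reduction_apply,
      reduction_congr k hS (B := ∑ s, S.ray s j • (mulZ s * A)) (fun f m => ?_), map_sum,
      AddMonoidHom.finsetSum_apply]
    simp only [LinearMap.sum_apply]
    exact hF j (A f) m
  rw [twist_form, map_sum]
  simp only [hX]
  rw [Finset.sum_comm]
  refine Finset.sum_congr rfl fun s _ => ?_
  rw [ι_rayE, Finset.sum_mul, map_sum]
  refine Finset.sum_congr rfl fun j _ => ?_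
  rw [smul_mul_assoc, map_zsmul, map_zsmul]
  rfl

end BaseIdeal

end SmoothCompleteFan

end LogLG

end

open scoped TensorProduct

noncomputable section

namespace LogLG

namespace SmoothCompleteFan

variable {n : ℕ} {ι : Type} [Fintype ι] [DecidableEq ι] {S : SmoothCompleteFan n ι}

/-! ### The Koszul contraction and its triangular error -/

section Contraction

variable {μ : ℕ} {σ : Fin μ → Finset ι} (hS : S.IsProjective) (hσ : S.IsGoodOrder σ)
  (T : Type) [Fintype T] (k : ℕ)

/-- The Koszul contraction on forms. -/
def homotopy : Module.End (S.Rku T k) (S.Forms T k) :=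
  -- The index `n + 1 - p` makes the divisor `tot + n - p` in terms of the monomial before
  -- differentiation. The degree `p = n + 1` is included because the homotopy is also evaluated on
  -- `v ∧ ω` with `ω` of degree `n`.
  ∑ p ∈ Finset.range (n + 2), ∑ i, ∑ r ∈ σ i, S.opF T k (hop hS hσ T i r (n + 1 - p))
    (ExteriorAlgebra.contract (dualE S T k (σ i) r) * ExteriorAlgebra.degreeProj p)

/-- The projection of forms to the `i`-th block. -/
def projForms (i : Fin μ) : Module.End (S.Rku T k) (S.Forms T k) :=
  S.opF T k (proj hS hσ T i) 1

/-- The projection of forms to the multiples of the `φ_i Ω`. -/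
def phiProj : Module.End (S.Rku T k) (S.Forms T k) :=
  ∑ i, S.opF T k (projPhi hS T hσ i) (ExteriorAlgebra.degreeProj n)

lemma homotopy_form {p : ℕ} (hp : p ≤ n + 1) (b : PowerSeries (S.Ok T k)) {ω : S.Ext T k}
    (hω : ω ∈ ⋀[S.Rku T k]^p (Fin n → S.Rku T k)) :
    homotopy hS hσ T k (S.form T k b ω) = ∑ i, ∑ r ∈ σ i,
      S.form T k (S.extU T k (hop hS hσ T i r (n + 1 - p)) b)
        (ExteriorAlgebra.contract (dualE S T k (σ i) r) ω) := by
  rw [homotopy, LinearMap.sum_apply, Finset.sum_eq_single_of_mem p (by simp; omega)]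
  · simp only [LinearMap.sum_apply, opF_form, Module.End.mul_apply,
      ExteriorAlgebra.degreeProj_of_mem hω, if_pos]
  · intro q _ hq
    simp only [LinearMap.sum_apply, opF_form, Module.End.mul_apply,
      ExteriorAlgebra.degreeProj_of_mem hω, if_neg hq, map_zero]
    refine Finset.sum_eq_zero fun i _ => Finset.sum_eq_zero fun r _ => ?_
    rw [← formHom_apply, map_zero]

lemma projForms_form (i : Fin μ) (b : PowerSeries (S.Ok T k)) (ω : S.Ext T k) :
    projForms hS hσ T k i (S.form T k b ω) = S.form T k (S.extU T k (proj hS hσ T i) b) ω := rfl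

lemma phiProj_form {p : ℕ} (b : PowerSeries (S.Ok T k)) {ω : S.Ext T k}
    (hω : ω ∈ ⋀[S.Rku T k]^p (Fin n → S.Rku T k)) :
    phiProj hS hσ T k (S.form T k b ω) =
      if n = p then ∑ i, S.form T k (S.extU T k (projPhi hS T hσ i) b) ω else 0 := by
  rw [phiProj, LinearMap.sum_apply]
  simp only [opF_form, ExteriorAlgebra.degreeProj_of_mem hω]
  split_ifs
  · rfl
  · refine Finset.sum_eq_zero fun i _ => ?_
    rw [← formHom_apply, map_zero]

lemma sum_projForms (y : S.Forms T k) : ∑ i, projForms hS hσ T k i y = y := by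
  induction y using S.forms_induction with
  | h0 => simp only [map_zero, Finset.sum_const_zero]
  | hadd x y hx hy => simp only [map_add, Finset.sum_add_distrib, hx, hy]
  | hform b ω =>
    have h : ∑ i, proj hS hσ T i = 1 := LinearMap.ext fun f => by
      rw [LinearMap.sum_apply]
      exact sum_proj hS hσ f
    have h1 : ∑ i, S.extU T k (proj hS hσ T i) b = b := by
      rw [← LinearMap.sum_apply, ← map_sum, h, map_one]
      rfl
    conv_rhs => rw [← h1, ← formHom_apply, map_sum, LinearMap.sum_apply]
    rfl

/-- The endomorphism induced by one of forms on the central fibre. -/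
def redOp (G : Module.End (S.Rku T k) (S.Forms T k)) :
    S.Forms T k ⧸ S.smallForms T k →ₗ[S.Rku T k] S.Forms T k ⧸ S.smallForms T k :=
  Submodule.mapQ _ _ G (Submodule.map_le_iff_le_comap.1 (by
    rw [Submodule.map_smul'']
    exact Submodule.smul_mono le_rfl le_top))

lemma mkQ_apply_eq {T : Type} (G : Module.End (S.Rku T k) (S.Forms T k)) (y : S.Forms T k) :
    (S.smallForms T k).mkQ (G y) = redOp T k G ((S.smallForms T k).mkQ y) := rfl

lemma redOp_projForms_reduction (j : Fin μ) (b : PowerSeries (S.Ok T k))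
    (A : Module.End (S.R T) (S.holo T)) (ω : S.Ext T k) :
    redOp T k (projForms hS hσ T k j) (reduction k b A ω) =
      reduction k b (proj hS hσ T j * A) ω := by
  rw [reduction_apply, ← mkQ_apply_eq, projForms_form, ← Module.End.mul_apply, ← map_mul]
  rfl

variable {T k}

/-- The entry of `d h` from block `i` to block `j` on the central fibre. The homotopy preserves
blocks, so only its `i`-th summand contributes. -/
lemma mkQ_twist_homotopy {F : S.holo T} (hF : IsUnfolding F) {i j : Fin μ}
    {p : ℕ} (hp : p ≤ n) (b : PowerSeries (S.Ok T k)) {ω : S.Ext T k}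
    (hω : ω ∈ ⋀[S.Rku T k]^p (Fin n → S.Rku T k)) :
    (S.smallForms T k).mkQ (projForms hS hσ T k j (S.twist T k F (homotopy hS hσ T k
      (projForms hS hσ T k i (S.form T k b ω))))) =
    ∑ s, ∑ r ∈ σ i, reduction k b (proj hS hσ T j * (mulZ s * hop hS hσ T i r (n - p + 1)))
      (ExteriorAlgebra.ι _ (rayE S T k s) *
        ExteriorAlgebra.contract (dualE S T k (σ i) r) ω) := by
  have hc : ∀ i' r, hop hS hσ T i' r (n + 1 - p) * proj hS hσ T i =
      if i = i' then hop hS hσ T i' r (n - p + 1) else 0 := by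
    intro i' r
    rw [show n + 1 - p = n - p + 1 by omega]
    ext1 f
    have := hop_proj hS hσ (T := T) i' i r (n - p + 1) f
    rw [Module.End.mul_apply, this]
    split_ifs <;> rfl
  rw [projForms_form, homotopy_form hS hσ T k (by omega) _ hω]
  simp only [← Module.End.mul_apply (S.extU T k _), ← map_mul, hc]
  rw [Finset.sum_eq_single_of_mem i (Finset.mem_univ i)]
  · simp only [if_pos, map_sum]
    rw [Finset.sum_comm]
    refine Finset.sum_congr rfl fun r _ => ?_
    rw [mkQ_apply_eq, mk_twist_form k hS hF, map_sum]
    simp only [redOp_projForms_reduction]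
  · intro i' _ hi'
    refine Finset.sum_eq_zero fun r _ => ?_
    rw [if_neg (Ne.symm hi'), map_zero, LinearMap.zero_apply, ← formHom_apply, map_zero]
    rfl

/-- The entry of `h d`. The differential has raised the form degree by one, so the index of the
homotopy is `n - p` instead of `n - p + 1`. -/
lemma mkQ_homotopy_twist {F : S.holo T} (hF : IsUnfolding F) {i j : Fin μ}
    {p : ℕ} (hp : p ≤ n) (b : PowerSeries (S.Ok T k)) {ω : S.Ext T k}
    (hω : ω ∈ ⋀[S.Rku T k]^p (Fin n → S.Rku T k)) :
    (S.smallForms T k).mkQ (projForms hS hσ T k j (homotopy hS hσ T k (S.twist T k F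
      (projForms hS hσ T k i (S.form T k b ω))))) =
    ∑ s, ∑ r ∈ σ j, reduction k b (hop hS hσ T j r (n - p) * (mulZ s * proj hS hσ T i))
      (ExteriorAlgebra.contract (dualE S T k (σ j) r)
        (ExteriorAlgebra.ι _ (rayE S T k s) * ω)) := by
  have hc : ∀ i' r, proj hS hσ T j * hop hS hσ T i' r (n - p) =
      if j = i' then hop hS hσ T i' r (n - p) else 0 := by
    intro i' r
    ext1 f
    have := proj_hop hS hσ (T := T) j i' r (n - p) f
    rw [Module.End.mul_apply, this]
    split_ifs <;> rfl
  rw [projForms_form, mkQ_apply_eq, mkQ_apply_eq, mk_twist_form k hS hF, map_sum, map_sum]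
  refine Finset.sum_congr rfl fun s _ => ?_
  rw [reduction_apply, ← mkQ_apply_eq, homotopy_form hS hσ T k (by omega) _
    (ExteriorAlgebra.ι_mul_mem _ hω), Nat.add_sub_add_right]
  simp only [← Module.End.mul_apply (S.extU T k _), ← map_mul, map_sum, ← reduction_apply,
    redOp_projForms_reduction]
  simp only [← mul_assoc, hc]
  rw [Finset.sum_eq_single_of_mem j (Finset.mem_univ j)]
  · simp only [if_pos]
  · intro i' _ hi'
    refine Finset.sum_eq_zero fun r _ => ?_
    rw [if_neg (Ne.symm hi'), zero_mul, zero_mul, map_zero]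
    rfl

lemma mkQ_phiProj {i j : Fin μ} {p : ℕ} (b : PowerSeries (S.Ok T k)) {ω : S.Ext T k}
    (hω : ω ∈ ⋀[S.Rku T k]^p (Fin n → S.Rku T k)) :
    (S.smallForms T k).mkQ (projForms hS hσ T k j (phiProj hS hσ T k
      (projForms hS hσ T k i (S.form T k b ω)))) =
    if j = i ∧ n = p then reduction k b (projPhi hS T hσ i) ω else 0 := by
  have hc : ∀ i', proj hS hσ T j * (projPhi hS T hσ i' * proj hS hσ T i) =
      if i' = i then if j = i then projPhi hS T hσ i else 0 else 0 := by
    intro i'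
    ext1 f
    have h1 := projPhi_proj hS hσ (T := T) i' i f
    have h2 := proj_projPhi hS hσ (T := T) i' j f
    rw [Module.End.mul_apply, Module.End.mul_apply, h1]
    by_cases h : i' = i
    · subst h
      rw [if_pos rfl, if_pos rfl, h2]
      split_ifs <;> rfl
    · rw [if_neg (Ne.symm h), if_neg h, map_zero]
      rfl
  rw [projForms_form, phiProj_form hS hσ T k _ hω]
  split_ifs with h1 h2 h2
  · obtain ⟨rfl, -⟩ := h2
    rw [map_sum, map_sum]
    simp only [projForms_form, ← Module.End.mul_apply (S.extU T k _), ← map_mul,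
      ← reduction_apply, hc, if_pos]
    rw [Finset.sum_eq_single_of_mem j (Finset.mem_univ j), if_pos rfl]
    intro i' _ hi'
    rw [if_neg hi', map_zero]
    rfl
  · rw [map_sum, map_sum]
    refine Finset.sum_eq_zero fun i' _ => ?_
    have hji : ¬ j = i := fun h => h2 ⟨h, h1⟩
    rw [projForms_form, ← Module.End.mul_apply, ← map_mul, ← Module.End.mul_apply, ← map_mul,
      ← reduction_apply, mul_assoc, hc, if_neg hji, ite_self, map_zero]
    rfl
  · exact (h1 h2.2).elim
  · simp only [map_zero]

lemma mkQ_projForms {i j : Fin μ} (b : PowerSeries (S.Ok T k)) (ω : S.Ext T k) :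
    (S.smallForms T k).mkQ (projForms hS hσ T k j (projForms hS hσ T k i (S.form T k b ω))) =
      if j = i then reduction k b (proj hS hσ T i) ω else 0 := by
  have hc : proj hS hσ T j * proj hS hσ T i = if j = i then proj hS hσ T i else 0 := by
    ext1 f
    have h1 := proj_proj hS hσ (T := T) j i f
    rw [Module.End.mul_apply, h1]
    by_cases h : j = i
    · subst h; simp
    · simp [h]
  simp only [projForms_form, ← Module.End.mul_apply (S.extU T k _), ← map_mul,
      ← reduction_apply, hc]
  split_ifs
  · rfl
  · rw [map_zero]; rfl

section Reduction

variable (b : PowerSeries (S.Ok T k))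

lemma reduction_proj_mulZ_hop {i j : Fin μ} {s : ι} (h : j < i ∨ (j = i ∧ s ∉ σ i)) (r : ι)
    (e : ℕ) : reduction k b (proj hS hσ T j * (mulZ s * hop hS hσ T i r e)) = 0 :=
  reduction_eq_zero k hS (fun f m => co_proj_z_mul_hop hS hσ h r e f m) b

lemma reduction_hop_mulZ_proj {i j : Fin μ} {s : ι} (h : j < i ∨ (j = i ∧ s ∉ σ i)) (r : ι)
    (e : ℕ) : reduction k b (hop hS hσ T j r e * (mulZ s * proj hS hσ T i)) = 0 :=
  reduction_eq_zero k hS (fun f m => co_hop_z_mul_proj hS hσ h r e f m) b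

lemma reduction_hop_mulZ_proj_of_mem {i : Fin μ} {r s : ι} (hr : r ∈ σ i) (hs : s ∈ σ i) (e : ℕ) :
    reduction k b (hop hS hσ T i r e * (mulZ s * proj hS hσ T i)) =
      reduction k b (proj hS hσ T i * (mulZ s * hop hS hσ T i r (e + 1))) +
        if r = s then reduction k b (eulerInv hS hσ T i e) else 0 := by
  split_ifs with h
  · subst h
    rw [← map_add]
    exact reduction_congr k hS (fun f m => co_hop_z_mul_proj_self hS hσ hr e f m) b
  · rw [add_zero]
    exact reduction_congr k hS (fun f m => co_hop_z_mul_proj_of_ne hS hσ hr hs h e f m) b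

lemma reduction_sum_proj_mulZ_hop (i : Fin μ) (e : ℕ) :
    ∑ r ∈ σ i, reduction k b (proj hS hσ T i * (mulZ r * hop hS hσ T i r (e + 1))) +
      e • reduction k b (eulerInv hS hσ T i e) =
      reduction k b (proj hS hσ T i) - if e = 0 then reduction k b (projPhi hS T hσ i) else 0 := by
  have h : reduction k b (∑ r ∈ σ i, proj hS hσ T i * (mulZ r * hop hS hσ T i r (e + 1)) +
      e • eulerInv hS hσ T i e) +
      reduction k b (if e = 0 then projPhi hS T hσ i else 0) = reduction k b (proj hS hσ T i) := by
    rw [← map_add]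
    refine reduction_congr k hS (fun f m => ?_) b
    have h1 := co_sum_proj_z_mul_hop hS hσ (T := T) i e f m
    rw [Nat.cast_smul_eq_nsmul, co_sub, eq_sub_iff_add_eq] at h1
    rw [← h1, ← co_add]
    congr 1
    rw [LinearMap.add_apply, LinearMap.add_apply, LinearMap.sum_apply]
    split_ifs <;> rfl
  rw [map_add, map_sum, map_nsmul] at h
  rw [eq_sub_iff_add_eq, ← h]
  congr 1
  split_ifs
  · rfl
  · rw [map_zero]

end Reduction

/-- Here `a` stands for multiplying after differentiating, `c` for the opposite order, and `eu` for
their commutator. Since `ξ_r` contracted with `ρ_t ∧ ω` is `δ_{rt} ω - ρ_t ∧ (ξ_r ⌟ ω)`, the terms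
with `r ≠ t` cancel. The diagonal leaves `a r r` and one copy of `eu` per ray, and Euler's identity
on `⋀ M` removes `p` copies. -/
lemma koszul_identity {A M G J : Type*} [CommRing A] [AddCommGroup M] [Module A M]
    [AddCommGroup G] [DecidableEq J] (s : Finset J) (ρ : J → M) (ξ : J → Module.Dual A M)
    (hρ : ∀ r ∈ s, ∀ t ∈ s, ξ r (ρ t) = if r = t then 1 else 0)
    (hξ : ∀ v, ∑ r ∈ s, ξ r v • ρ r = v) (a c : J → J → ExteriorAlgebra A M →+ G)
    (eu : ExteriorAlgebra A M →+ G)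
    (hac : ∀ r ∈ s, ∀ t ∈ s, c r t = a r t + if r = t then eu else 0) {p : ℕ}
    {ω : ExteriorAlgebra A M} (hω : ω ∈ ⋀[A]^p M) :
    ∑ t ∈ s, ∑ r ∈ s, a r t (ExteriorAlgebra.ι A (ρ t) * ExteriorAlgebra.contract (ξ r) ω) +
      ∑ t ∈ s, ∑ r ∈ s, c r t (ExteriorAlgebra.contract (ξ r) (ExteriorAlgebra.ι A (ρ t) * ω)) =
      (∑ r ∈ s, a r r ω) + s.card • eu ω - p • eu ω := by
  have h : ∀ t ∈ s, ∀ r ∈ s,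
      a r t (ExteriorAlgebra.ι A (ρ t) * ExteriorAlgebra.contract (ξ r) ω) +
      c r t (ExteriorAlgebra.contract (ξ r) (ExteriorAlgebra.ι A (ρ t) * ω)) =
      if r = t then a t t ω + eu ω -
        eu (ExteriorAlgebra.ι A (ρ t) * ExteriorAlgebra.contract (ξ t) ω) else 0 := by
    intro t ht r hr
    rw [ExteriorAlgebra.contract_ι_mul, hρ r hr t ht, hac r hr t ht]
    split_ifs with hrt
    · subst hrt
      rw [one_smul, map_sub]
      simp only [AddMonoidHom.add_apply]
      abel
    · rw [zero_smul, zero_sub, map_neg, add_zero, add_neg_cancel]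
  rw [← Finset.sum_add_distrib]
  simp only [← Finset.sum_add_distrib]
  rw [Finset.sum_congr rfl fun t ht => (Finset.sum_congr rfl fun r hr => h t ht r hr).trans
    (Finset.sum_eq_single_of_mem t ht fun r _ hrt => if_neg hrt)]
  simp only [if_pos]
  rw [Finset.sum_sub_distrib, Finset.sum_add_distrib, Finset.sum_const, ← map_sum,
    ExteriorAlgebra.sum_ι_mul_contract s ρ ξ hξ hω, Nat.cast_smul_eq_nsmul, map_nsmul]

/-- Below the diagonal all terms vanish, since multiplication does not lower blocks. On the diagonal
only the rays of `σ j` contribute, and the identity is Euler's formula for polynomial forms in `n`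
variables. -/
lemma strict_triangular_form {i j : Fin μ}
    (hij : j ≤ i) {p : ℕ} (hp : p ≤ n) (b : PowerSeries (S.Ok T k)) {ω : S.Ext T k}
    (hω : ω ∈ ⋀[S.Rku T k]^p (Fin n → S.Rku T k)) :
    (∑ s, ∑ r ∈ σ i, reduction k b (proj hS hσ T j * (mulZ s * hop hS hσ T i r (n - p + 1)))
      (ExteriorAlgebra.ι _ (rayE S T k s) *
        ExteriorAlgebra.contract (dualE S T k (σ i) r) ω)) +
    (∑ s, ∑ r ∈ σ j, reduction k b (hop hS hσ T j r (n - p) * (mulZ s * proj hS hσ T i))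
      (ExteriorAlgebra.contract (dualE S T k (σ j) r)
        (ExteriorAlgebra.ι _ (rayE S T k s) * ω))) +
    (if j = i ∧ n = p then reduction k b (projPhi hS T hσ i) ω else 0) -
    (if j = i then reduction k b (proj hS hσ T i) ω else 0) = 0 := by
  rcases hij.lt_or_eq with hlt | rfl
  · simp only [reduction_hop_mulZ_proj hS hσ b (Or.inl hlt),
      reduction_proj_mulZ_hop hS hσ b (Or.inl hlt), AddMonoidHom.zero_apply, Finset.sum_const_zero,
      hlt.ne, false_and, if_false, add_zero, sub_zero]
  · have e1 : ∀ s, s ∉ σ j → ∑ r ∈ σ j, reduction k b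
        (proj hS hσ T j * (mulZ s * hop hS hσ T j r (n - p + 1)))
        (ExteriorAlgebra.ι _ (rayE S T k s) *
          ExteriorAlgebra.contract (dualE S T k (σ j) r) ω) = 0 := fun s hs =>
      Finset.sum_eq_zero fun r _ => by
        rw [reduction_proj_mulZ_hop hS hσ b (Or.inr ⟨rfl, hs⟩), AddMonoidHom.zero_apply]
    have e2 : ∀ s, s ∉ σ j → ∑ r ∈ σ j, reduction k b
        (hop hS hσ T j r (n - p) * (mulZ s * proj hS hσ T j))
        (ExteriorAlgebra.contract (dualE S T k (σ j) r)
          (ExteriorAlgebra.ι _ (rayE S T k s) * ω)) = 0 := fun s hs =>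
      Finset.sum_eq_zero fun r _ => by
        rw [reduction_hop_mulZ_proj hS hσ b (Or.inr ⟨rfl, hs⟩), AddMonoidHom.zero_apply]
    rw [← Finset.sum_subset (Finset.subset_univ (σ j)) fun s _ hs => e1 s hs,
      ← Finset.sum_subset (Finset.subset_univ (σ j)) fun s _ hs => e2 s hs,
      koszul_identity (σ j) (rayE S T k) (dualE S T k (σ j))
        (fun r hr t ht => dualE_rayE k (hσ.mem_cones j) (hσ.card_eq j) hr ht)
        (sum_dualE k (hσ.mem_cones j) (hσ.card_eq j))
        (fun r s => reduction k b (proj hS hσ T j * (mulZ s * hop hS hσ T j r (n - p + 1))))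
        (fun r s => reduction k b (hop hS hσ T j r (n - p) * (mulZ s * proj hS hσ T j)))
        (reduction k b (eulerInv hS hσ T j (n - p)))
        (fun r hr t ht => reduction_hop_mulZ_proj_of_mem hS hσ b hr ht _) hω, hσ.card_eq j]
    have e3 := congrArg (fun g => g ω) (reduction_sum_proj_mulZ_hop hS hσ b j (n - p))
    -- Of the `n` copies of `eulerInv`, the form degree takes away `p`. The remaining `n - p` are
    -- what completes `tot` to the Euler weight.
    have e4 : n • reduction k b (eulerInv hS hσ T j (n - p)) ω =
        p • reduction k b (eulerInv hS hσ T j (n - p)) ω +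
          (n - p) • reduction k b (eulerInv hS hσ T j (n - p)) ω := by
      rw [← add_smul, Nat.add_sub_cancel' hp]
    simp only [AddMonoidHom.add_apply, AddMonoidHom.finsetSum_apply, AddMonoidHom.sub_apply,
      AddMonoidHom.nsmul_apply] at e3
    rw [e4, add_comm (p • _), ← add_assoc, add_sub_cancel_right, e3]
    by_cases hnp : n = p
    · have h0 : n - p = 0 := by omega
      simp [hnp]
    · have h0 : n - p ≠ 0 := by omega
      simp [h0, hnp]

lemma strict_triangular {F : S.holo T} (hF : IsUnfolding F) {i j : Fin μ}
    (hij : j ≤ i) (y : S.Forms T k) :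
    projForms hS hσ T k j ((S.twist T k F * homotopy hS hσ T k + homotopy hS hσ T k * S.twist T k F +
      phiProj hS hσ T k - 1) (projForms hS hσ T k i y)) ∈ S.smallForms T k := by
  induction y using S.forms_induction_degree with
  | h0 => simp only [map_zero, zero_mem]
  | hadd x y hx hy =>
    rw [map_add, map_add, map_add]
    exact add_mem hx hy
  | hform b p hp ω hω =>
    rw [← Submodule.Quotient.mk_eq_zero, ← Submodule.mkQ_apply]
    simp only [LinearMap.sub_apply, LinearMap.add_apply, Module.End.mul_apply,
      Module.End.one_apply, map_sub, map_add]
    rw [mkQ_twist_homotopy hS hσ hF hp b hω, mkQ_homotopy_twist hS hσ hF hp b hω,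
      mkQ_phiProj hS hσ b hω, mkQ_projForms]
    exact strict_triangular_form hS hσ hij hp b hω

end Contraction

end SmoothCompleteFan

end LogLG

end

open scoped TensorProduct

noncomputable section

namespace LogLG

namespace SmoothCompleteFan

variable {n : ℕ} {ι : Type} [Fintype ι] [DecidableEq ι] (S : SmoothCompleteFan n ι)

/-! ### Forms of top degree -/

section Volume

variable (T : Type) (k : ℕ)

/-- The volume form `Ω`. -/
abbrev vol : S.Ext T k := S.dlogs T k (id : Fin n → Fin n)

lemma dlogs_mem {p : ℕ} (s : Fin p → Fin n) :
    S.dlogs T k s ∈ ⋀[S.Rku T k]^p (Fin n → S.Rku T k) :=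
  ExteriorAlgebra.ιMulti_range (S.Rku T k) p ⟨_, rfl⟩

lemma extBasis_univ : S.extBasis T k Finset.univ = S.vol T k := by
  have h := ExteriorAlgebra.basis_apply_ofCard (n := n) (Pi.basisFun (S.Rku T k) (Fin n))
    (s := Finset.univ) (by simp)
  rw [extBasis, h, ExteriorAlgebra.ιMulti_family]
  refine congrArg (ExteriorAlgebra.ιMulti (S.Rku T k) n) (funext fun a => ?_)
  rw [Function.comp_apply, Pi.basisFun_apply]
  congr 1
  have h2 := (OrderEmbedding.strictMono (Set.powersetCard.ofFinEmbEquiv.symm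
    (Set.powersetCard.ofCard (s := (Finset.univ : Finset (Fin n))) (n := n) (by simp)))).range_inj
    (strictMono_id (α := Fin n))
  refine congrFun (h2.1 ?_) a
  rw [Set.range_id]
  exact (Finite.surjective_of_injective (RelEmbedding.injective _)).range_eq

lemma eq_smul_vol {ω : S.Ext T k} (hω : ω ∈ ⋀[S.Rku T k]^n (Fin n → S.Rku T k)) :
    ω = (S.extBasis T k).coord Finset.univ ω • S.vol T k := by
  have h := ExteriorAlgebra.degreeProj_of_mem hω n
  rw [if_pos rfl, ← (S.extBasis T k).sum_repr ω, map_sum,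
    Finset.sum_eq_single_of_mem Finset.univ (Finset.mem_univ _)] at h
  · rw [map_smul, ExteriorAlgebra.degreeProj_of_mem (S.extBasis_mem T k _), if_pos (by simp),
      (S.extBasis T k).sum_repr, extBasis_univ] at h
    exact h.symm
  · intro s _ hs
    rw [map_smul, ExteriorAlgebra.degreeProj_of_mem (S.extBasis_mem T k s), if_neg, smul_zero]
    intro hn
    exact hs (Finset.eq_univ_of_card s (by simpa using hn.symm))

lemma eq_zero_of_mem_succ {ω : S.Ext T k}
    (hω : ω ∈ ⋀[S.Rku T k]^(n + 1) (Fin n → S.Rku T k)) : ω = 0 := by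
  have h := ExteriorAlgebra.degreeProj_of_mem hω (n + 1)
  rw [if_pos rfl, ← (S.extBasis T k).sum_repr ω, map_sum, Finset.sum_eq_zero] at h
  · rw [← (S.extBasis T k).sum_repr ω, ← h]
  · intro s _
    rw [map_smul, ExteriorAlgebra.degreeProj_of_mem (S.extBasis_mem T k s), if_neg, smul_zero]
    have := Finset.card_le_univ s
    rw [Fintype.card_fin] at this
    omega

lemma twist_form_top (F : S.holo T) (b : PowerSeries (S.Ok T k)) {ω : S.Ext T k}
    (hω : ω ∈ ⋀[S.Rku T k]^n (Fin n → S.Rku T k)) : S.twist T k F (S.form T k b ω) = 0 := by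
  rw [twist_form]
  refine Finset.sum_eq_zero fun j _ => ?_
  rw [S.eq_zero_of_mem_succ T k (ExteriorAlgebra.ι_mul_mem _ hω), ← formHom_apply, map_zero]

/-- The coefficient of the volume form. -/
def top : S.Forms T k →ₗ[S.Rku T k] PowerSeries (S.Ok T k) :=
  TensorProduct.lift (LinearMap.mk₂ (S.Rku T k)
    (fun (b : PowerSeries (S.Ok T k)) (ω : S.Ext T k) =>
      (S.extBasis T k).coord Finset.univ ω • b)
    (fun b c ω => smul_add _ _ _) (fun r b ω => smul_comm _ _ _)
    (fun b ω η => by rw [map_add, add_smul]) (fun r b ω => by rw [map_smul, smul_assoc]))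

lemma top_form (b : PowerSeries (S.Ok T k)) (ω : S.Ext T k) :
    S.top T k (S.form T k b ω) = (S.extBasis T k).coord Finset.univ ω • b :=
  TensorProduct.lift.tmul _ _

lemma top_form_vol (b : PowerSeries (S.Ok T k)) : S.top T k (S.form T k b (S.vol T k)) = b := by
  rw [top_form, ← extBasis_univ, Module.Basis.coord_apply, Module.Basis.repr_self,
    Finsupp.single_eq_same, one_smul]

end Volume

/-! ### The twisted complex contracts to the multiples of the volume form by the `φ_i` -/

section Contraction

variable {S} {μ : ℕ} {σ : Fin μ → Finset ι} (hS : S.IsProjective) (hσ : S.IsGoodOrder σ)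
  {T : Type} [Fintype T] {k : ℕ}

lemma opF_zero {T : Type} (β : Module.End (S.Rku T k) (S.Ext T k)) : S.opF T k 0 β = 0 := by
  rw [opF, map_zero, TensorProduct.map_zero_left]
  rfl

lemma homotopy_phiProj (y : S.Forms T k) : homotopy hS hσ T k (phiProj hS hσ T k y) = 0 := by
  rw [phiProj, homotopy]
  simp only [LinearMap.sum_apply, map_sum, opF_opF]
  refine Finset.sum_eq_zero fun i _ => Finset.sum_eq_zero fun p _ => Finset.sum_eq_zero fun j _ =>
    Finset.sum_eq_zero fun r _ => ?_
  have h : hop hS hσ T j r (n + 1 - p) * projPhi hS T hσ i = 0 :=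
    LinearMap.ext fun f => hop_projPhi hS hσ j i r _ f
  rw [h, opF_zero, LinearMap.zero_apply]

lemma phiProj_eq_form_vol (y : S.Forms T k) : ∃ b : PowerSeries (S.Ok T k),
    phiProj hS hσ T k y = ∑ i, S.form T k (S.extU T k (projPhi hS T hσ i) b) (S.vol T k) := by
  induction y using S.forms_induction_degree with
  | h0 =>
    refine ⟨0, ?_⟩
    simp only [map_zero, ← formHom_apply, LinearMap.zero_apply, Finset.sum_const_zero]
  | hadd x y hx hy =>
    obtain ⟨b, hb⟩ := hx
    obtain ⟨c, hc⟩ := hy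
    refine ⟨b + c, ?_⟩
    rw [map_add, hb, hc, ← Finset.sum_add_distrib]
    simp only [← formHom_apply, map_add, LinearMap.add_apply]
  | hform b p hp ω hω =>
    rw [phiProj_form hS hσ T k b hω]
    split_ifs with h
    · subst h
      refine ⟨(S.extBasis T k).coord Finset.univ ω • b, Finset.sum_congr rfl fun i _ => ?_⟩
      conv_lhs => rw [S.eq_smul_vol T k hω]
      simp only [← formHom_apply, map_smul, LinearMap.smul_apply]
    · refine ⟨0, ?_⟩
      simp only [map_zero, ← formHom_apply, LinearMap.zero_apply, Finset.sum_const_zero]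

lemma phiProj_form_vol (b : PowerSeries (S.Ok T k)) : phiProj hS hσ T k (S.form T k b (S.vol T k)) =
    ∑ i, S.form T k (S.extU T k (projPhi hS T hσ i) b) (S.vol T k) := by
  rw [phiProj_form hS hσ T k b (S.dlogs_mem T k _), if_pos rfl]

lemma extU_projPhi_extU_projPhi (i j : Fin μ) (b : PowerSeries (S.Ok T k)) :
    S.extU T k (projPhi hS T hσ i) (S.extU T k (projPhi hS T hσ j) b) =
      if j = i then S.extU T k (projPhi hS T hσ i) b else 0 := by
  rw [← Module.End.mul_apply, ← map_mul]
  have h : projPhi hS T hσ i * projPhi hS T hσ j = if j = i then projPhi hS T hσ i else 0 := by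
    ext1 f
    rw [Module.End.mul_apply, projPhi_projPhi hS hσ]
    split_ifs <;> rfl
  rw [h]
  split_ifs
  · rfl
  · rw [map_zero]; rfl

lemma phiProj_phiProj (y : S.Forms T k) :
    phiProj hS hσ T k (phiProj hS hσ T k y) = phiProj hS hσ T k y := by
  obtain ⟨b, hb⟩ := phiProj_eq_form_vol hS hσ y
  rw [hb, map_sum]
  simp only [phiProj_form_vol, extU_projPhi_extU_projPhi]
  rw [Finset.sum_comm]
  refine Finset.sum_congr rfl fun i _ => ?_
  rw [Finset.sum_eq_single_of_mem i (Finset.mem_univ i), if_pos rfl]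
  intro j _ hj
  rw [if_neg hj, ← formHom_apply, map_zero, LinearMap.zero_apply]

lemma twist_phiProj (F : S.holo T) (y : S.Forms T k) :
    S.twist T k F (phiProj hS hσ T k y) = 0 := by
  obtain ⟨b, hb⟩ := phiProj_eq_form_vol hS hσ y
  rw [hb, map_sum]
  exact Finset.sum_eq_zero fun i _ => S.twist_form_top T k F _ (S.dlogs_mem T k _)

/-- Strict triangularity over `μ` blocks puts the `μ`-th power of the error into the multiples of
`(𝓘, u)`. Its power `μ (k + 1)` then lies in those of `(𝓘, u) ^ (k + 1) ⊆ (u)`. -/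
lemma isPerturbedContraction {F : S.holo T} (hF : IsUnfolding F) :
    IsPerturbedContraction (PowerSeries.X : S.Rku T k) (S.twist T k F) (homotopy hS hσ T k)
      (phiProj hS hσ T k) where
  complete := S.forms_isXComplete T k
  d_d := S.twist_twist T k F
  d_Q := twist_phiProj hS hσ F
  h_Q := homotopy_phiProj hS hσ
  Q_Q := phiProj_phiProj hS hσ
  nilpotent := by
    refine ⟨μ * (k + 1), fun y => ?_⟩
    have h1 := exists_pow_apply_mem (sum_projForms hS hσ T k)
      (fun i j hij y => strict_triangular hS hσ hF hij y) (k + 1) y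
    have h2 := Submodule.smul_mono (S.baseIdeal_pow_le T k) le_rfl h1
    rw [Submodule.ideal_span_singleton_smul, Submodule.mem_smul_pointwise_iff_exists] at h2
    obtain ⟨z, -, hz⟩ := h2
    exact ⟨z, hz.symm⟩

end Contraction

/-! ### The superpotential along the central fibre -/

section Unfolding

variable {S} {μ : ℕ} {σ : Fin μ → Finset ι}

lemma phi_eq_theta (hσ : S.IsGoodOrder σ) (i : Fin μ) :
    S.phi σ i = S.theta (S.raysSum (tau σ n i)) := by
  refine Subtype.ext (funext fun x => ?_)
  have h1 : ((S.phi σ i).1 : S.Pt (Param σ n) → ℂ) x =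
      x.1 (Multiplicative.ofAdd (∑ r ∈ tau σ n i, (⟨Pi.single r 1, S.single_mem_Pphi r⟩ : S.Pphi))) := by
    rw [ofAdd_sum, map_prod, phi]
    rw [SubmonoidClass.coe_finsetProd, Finset.prod_apply]
    refine Finset.prod_congr rfl fun r _ => ?_
    change S.mon _ _ x = _
    simp [mon]
  have h2 : ((S.theta (T := Param σ n) (S.raysSum (tau σ n i))).1) x = 
      x.1 (Multiplicative.ofAdd (S.key (S.raysSum (tau σ n i)) (0 : S.BaseExp (Param σ n))).1) := by
    change S.mon _ _ x = _
    rw [mon, key_snd]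
    simp
  rw [h1, h2]
  congr 2
  apply Subtype.ext
  rw [key_fst, S.tphi_raysSum (tau_mem_cones hσ i)]
  ext r
  simp [Finset.sum_apply, Pi.single_apply]

lemma relDer_monH {T : Type} [Fintype T] (j : Fin n) (q : S.Pphi × (T →₀ ℕ)) :
    S.relDer T j (S.monH T q) = S.raySum q.1.1 j • S.monH T q := by
  classical
  refine coeff_ext fun q' => ?_
  rw [coeff_relDer, ← Int.cast_smul_eq_zsmul ℂ, coeff_smul, coeff_monH]
  by_cases h : q' = q
  · subst h; simp
  · simp [h]

lemma relDer_z {T : Type} [Fintype T] (j : Fin n) (s : ι) :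
    S.relDer T j (S.z T s) = S.ray s j • S.z T s := by
  rw [z, relDer_monH]
  simp [raySum_single]

lemma monH_single {T : Type} (i : T) (f : S.holo T) :
    S.monH T (0, Finsupp.single i 1) * f = S.rmon (0, Finsupp.single i 1) 1 • f := by
  rw [rmon_smul, one_smul]
  rfl

/-- The relative derivations do not see `t_i`, so the derivative of `t_i φ_i` keeps its factor in
`𝓘`. -/
lemma isUnfolding_superF (hS : S.IsProjective) : IsUnfolding (S.superF σ) := by
  intro j f m
  have h : S.relDer (Param σ n) j (S.superF σ) * f = ∑ s, S.ray s j • (S.z (Param σ n) s * f) +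
      ∑ i : Param σ n, S.rmon (0, Finsupp.single i 1) 1 •
        (S.relDer (Param σ n) j (S.phi σ i) * f) := by
    rw [superF, map_add, map_sum, map_sum, add_mul, Finset.sum_mul, Finset.sum_mul]
    congr 1
    · exact Finset.sum_congr rfl fun s _ => by rw [relDer_z, smul_mul_assoc]
    · exact Finset.sum_congr rfl fun i _ => by
        rw [monH_single, map_smul, smul_mul_assoc]
  rw [h, co_add, add_eq_left]
  refine (S.mem_smul_top_iff hS _).1 (sum_mem fun i _ => ?_) m
  refine Submodule.smul_mem_smul (S.rmon_mem_maxIdeal (fun h' => ?_) 1) Submodule.mem_top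
  have := congrArg (fun w => w.2 i) h'
  simp at this

end Unfolding

end SmoothCompleteFan

end LogLG

end

open scoped TensorProduct

noncomputable section

namespace LogLG

namespace SmoothCompleteFan

variable {n : ℕ} {ι : Type} [Fintype ι] [DecidableEq ι] {S : SmoothCompleteFan n ι}

/-! ### The classes of the `φ_i Ω` form a basis -/

section Basis

variable {μ : ℕ} {σ : Fin μ → Finset ι} (hS : S.IsProjective) (hσ : S.IsGoodOrder σ) (k : ℕ)

lemma phiForm_mem_ker (i : Fin μ) :
    S.phiForm σ k i ∈ LinearMap.ker (S.twist (Param σ n) k (S.superF σ)) :=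
  S.twist_form_top _ k _ _ (S.dlogs_mem _ k _)

lemma projPhi_phi (i j : Fin μ) :
    projPhi hS (Param σ n) hσ i (S.phi σ j) = if j = i then S.phi σ j else 0 := by
  classical
  refine co_ext fun m w => ?_
  rw [co_projPhi, phi_eq_theta hσ]
  split_ifs with h1 h2 h2
  · rfl
  · rw [co_theta, co_zero, if_neg]
    rintro ⟨h3, -⟩
    have h4 := congrArg (S.idx hσ) (h1.symm.trans h3)
    rw [idx_raysSum_tau, idx_raysSum_tau] at h4
    exact h2 h4.symm
  · subst h2
    rw [co_theta, if_neg fun h => h1 h.1]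
  · rw [co_zero]

lemma extU_projPhi_toU (i j : Fin μ) :
    S.extU (Param σ n) k (projPhi hS (Param σ n) hσ i) (S.toU (Param σ n) k (S.phi σ j)) =
      if j = i then S.toU (Param σ n) k (S.phi σ j) else 0 := by
  ext e
  rw [S.coeff_extU (f := if e = 0 then S.phi σ j else 0)]
  · split_ifs with h1 h2 h2
    · rw [projPhi_phi, if_pos h2, toU, PowerSeries.coeff_C, if_pos h1]
    · rw [projPhi_phi, if_neg h2, map_zero, map_zero]
    · rw [map_zero, map_zero, toU, PowerSeries.coeff_C, if_neg h1]
    · simp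
  · rw [toU, PowerSeries.coeff_C]
    split_ifs <;> simp

/-- Each coefficient in `u` is an entire series of multiples of `φ_i`. Modulo `𝓘 ^ (k + 1)` it
agrees with a polynomial multiple. -/
lemma exists_extU_projPhi_eq (i : Fin μ) (b : PowerSeries (S.Ok (Param σ n) k)) :
    ∃ r : S.Rku (Param σ n) k, S.extU (Param σ n) k (projPhi hS (Param σ n) hσ i) b =
      r • S.toU (Param σ n) k (S.phi σ i) := by
  obtain ⟨f, hf⟩ := S.exists_lift_coeff (Param σ n) k b
  choose r hr using fun e => S.exists_sub_smul_theta_mem hS (S.raysSum (tau σ n i)) (k + 1)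
    (projPhi hS (Param σ n) hσ i (f e)) fun m hm w => by rw [co_projPhi, if_neg hm]
  refine ⟨PowerSeries.mk fun e => S.toRk _ k (r e), ?_⟩
  ext e
  rw [S.coeff_extU _ (hf e), toU, Algebra.smul_def, PowerSeries.algebraMap_apply'',
    PowerSeries.coeff_mul_C, PowerSeries.coeff_map, PowerSeries.coeff_mk, ← Algebra.smul_def,
    toRk_smul_toOk, ← sub_eq_zero, ← map_sub, toOk_eq_zero_iff, phi_eq_theta hσ]
  exact hr e

lemma eq_zero_of_smul_toU (hσ : S.IsGoodOrder σ) (i : Fin μ) {r : S.Rku (Param σ n) k}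
    (h : r • S.toU (Param σ n) k (S.phi σ i) = 0) : r = 0 := by
  ext e
  obtain ⟨a, ha⟩ := S.toRk_surjective _ k (PowerSeries.coeff e r)
  have h1 := congrArg (PowerSeries.coeff e) h
  rw [toU, Algebra.smul_def, PowerSeries.algebraMap_apply'',
    PowerSeries.coeff_mul_C, PowerSeries.coeff_map, ← Algebra.smul_def, ← ha,
    toRk_smul_toOk, map_zero, toOk_eq_zero_iff, phi_eq_theta hσ] at h1
  rw [← ha, map_zero, toRk_eq_zero_iff]
  exact S.mem_pow_of_smul_theta h1

lemma smul_phiForm (r : S.Rku (Param σ n) k) (i : Fin μ) : r • S.phiForm σ k i =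
    S.form (Param σ n) k (r • S.toU (Param σ n) k (S.phi σ i)) (S.vol (Param σ n) k) := by
  rw [← formHom_apply, map_smul]
  rfl

lemma phiProj_sum_smul_phiForm (r : Fin μ → S.Rku (Param σ n) k) :
    phiProj hS hσ (Param σ n) k (∑ i, r i • S.phiForm σ k i) = ∑ i, r i • S.phiForm σ k i := by
  rw [map_sum]
  refine Finset.sum_congr rfl fun i _ => ?_
  rw [smul_phiForm, phiProj_form_vol]
  simp only [map_smul, extU_projPhi_toU]
  rw [Finset.sum_eq_single_of_mem i (Finset.mem_univ i), if_pos rfl]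
  intro j _ hj
  rw [if_neg (Ne.symm hj), smul_zero, ← formHom_apply, map_zero, LinearMap.zero_apply]

lemma sum_smul_phiForm_eq_zero (hS : S.IsProjective) (hσ : S.IsGoodOrder σ) (k : ℕ)
    {r : Fin μ → S.Rku (Param σ n) k}
    (h : ∑ i, r i • S.phiForm σ k i = 0) (i : Fin μ) : r i = 0 := by
  have h1 := congrArg (S.top (Param σ n) k) h
  simp only [map_sum, smul_phiForm, top_form_vol, map_zero] at h1
  have h2 := congrArg (S.extU (Param σ n) k (projPhi hS (Param σ n) hσ i)) h1
  simp only [map_sum, map_smul, extU_projPhi_toU, map_zero] at h2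
  rw [Finset.sum_eq_single_of_mem i (Finset.mem_univ i), if_pos rfl] at h2
  · exact eq_zero_of_smul_toU k hσ i h2
  · intro j _ hj
    rw [if_neg hj, smul_zero]

/-- The combination is fixed by the projection `phiProj`, and exact forms in its image vanish. So
the combination is zero as a form, not only as a class. -/
lemma eq_zero_of_mem_range (hS : S.IsProjective) (hσ : S.IsGoodOrder σ) (k : ℕ)
    {r : Fin μ → S.Rku (Param σ n) k}
    (h : ∑ i, r i • S.phiForm σ k i ∈ LinearMap.range (S.twist (Param σ n) k (S.superF σ)))
    (i : Fin μ) : r i = 0 := by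
  obtain ⟨z, hz⟩ := h
  have h1 := (isPerturbedContraction hS hσ (k := k) (isUnfolding_superF (σ := σ) hS)).eq_zero
    (y := ∑ i, r i • S.phiForm σ k i) (z := z) (by rw [phiProj_sum_smul_phiForm, hz])
  rw [phiProj_sum_smul_phiForm] at h1
  exact sum_smul_phiForm_eq_zero hS hσ k h1 i

lemma exists_sum_smul_phiForm (hS : S.IsProjective) (hσ : S.IsGoodOrder σ) (k : ℕ)
    {y : S.Forms (Param σ n) k}
    (hy : S.twist (Param σ n) k (S.superF σ) y = 0) :
    ∃ (r : Fin μ → S.Rku (Param σ n) k) (z : S.Forms (Param σ n) k),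
      y = ∑ i, r i • S.phiForm σ k i + S.twist (Param σ n) k (S.superF σ) z := by
  obtain ⟨a, z, h⟩ :=
    (isPerturbedContraction hS hσ (k := k) (isUnfolding_superF (σ := σ) hS)).exists_of_closed hy
  obtain ⟨b, hb⟩ := phiProj_eq_form_vol hS hσ a
  choose r hr using fun i => exists_extU_projPhi_eq hS hσ k i b
  refine ⟨r, z, ?_⟩
  rw [h, hb]
  simp only [hr, smul_phiForm]

/-- The class of `φ_i Ω`. -/
def phiClass (i : Fin μ) : S.Hodge σ k :=
  Submodule.Quotient.mk ⟨S.phiForm σ k i, phiForm_mem_ker k i⟩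

lemma sum_smul_phiClass (r : Fin μ → S.Rku (Param σ n) k)
    (h : ∑ i, r i • S.phiForm σ k i ∈ LinearMap.ker (S.twist (Param σ n) k (S.superF σ))) :
    ∑ i, r i • phiClass (S := S) (σ := σ) k i =
      (Submodule.Quotient.mk ⟨∑ i, r i • S.phiForm σ k i, h⟩ : S.Hodge σ k) := by
  have h1 : (⟨∑ i, r i • S.phiForm σ k i, h⟩ :
      LinearMap.ker (S.twist (Param σ n) k (S.superF σ))) =
      ∑ i, r i • ⟨S.phiForm σ k i, phiForm_mem_ker k i⟩ :=
    Subtype.ext (by simp)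
  rw [h1, ← Submodule.mkQ_apply, map_sum]
  rfl

lemma sum_smul_phiForm_mem_ker (r : Fin μ → S.Rku (Param σ n) k) :
    ∑ i, r i • S.phiForm σ k i ∈ LinearMap.ker (S.twist (Param σ n) k (S.superF σ)) :=
  sum_mem fun i _ => Submodule.smul_mem _ _ (phiForm_mem_ker k i)

/-- The basis of the Hodge bundle given by the classes of the `φ_i Ω`. -/
def phiBasis : Module.Basis (Fin μ) (S.Rku (Param σ n) k) (S.Hodge σ k) :=
  Module.Basis.mk (v := phiClass k)
    (Fintype.linearIndependent_iff.2 fun r hr i => by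
      rw [sum_smul_phiClass k r (sum_smul_phiForm_mem_ker k r), Submodule.Quotient.mk_eq_zero] at hr
      exact eq_zero_of_mem_range hS hσ k hr i)
    (fun h _ => by
      obtain ⟨⟨y, hy⟩, rfl⟩ := Submodule.Quotient.mk_surjective _ h
      obtain ⟨r, z, hz⟩ := exists_sum_smul_phiForm hS hσ k hy
      have h1 : (Submodule.Quotient.mk ⟨y, hy⟩ : S.Hodge σ k) = ∑ i, r i • phiClass k i := by
        rw [sum_smul_phiClass k r (sum_smul_phiForm_mem_ker k r), Submodule.Quotient.eq]
        refine ⟨z, ?_⟩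
        change _ = y - ∑ i, r i • S.phiForm σ k i
        rw [hz, add_sub_cancel_left]
      rw [h1]
      exact sum_mem fun i _ => Submodule.smul_mem _ _ (Submodule.subset_span ⟨i, rfl⟩))

lemma phiBasis_apply (i : Fin μ) : phiBasis hS hσ k i = phiClass k i := by
  rw [phiBasis, Module.Basis.mk_apply]

end Basis

end SmoothCompleteFan

end LogLG

end

open scoped TensorProduct

noncomputable section

namespace LogLG

namespace SmoothCompleteFan

variable {n : ℕ} {ι : Type} [Fintype ι] [DecidableEq ι] (S : SmoothCompleteFan n ι)

/-! ### The action of the weight torus -/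

section Scaling

variable {T : Type} (d : T → ℤ)

/-- The action of the element `2` of the torus of weights on `𝒳`. -/
def scalePt (x : S.Pt T) : S.Pt T :=
  ({ toFun := fun v => 2 ^ (2 * ∑ i, (Multiplicative.toAdd v : S.Pphi).1 i) * x.1 v
     map_one' := by simp
     map_mul' := fun v w => by
      simp only [toAdd_mul, AddSubmonoid.coe_add, Pi.add_apply, Finset.sum_add_distrib, mul_add,
        zpow_add₀ (two_ne_zero (α := ℂ)), map_mul]
      ring }, fun i => 2 ^ d i * x.2 i)

lemma prod_zpow (α : T →₀ ℕ) :
    (α.prod fun i e => ((2 : ℂ) ^ d i) ^ e) = 2 ^ (α.sum fun i e => e * d i) := by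
  classical
  rw [Finsupp.prod, Finsupp.sum]
  induction α.support using Finset.induction_on with
  | empty => simp
  | insert i s hi ih =>
    rw [Finset.prod_insert hi, Finset.sum_insert hi, ih, zpow_add₀ two_ne_zero, mul_comm (α i : ℤ),
      zpow_mul, zpow_natCast]

lemma mon_scalePt (q : S.Pphi × (T →₀ ℕ)) (x : S.Pt T) :
    S.mon T q (S.scalePt d x) = 2 ^ weight T d q.1.1 q.2 * S.mon T q x := by
  have h : (q.2.prod fun i e => ((2 : ℂ) ^ d i * x.2 i) ^ e) =
      2 ^ (q.2.sum fun i e => e * d i) * q.2.prod fun i e => x.2 i ^ e := by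
    rw [← prod_zpow, ← Finsupp.prod_mul]
    simp only [mul_pow]
  simp only [mon, scalePt, weight, MonoidHom.coe_mk, OneHom.coe_mk, toAdd_ofAdd, h,
    zpow_add₀ (two_ne_zero (α := ℂ))]
  ring

/-- The pullback of functions along `scalePt`. -/
def scale : S.holo T →ₐ[ℂ] S.holo T where
  toFun f := ⟨fun x => f.1 (S.scalePt d x), by
    obtain ⟨c, hc⟩ := f.2
    refine ⟨fun q => c q * 2 ^ weight T d q.1.1 q.2, fun x => ?_⟩
    simpa [mon_scalePt, mul_assoc] using hc (S.scalePt d x)⟩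
  map_one' := rfl
  map_mul' _ _ := rfl
  map_zero' := rfl
  map_add' _ _ := rfl
  commutes' _ := rfl

variable {S}

lemma coeff_scale [Fintype T] (f : S.holo T) (q : S.Pphi × (T →₀ ℕ)) :
    coeff (S.scale d f) q = coeff f q * 2 ^ weight T d q.1.1 q.2 := by
  refine congrFun (coeff_eq (c := fun q => coeff f q * 2 ^ weight T d q.1.1 q.2) fun x => ?_) q
  change HasSum _ (f.1 (S.scalePt d x))
  simpa [mon_scalePt, mul_assoc] using hasSum_coeff f (S.scalePt d x)

lemma scale_monH (q : S.Pphi × (T →₀ ℕ)) :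
    S.scale d (S.monH T q) = (2 : ℂ) ^ weight T d q.1.1 q.2 • S.monH T q :=
  Subtype.ext (funext fun x => S.mon_scalePt d q x)

lemma scale_relDer [Fintype T] (j : Fin n) (f : S.holo T) :
    S.scale d (S.relDer T j f) = S.relDer T j (S.scale d f) :=
  coeff_ext fun q => by simp only [coeff_scale, coeff_relDer]; ring

lemma scale_of_mem_holoWeight {w : ℤ} {f : S.holo T} (hf : f ∈ S.holoWeight T d w) :
    S.scale d f = (2 : ℂ) ^ w • f := by
  obtain ⟨c, hc, hs⟩ := hf
  refine Subtype.ext (funext fun x => ?_)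
  have h1 := hs (S.scalePt d x)
  have h2 := (hs x).mul_left ((2 : ℂ) ^ w)
  have h3 : (fun q => c q * S.mon T q (S.scalePt d x)) =
      fun q => (2 : ℂ) ^ w * (c q * S.mon T q x) := by
    funext q
    rw [mon_scalePt]
    by_cases h : c q = 0
    · simp [h]
    · rw [hc q h]
      ring
  rw [h3] at h1
  exact h1.unique h2

variable (S)

/-- The weight of an exponent of the base. -/
def baseWeight (w : S.BaseExp T) : ℤ := weight T d w.1.1 w.2

/-- The scaling of `ℂ[P]`. -/
def scaleNE : AddMonoidAlgebra ℂ S.NE →+* AddMonoidAlgebra ℂ S.NE :=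
  (AddMonoidAlgebra.lift ℂ (AddMonoidAlgebra ℂ S.NE) S.NE
    { toFun := fun p => AddMonoidAlgebra.single (Multiplicative.toAdd p)
        ((2 : ℂ) ^ (2 * ∑ i, (Multiplicative.toAdd p).1 i))
      map_one' := by simp [AddMonoidAlgebra.one_def]
      map_mul' := fun p q => by
        simp only [toAdd_mul, AddSubmonoid.coe_add, Pi.add_apply, Finset.sum_add_distrib, mul_add,
          zpow_add₀ (two_ne_zero (α := ℂ)), AddMonoidAlgebra.single_mul_single] }).toRingHom

lemma scaleNE_single (p : S.NE) (a : ℂ) : S.scaleNE (AddMonoidAlgebra.single p a) =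
    AddMonoidAlgebra.single p (2 ^ (2 * ∑ i, p.1 i) * a) := by
  change AddMonoidAlgebra.lift ℂ _ _ _ (AddMonoidAlgebra.single p a) = _
  rw [AddMonoidAlgebra.lift_single]
  simp [mul_comm]

/-- The scaling of the base. -/
def scaleR : S.R T →+* S.R T :=
  MvPolynomial.eval₂Hom (MvPolynomial.C.comp S.scaleNE)
    fun i => MvPolynomial.C (AddMonoidAlgebra.single 0 ((2 : ℂ) ^ d i)) * MvPolynomial.X i

lemma scaleR_rmon (w : S.BaseExp T) (a : ℂ) :
    S.scaleR d (S.rmon w a) = S.rmon w (2 ^ S.baseWeight d w * a) := by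
  have h : (w.2.prod fun i e => (MvPolynomial.C (AddMonoidAlgebra.single (0 : S.NE) ((2 : ℂ) ^ d i)) *
      MvPolynomial.X i : S.R T) ^ e) = S.rmon (0, w.2) (2 ^ (w.2.sum fun i e => e * d i)) := by
    have h1 : (w.2.prod fun i e => (AddMonoidAlgebra.single (0 : S.NE) ((2 : ℂ) ^ d i)) ^ e) =
        AddMonoidAlgebra.single (0 : S.NE) (2 ^ (w.2.sum fun i e => e * d i)) := by
      rw [← prod_zpow]
      refine Eq.trans (Finsupp.prod_congr fun i _ => ?_) (map_finsuppProd
        (AddMonoidAlgebra.singleZeroRingHom (R := ℂ) (M := S.NE)) w.2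
        (fun i e => ((2 : ℂ) ^ d i) ^ e)).symm
      rw [map_pow]
      rfl
    rw [rmon, MvPolynomial.monomial_eq, ← h1]
    simp only [mul_pow]
    rw [Finsupp.prod_mul, map_finsuppProd]
    simp only [map_pow]
  have h2 : S.scaleR d (S.rmon w a) = S.rmon (w.1, 0) (2 ^ (2 * ∑ i, w.1.1 i) * a) *
      S.rmon (0, w.2) (2 ^ (w.2.sum fun i e => e * d i)) := by
    rw [← h, scaleR, rmon, MvPolynomial.coe_eval₂Hom, MvPolynomial.eval₂_monomial,
      RingHom.comp_apply, scaleNE_single]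
    rfl
  rw [h2, rmon_mul, baseWeight, weight, zpow_add₀ two_ne_zero]
  congr 1
  · simp
  · ring

lemma scale_smul (r : S.R T) (f : S.holo T) :
    S.scale d (r • f) = S.scaleR d r • S.scale d f := by
  induction r using S.rmon_induction with
  | hadd r s hr hs => rw [add_smul, map_add, hr, hs, map_add, add_smul]
  | hmon w a =>
    rw [scaleR_rmon, rmon_smul, rmon_smul, map_smul, map_mul, baseMon, scale_monH, smul_mul_assoc,
      smul_smul, mul_comm a]
    rfl

lemma scaleR_mem_pow {r : S.R T} {k : ℕ} (hr : r ∈ S.maxIdeal T ^ k) :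
    S.scaleR d r ∈ S.maxIdeal T ^ k := by
  have h1 : S.maxIdeal T ≤ (S.maxIdeal T).comap (S.scaleR d) :=
    S.maxIdeal_le fun w hw => by
      rw [Ideal.mem_comap, scaleR_rmon]
      exact S.rmon_mem_maxIdeal hw _
  have h2 := Ideal.mem_map_of_mem (S.scaleR d) hr
  rw [Ideal.map_pow] at h2
  exact Ideal.pow_right_mono (Ideal.map_le_iff_le_comap.2 h1) k h2

variable (k : ℕ)

/-- The scaling of `ℛ_k`. -/
def scaleRk : S.Rk T k →+* S.Rk T k :=
  Ideal.quotientMap _ (S.scaleR d) fun _ hr => S.scaleR_mem_pow d hr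

lemma scaleRk_toRk (r : S.R T) : S.scaleRk d k (S.toRk T k r) = S.toRk T k (S.scaleR d r) :=
  Ideal.quotientMap_mk

lemma toOk_scale_eq_zero {f : S.holo T} (hf : S.toOk T k f = 0) :
    S.toOk T k (S.scale d f) = 0 := by
  rw [toOk_eq_zero_iff] at hf ⊢
  refine Submodule.smul_induction_on hf (fun r hr f _ => ?_) fun f g hf hg => ?_
  · rw [scale_smul]
    exact Submodule.smul_mem_smul (S.scaleR_mem_pow d hr) Submodule.mem_top
  · rw [map_add]
    exact add_mem hf hg

/-- The scaling of `𝒪(𝒳_k)`. -/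
def scaleOk : S.Ok T k →+* S.Ok T k :=
  (S.toOk T k).liftOfSurjective (S.toOk_surjective T k)
    ⟨(S.toOk T k).comp (S.scale d).toRingHom, fun _ hf => S.toOk_scale_eq_zero d k hf⟩

lemma scaleOk_toOk (f : S.holo T) : S.scaleOk d k (S.toOk T k f) = S.toOk T k (S.scale d f) :=
  (S.toOk T k).liftOfRightInverse_comp_apply _ _ _ f

lemma scaleOk_smul (r : S.Rk T k) (x : S.Ok T k) :
    S.scaleOk d k (r • x) = S.scaleRk d k r • S.scaleOk d k x := by
  obtain ⟨r, rfl⟩ := S.toRk_surjective T k r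
  obtain ⟨f, rfl⟩ := S.toOk_surjective T k x
  rw [toRk_smul_toOk, scaleOk_toOk, scaleOk_toOk, scaleRk_toRk, toRk_smul_toOk, scale_smul]

/-- The scaling of `𝒪(𝒳_k)[[u]]`. -/
def scaleU : PowerSeries (S.Ok T k) →+* PowerSeries (S.Ok T k) :=
  -- The variable `u` has weight `2`, so the element `2` of the torus multiplies it by `2 ^ 2`.
  (PowerSeries.rescale 4).comp (PowerSeries.map (S.scaleOk d k))

/-- The scaling of `ℛ_k[[u]]`. -/
def scaleRku : S.Rku T k →+* S.Rku T k :=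
  (PowerSeries.rescale 4).comp (PowerSeries.map (S.scaleRk d k))

lemma coeff_scaleU (b : PowerSeries (S.Ok T k)) (e : ℕ) :
    PowerSeries.coeff e (S.scaleU d k b) = 4 ^ e * S.scaleOk d k (PowerSeries.coeff e b) := by
  rw [scaleU, RingHom.comp_apply, PowerSeries.coeff_rescale, PowerSeries.coeff_map]

lemma coeff_scaleRku (b : S.Rku T k) (e : ℕ) :
    PowerSeries.coeff e (S.scaleRku d k b) = 4 ^ e * S.scaleRk d k (PowerSeries.coeff e b) := by
  rw [scaleRku, RingHom.comp_apply, PowerSeries.coeff_rescale, PowerSeries.coeff_map]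

lemma scaleU_smul (r : S.Rku T k) (b : PowerSeries (S.Ok T k)) :
    S.scaleU d k (r • b) = S.scaleRku d k r • S.scaleU d k b := by
  rw [Algebra.smul_def, map_mul, Algebra.smul_def]
  congr 1
  ext e
  rw [coeff_scaleU, PowerSeries.algebraMap_apply'', PowerSeries.algebraMap_apply'',
    PowerSeries.coeff_map, PowerSeries.coeff_map, coeff_scaleRku, map_mul, map_pow, map_ofNat,
    Algebra.algebraMap_eq_smul_one, Algebra.algebraMap_eq_smul_one, scaleOk_smul, map_one]

lemma scaleU_toU (f : S.holo T) : S.scaleU d k (S.toU T k f) = S.toU T k (S.scale d f) := by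
  ext e
  rw [coeff_scaleU, toU, toU, PowerSeries.coeff_C, PowerSeries.coeff_C]
  split_ifs with h
  · rw [h, pow_zero, one_mul, scaleOk_toOk]
  · rw [map_zero, mul_zero]

lemma scaleU_derU [Fintype T] (j : Fin n) (b : PowerSeries (S.Ok T k)) :
    S.scaleU d k (S.derU T k j b) = S.derU T k j (S.scaleU d k b) := by
  obtain ⟨f, hf⟩ := S.exists_lift_coeff T k b
  ext e
  have h : PowerSeries.coeff e (S.scaleU d k b) = S.toOk T k (4 ^ e * S.scale d (f e)) := by
    rw [coeff_scaleU, hf, scaleOk_toOk, map_mul, map_pow, map_ofNat]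
  have h4 : (4 : S.holo T) ^ e * S.scale d (f e) = ((4 : ℕ) ^ e) • S.scale d (f e) := by
    rw [nsmul_eq_mul, Nat.cast_pow, Nat.cast_ofNat]
  rw [← extU_relDer, S.coeff_extU _ h, h4, map_nsmul, nsmul_eq_mul, map_mul, map_natCast,
    ← scale_relDer, coeff_scaleU, S.coeff_extU _ (hf e), scaleOk_toOk, Nat.cast_pow, Nat.cast_ofNat]

lemma scaleRku_X : S.scaleRku d k (PowerSeries.X : S.Rku T k) = 4 * PowerSeries.X := by
  ext e
  rw [coeff_scaleRku, PowerSeries.coeff_X]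
  have h : (4 : S.Rku T k) = PowerSeries.C (4 : S.Rk T k) := (map_ofNat PowerSeries.C 4).symm
  rw [h, PowerSeries.coeff_C_mul, PowerSeries.coeff_X]
  split_ifs with h
  · rw [h, pow_one, map_one]
  · rw [map_zero, mul_zero, mul_zero]

end Scaling

end SmoothCompleteFan

end LogLG

end

open scoped TensorProduct

noncomputable section

lemma two_zpow_sub_ne_zero {u v : ℤ} (h : u ≠ v) : (2 : ℂ) ^ u - 2 ^ v ≠ 0 := by
  rw [sub_ne_zero]
  intro h'
  refine h (zpow_right_injective₀ (a := (2 : ℝ)) two_pos (by norm_num) ?_)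
  have h2 : (((2 : ℝ) ^ u : ℝ) : ℂ) = (((2 : ℝ) ^ v : ℝ) : ℂ) := by push_cast; exact h'
  exact_mod_cast h2

/-- Apply `g - 2 ^ a` to remove the term `a`. The other terms are only multiplied by the nonzero
scalars `2 ^ u - 2 ^ a`. -/
lemma eq_zero_of_sum_eigenvectors {M : Type*} [CommRing M] [Algebra ℂ M] (g : Module.End ℂ M)
    (U : Finset ℤ) (x : ℤ → M) (hx : ∀ u, g (x u) = (2 : ℂ) ^ u • x u) (h : ∑ u ∈ U, x u = 0) :
    ∀ u ∈ U, x u = 0 := by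
  induction U using Finset.induction_on generalizing x with
  | empty => simp
  | insert a U ha ih =>
    have h1 : ∑ u ∈ U, ((2 : ℂ) ^ u - 2 ^ a) • x u = 0 := by
      have h2 := congrArg (fun y => g y - (2 : ℂ) ^ a • y) h
      simp only [map_sum, Finset.smul_sum, ← Finset.sum_sub_distrib, hx, ← sub_smul, map_zero,
        smul_zero, sub_zero] at h2
      rwa [Finset.sum_insert ha, sub_self, zero_smul, zero_add] at h2
    have h3 := ih (fun u => ((2 : ℂ) ^ u - 2 ^ a) • x u)
      (fun u => by rw [map_smul, hx, smul_comm]) h1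
    have h4 : ∀ u ∈ U, x u = 0 := fun u hu => (smul_eq_zero.1 (h3 u hu)).resolve_left
      (two_zpow_sub_ne_zero fun h => ha (h ▸ hu))
    intro u hu
    rcases Finset.mem_insert.1 hu with rfl | hu
    · rwa [Finset.sum_insert ha, Finset.sum_eq_zero h4, add_zero] at h
    · exact h4 u hu

/-- A sum of eigenvectors that is an eigenvector is one of the summands. -/
lemma sum_eigenvectors_eq {M : Type*} [CommRing M] [Algebra ℂ M] (g : Module.End ℂ M)
    (x : ℤ → M) (hx : ∀ u, g (x u) = (2 : ℂ) ^ u • x u) (U : Finset ℤ) (v : ℤ)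
    (h : g (∑ u ∈ U, x u) = (2 : ℂ) ^ v • ∑ u ∈ U, x u) :
    ∑ u ∈ U, x u = if v ∈ U then x v else 0 := by
  have h1 : ∑ u ∈ U, ((2 : ℂ) ^ u - 2 ^ v) • x u = 0 := by
    rw [map_sum, Finset.smul_sum, ← sub_eq_zero, ← Finset.sum_sub_distrib] at h
    simpa only [hx, ← sub_smul] using h
  have h2 := eq_zero_of_sum_eigenvectors g U (fun u => ((2 : ℂ) ^ u - 2 ^ v) • x u)
    (fun u => by rw [map_smul, hx, smul_comm]) h1
  have h3 : ∀ u ∈ U, u ≠ v → x u = 0 := fun u hu huv =>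
    (smul_eq_zero.1 (h2 u hu)).resolve_left (two_zpow_sub_ne_zero huv)
  split_ifs with hv
  · exact Finset.sum_eq_single_of_mem v hv h3
  · exact Finset.sum_eq_zero fun u hu => h3 u hu fun h => hv (h ▸ hu)

namespace LogLG

namespace SmoothCompleteFan

variable {n : ℕ} {ι : Type} [Fintype ι] [DecidableEq ι] (S : SmoothCompleteFan n ι)

/-! ### Exact forms of top degree and their scaling -/

section Exact

variable (T : Type) (k : ℕ) (F : S.holo T)

/-- The map whose image consists of the coefficients of the volume form in exact forms. -/
def divergence : (Fin n → PowerSeries (S.Ok T k)) →ₗ[S.Rku T k] PowerSeries (S.Ok T k) :=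
  ∑ j, S.nabla T k F j ∘ₗ LinearMap.proj j

lemma divergence_apply (b : Fin n → PowerSeries (S.Ok T k)) :
    S.divergence T k F b = ∑ j, S.nabla T k F j (b j) := by
  rw [divergence, LinearMap.sum_apply]
  rfl

/-- The scaling is defined on functions rather than on forms. Exactness in top degree is therefore
rephrased as a condition on the volume coefficient; `form_divergence_mem` is the converse. -/
lemma top_twist_mem (z : S.Forms T k) :
    S.top T k (S.twist T k F z) ∈ LinearMap.range (S.divergence T k F) := by
  induction z using S.forms_induction with
  | h0 => simp only [map_zero, zero_mem]
  | hadd x y hx hy => simp only [map_add]; exact add_mem hx hy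
  | hform b ω =>
    refine ⟨fun j => (S.extBasis T k).coord Finset.univ
      (ExteriorAlgebra.ι (S.Rku T k) (Pi.single j 1) * ω) • b, ?_⟩
    rw [divergence_apply, twist_form, map_sum]
    exact Finset.sum_congr rfl fun j _ => by rw [top_form, map_smul]

lemma form_divergence_mem (b : Fin n → PowerSeries (S.Ok T k)) :
    S.form T k (S.divergence T k F b) (S.vol T k) ∈ LinearMap.range (S.twist T k F) := by
  rw [divergence_apply, ← formHom_apply, map_sum, LinearMap.sum_apply]
  refine sum_mem fun j _ => ?_
  -- The contraction of `Ω` with the `j`-th coordinate has wedge product `δ_{lj} Ω` with `d log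
  -- e_l`, so its twisted differential retains only `nabla j`.
  refine ⟨S.form T k (b j) (ExteriorAlgebra.contract (LinearMap.proj j) (S.vol T k)), ?_⟩
  have h : ∀ l : Fin n, ExteriorAlgebra.ι (S.Rku T k) (Pi.single l 1 : Fin n → S.Rku T k) *
      ExteriorAlgebra.contract (LinearMap.proj j) (S.vol T k) =
      if l = j then S.vol T k else 0 := by
    intro l
    have h1 := ExteriorAlgebra.contract_ι_mul (LinearMap.proj j : Module.Dual (S.Rku T k) _)
      (Pi.single l 1) (S.vol T k)
    rw [S.eq_zero_of_mem_succ T k (ExteriorAlgebra.ι_mul_mem _ (S.dlogs_mem T k _)), map_zero] at h1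
    rw [← sub_eq_zero.1 h1.symm, LinearMap.proj_apply, Pi.single_apply]
    split_ifs with h2 h3 h3
    · rw [one_smul]
    · exact (h3 h2.symm).elim
    · exact (h2 h3.symm).elim
    · rw [zero_smul]
  rw [twist_form]
  simp only [h]
  rw [Finset.sum_eq_single_of_mem j (Finset.mem_univ j), if_pos rfl, formHom_apply]
  intro l _ hl
  rw [if_neg hl, ← formHom_apply, map_zero]

variable {T F}

/-- Both parts of `nabla` pick up the factor `4`: the first because `F` has weight `2`, the second
because `u` has. -/
lemma scaleU_nabla [Fintype T] {d : T → ℤ} (hF : S.scale d F = 4 * F) (j : Fin n)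
    (b : PowerSeries (S.Ok T k)) :
    S.scaleU d k (S.nabla T k F j b) = S.nabla T k F j ((4 : S.Rku T k) • S.scaleU d k b) := by
  have h4 : ∀ x : PowerSeries (S.Ok T k), (4 : S.Rku T k) • x = 4 * x := fun x => by
    rw [Algebra.smul_def, map_ofNat]
  have h1 : S.scale d (S.relDer T j F) = 4 * S.relDer T j F := by
    have e4 : ∀ f : S.holo T, 4 * f = (4 : ℕ) • f := fun f => by simp
    rw [scale_relDer, hF, e4, e4, map_nsmul]
  rw [map_smul, nabla, LinearMap.add_apply, LinearMap.add_apply, extU_mulLeft, extU_mulLeft, map_add,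
    map_mul, scaleU_toU, h1, LinearMap.smul_apply, LinearMap.smul_apply, scaleU_smul, scaleRku_X,
    scaleU_derU, smul_add, mul_smul, h4 (_ * _)]
  congr 1
  rw [toU, toU, map_mul, map_mul, map_ofNat, map_ofNat, mul_assoc]

lemma scaleU_divergence_mem [Fintype T] {d : T → ℤ} (hF : S.scale d F = 4 * F)
    {x : PowerSeries (S.Ok T k)} (hx : x ∈ LinearMap.range (S.divergence T k F)) :
    S.scaleU d k x ∈ LinearMap.range (S.divergence T k F) := by
  obtain ⟨b, rfl⟩ := hx
  refine ⟨fun j => (4 : S.Rku T k) • S.scaleU d k (b j), ?_⟩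
  rw [divergence_apply, divergence_apply, map_sum]
  exact Finset.sum_congr rfl fun j _ => (S.scaleU_nabla k hF j _).symm

end Exact

/-! ### Homogeneous elements as eigenvectors of the scaling -/

section Eigen

variable {T : Type} (d : T → ℤ) (k : ℕ)

/-- A complex number as an element of `ℛ_k[[u]]`. -/
def scal (T : Type) (k : ℕ) (c : ℂ) : S.Rku T k := PowerSeries.C (S.toRk T k (S.rmon 0 c))

lemma toOk_smul (c : ℂ) (f : S.holo T) :
    S.toOk T k (c • f) = S.toRk T k (S.rmon 0 c) • S.toOk T k f := by
  have h1 : S.baseMon (0 : S.BaseExp T) = 1 := Subtype.ext (funext fun x => S.mon_zero T x)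
  rw [toRk_smul_toOk, rmon_smul, h1, one_mul]

lemma coord_dlogs_ne {p : ℕ} (hp : p ≠ n) (s : Fin p → Fin n) :
    (S.extBasis T k).coord Finset.univ (S.dlogs T k s) = 0 := by
  have h1 : (S.extBasis T k).coord Finset.univ ∘ₗ ExteriorAlgebra.degreeProj p = 0 := by
    refine (S.extBasis T k).ext fun t => ?_
    rw [LinearMap.comp_apply, ExteriorAlgebra.degreeProj_of_mem (S.extBasis_mem T k t)]
    split_ifs with h
    · rw [Module.Basis.coord_apply, Module.Basis.repr_self, Finsupp.single_eq_of_ne]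
      · rfl
      · rintro rfl
        exact hp (by simpa using h)
    · rw [map_zero]; rfl
  have h2 := congrArg (fun g => g (S.dlogs T k s)) h1
  simpa only [LinearMap.comp_apply, ExteriorAlgebra.degreeProj_of_mem (S.dlogs_mem T k s), if_pos,
    LinearMap.zero_apply] using h2

lemma exists_dlogs_eq_zsmul (s : Fin n → Fin n) : ∃ c : ℤ, S.dlogs T k s = c • S.vol T k := by
  by_cases hs : Function.Injective s
  · let g : Equiv.Perm (Fin n) := Equiv.ofBijective s (Finite.injective_iff_bijective.1 hs)
    refine ⟨(Equiv.Perm.sign g : ℤ), ?_⟩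
    have := AlternatingMap.map_perm (ExteriorAlgebra.ιMulti (S.Rku T k) n)
      (fun a => (Pi.single a 1 : Fin n → S.Rku T k)) g
    exact this
  · refine ⟨0, ?_⟩
    rw [zero_smul]
    refine AlternatingMap.map_eq_zero_of_not_injective _ _ fun h => hs fun a b hab => h ?_
    simp only [hab]

/-- Only wedges of `n` factors reach the volume coefficient, and for them the shift `2 (n - p)` is
zero. The factor `4 ^ e` compensates the weight `w - 2 e` of the coefficient of `u ^ e`. -/
lemma scaleU_top {w : ℤ} {η : S.Forms T k} (hη : η ∈ S.formWeight T d k w) :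
    S.scaleU d k (S.top T k η) = S.scal T k (2 ^ w) • S.top T k η := by
  induction hη using AddSubgroup.closure_induction with
  | mem η hη =>
    obtain ⟨p, s, b, hb, rfl⟩ := hη
    by_cases hp : p = n
    · subst hp
      obtain ⟨c, hc⟩ := S.exists_dlogs_eq_zsmul k s (T := T)
      rw [hc, ← formHom_apply, map_zsmul, map_zsmul, formHom_apply, top_form_vol, map_zsmul,
        smul_comm]
      congr 1
      ext e
      obtain ⟨g, hg, hge⟩ := hb e
      rw [coeff_scaleU, hge, scaleOk_toOk, scale_of_mem_holoWeight d hg, scal, coeff_C_smul, hge,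
        ← toOk_smul]
      have h4 : (4 : S.Ok T k) ^ e = S.toOk T k (4 ^ e) := by rw [map_pow, map_ofNat]
      have h5 : (4 : S.holo T) ^ e = algebraMap ℂ _ (4 ^ e) := by rw [map_pow, map_ofNat]
      rw [h4, ← map_mul, h5, ← Algebra.smul_def, smul_smul, sub_self, mul_zero, sub_zero]
      congr 2
      rw [zpow_sub₀ two_ne_zero, zpow_mul, zpow_natCast]
      have h6 : (2 : ℂ) ^ (2 : ℤ) = 4 := by norm_num
      rw [h6, mul_div_cancel₀]
      exact pow_ne_zero _ (by norm_num)
    · rw [top_form, S.coord_dlogs_ne k hp, zero_smul, map_zero, smul_zero]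
  | zero => simp only [map_zero, smul_zero]
  | add x y _ _ hx hy => simp only [map_add, smul_add, hx, hy]
  | neg x _ hx => simp only [map_neg, smul_neg, hx]

instance : Algebra ℂ (S.Rk T k) :=
  inferInstanceAs (Algebra ℂ (S.R T ⧸ S.maxIdeal T ^ (k + 1)))

lemma smul_Rk (c : ℂ) (x : S.Rk T k) : c • x = S.toRk T k (S.rmon 0 c) * x := by
  rw [Algebra.smul_def]
  congr 1

lemma baseWeight_zero : S.baseWeight d (0 : S.BaseExp T) = 0 := by
  simp [baseWeight, weight]

lemma smul_toRk_rmon (w : S.BaseExp T) (c a : ℂ) :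
    c • S.toRk T k (S.rmon w a) = S.toRk T k (S.rmon w (c * a)) := by
  rw [smul_Rk, ← map_mul, rmon_mul, zero_add]

/-- The scaling of `ℛ_k` as a linear map. -/
def scaleRkLin : Module.End ℂ (S.Rk T k) where
  toFun := S.scaleRk d k
  map_add' := map_add _
  map_smul' c x := by
    rw [smul_Rk, map_mul, scaleRk_toRk, scaleR_rmon, baseWeight_zero, zpow_zero, one_mul,
      RingHom.id_apply, smul_Rk]

/-- A polynomial representative splits into homogeneous parts, whose images in `ℛ_k` are
eigenvectors for distinct powers of `2`. All parts except the one of weight `v` vanish in `ℛ_k`. -/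
lemma mem_RkWeight_of_scaleRk_eq {v : ℤ} {x : S.Rk T k}
    (hx : S.scaleRk d k x = (2 : ℂ) ^ v • x) : x ∈ S.RkWeight T d k v := by
  classical
  obtain ⟨r, rfl⟩ := S.toRk_surjective T k x
  obtain ⟨s, hs⟩ := S.sum_rmon r
  let X : ℤ → S.Rk T k := fun u =>
    ∑ w ∈ s with S.baseWeight d w = u, S.toRk T k (S.rmon w (S.rcoeff r w))
  have hX : ∀ u, S.scaleRkLin d k (X u) = (2 : ℂ) ^ u • X u := by
    intro u
    change S.scaleRkLin d k (∑ w ∈ s with S.baseWeight d w = u, _) = _ • ∑ w ∈ s with _, _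
    rw [map_sum, Finset.smul_sum]
    refine Finset.sum_congr rfl fun w hw => ?_
    rw [smul_toRk_rmon, ← (Finset.mem_filter.1 hw).2, ← scaleR_rmon, ← scaleRk_toRk]
    rfl
  have hsum : S.toRk T k r = ∑ u ∈ s.image (S.baseWeight d), X u := by
    conv_lhs => rw [hs, map_sum]
    exact (Finset.sum_fiberwise_of_maps_to (fun w hw => Finset.mem_image_of_mem _ hw) _).symm
  rw [hsum] at hx ⊢
  rw [sum_eigenvectors_eq (S.scaleRkLin d k) X hX _ v hx]
  split_ifs
  · refine sum_mem fun w hw => AddSubgroup.subset_closure ?_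
    exact ⟨w.1, w.2, _, (Finset.mem_filter.1 hw).2, rfl⟩
  · exact zero_mem _

lemma mem_RkuWeight_of_scaleRku_eq {v : ℤ} {r : S.Rku T k}
    (hr : S.scaleRku d k r = S.scal T k (2 ^ v) * r) : r ∈ S.RkuWeight T d k v := by
  intro e
  apply mem_RkWeight_of_scaleRk_eq
  have h := congrArg (PowerSeries.coeff e) hr
  rw [coeff_scaleRku, scal, PowerSeries.coeff_C_mul, ← smul_Rk] at h
  have h4 : (4 : S.Rk T k) ^ e * S.scaleRk d k (PowerSeries.coeff e r) =
      ((4 : ℂ) ^ e) • S.scaleRk d k (PowerSeries.coeff e r) := by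
    rw [Algebra.smul_def, map_pow, map_ofNat]
  have h0 : ((4 : ℂ) ^ e) ≠ 0 := pow_ne_zero _ (by norm_num)
  have h6 : (2 : ℂ) ^ (2 : ℤ) = 4 := by norm_num
  rw [h4] at h
  rw [zpow_sub₀ two_ne_zero, zpow_mul, zpow_natCast, h6, div_eq_inv_mul, mul_smul, ← h,
    inv_smul_smul₀ h0]

end Eigen

/-! ### Homogeneous holomorphic functions -/

section HoloWeight

variable {S} {T : Type} {d : T → ℤ}

lemma holoWeight_add {w : ℤ} {f g : S.holo T} (hf : f ∈ S.holoWeight T d w)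
    (hg : g ∈ S.holoWeight T d w) : f + g ∈ S.holoWeight T d w := by
  obtain ⟨c, hc, hcs⟩ := hf
  obtain ⟨c', hc', hcs'⟩ := hg
  refine ⟨c + c', fun q hq => ?_, fun x => by simpa [add_mul] using (hcs x).add (hcs' x)⟩
  by_cases h : c q = 0
  · exact hc' q fun h' => hq (by simp [h, h'])
  · exact hc q h

lemma holoWeight_smul_monH {w : ℤ} (a : ℂ) {q : S.Pphi × (T →₀ ℕ)}
    (hq : weight T d q.1.1 q.2 = w) : a • S.monH T q ∈ S.holoWeight T d w := by
  classical
  refine ⟨Pi.single q a, fun r hr => ?_, fun x => ?_⟩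
  · by_cases h : r = q
    · rw [h, hq]
    · simp [h] at hr
  · have := hasSum_single (f := fun r => (Pi.single q a : _ → ℂ) r * S.mon T r x) q
      (fun r hr => by simp [hr])
    rw [Pi.single_eq_same] at this
    exact this

lemma holoWeight_zero (w : ℤ) : (0 : S.holo T) ∈ S.holoWeight T d w :=
  ⟨0, fun q hq => (hq rfl).elim, fun x => by simp [hasSum_zero]⟩

lemma holoWeight_neg {w : ℤ} {f : S.holo T} (hf : f ∈ S.holoWeight T d w) :
    -f ∈ S.holoWeight T d w := by
  obtain ⟨c, hc, hcs⟩ := hf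
  exact ⟨-c, fun q hq => hc q fun h => hq (by simp [h]), fun x => by simpa using (hcs x).neg⟩

/-- Multiples of `z^{φ(m)}` by homogeneous elements of the base are homogeneous. -/
lemma exists_smul_theta_eq {k : ℕ} {v : ℤ} {r : S.Rk T k} (hr : r ∈ S.RkWeight T d k v)
    (m : Fin n → ℤ) : ∃ g ∈ S.holoWeight T d (v + 2 * ∑ i, S.tphi m i),
      r • S.toOk T k (S.theta m) = S.toOk T k g := by
  induction hr using AddSubgroup.closure_induction with
  | mem r hr =>
    obtain ⟨p, α, c, hw, rfl⟩ := hr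
    refine ⟨c • S.monH T (S.key m (p, α)), holoWeight_smul_monH c ?_, ?_⟩
    · rw [key_fst, key_snd, ← hw]
      simp only [weight, Pi.add_apply, Finset.sum_add_distrib]
      ring
    · change S.toRk T k (S.rmon (p, α) c) • _ = _
      rw [toRk_smul_toOk, rmon_smul]
      congr 2
      refine Subtype.ext (funext fun x => ?_)
      change S.mon T _ x * S.mon T _ x = S.mon T _ x
      rw [← mon_add, baseExp_add_key, add_zero]
  | zero => exact ⟨0, holoWeight_zero _, by rw [zero_smul, map_zero]⟩
  | add x y _ _ hx hy =>
    obtain ⟨f, hf, hxf⟩ := hx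
    obtain ⟨g, hg, hyg⟩ := hy
    exact ⟨f + g, holoWeight_add hf hg, by rw [add_smul, hxf, hyg, map_add]⟩
  | neg x _ hx =>
    obtain ⟨f, hf, hxf⟩ := hx
    exact ⟨-f, holoWeight_neg hf, by rw [neg_smul, hxf, map_neg]⟩

end HoloWeight

/-! ### Weights of classes and of their coordinates -/

section Main

variable {S} {μ : ℕ} {σ : Fin μ → Finset ι} (hS : S.IsProjective) (hσ : S.IsGoodOrder σ) (k : ℕ)

lemma two_mul_sum_tphi (hσ : S.IsGoodOrder σ) (i : Fin μ) :
    2 * ∑ r, S.tphi (S.raysSum (tau σ n i)) r = phiDeg σ n i := by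
  rw [S.tphi_raysSum (tau_mem_cones hσ i), phiDeg]
  simp

lemma scale_phi (hσ : S.IsGoodOrder σ) (i : Fin μ) :
    S.scale (paramDeg σ n) (S.phi σ i) = (2 : ℂ) ^ phiDeg σ n i • S.phi σ i := by
  rw [phi_eq_theta hσ, theta, scale_monH, weight, key_fst, key_snd, ← two_mul_sum_tphi hσ]
  simp

/-- Each `z_s` has weight `2`, and so has `t_i φ_i` by the choice of the weight of `t_i`. -/
lemma scale_superF (hσ : S.IsGoodOrder σ) :
    S.scale (paramDeg σ n) (S.superF σ) = 4 * S.superF σ := by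
  have h4 : (4 : S.holo (Param σ n)) = algebraMap ℂ _ 4 := (map_ofNat _ 4).symm
  rw [h4, ← Algebra.smul_def, superF, map_add, map_sum, map_sum, smul_add, Finset.smul_sum,
    Finset.smul_sum]
  congr 1
  · refine Finset.sum_congr rfl fun s _ => ?_
    rw [z, scale_monH]
    congr 1
    simp [weight]
    norm_num
  · refine Finset.sum_congr rfl fun i _ => ?_
    rw [map_mul, scale_phi hσ, scale_monH, smul_mul_smul_comm, ← zpow_add₀ two_ne_zero]
    congr 1
    simp [weight, paramDeg]
    norm_num

lemma phiForm_smul_mem_formWeight (hσ : S.IsGoodOrder σ) {w : ℤ} {i : Fin μ}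
    {r : S.Rku (Param σ n) k}
    (hr : r ∈ S.RkuWeight (Param σ n) (paramDeg σ n) k (w - phiDeg σ n i)) :
    r • S.phiForm σ k i ∈ S.formWeight (Param σ n) (paramDeg σ n) k w := by
  refine AddSubgroup.subset_closure ⟨n, id, r • S.toU (Param σ n) k (S.phi σ i), fun e => ?_,
    smul_phiForm k r i⟩
  obtain ⟨g, hg, hge⟩ := exists_smul_theta_eq (hr e) (S.raysSum (tau σ n i))
  refine ⟨g, ?_, ?_⟩
  · rw [two_mul_sum_tphi hσ] at hg
    convert hg using 1
    ring_nf
  · rw [toU, Algebra.smul_def, PowerSeries.algebraMap_apply'',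
      PowerSeries.coeff_mul_C, PowerSeries.coeff_map, ← Algebra.smul_def, phi_eq_theta hσ, hge]

lemma scal_mul {T : Type} (a b : ℂ) : S.scal T k (a * b) = S.scal T k a * S.scal T k b := by
  rw [scal, scal, scal, ← map_mul, ← map_mul, rmon_mul, add_zero]

lemma scal_one {T : Type} : S.scal T k 1 = 1 := by
  have h : S.rmon (0 : S.BaseExp T) 1 = 1 := rfl
  rw [scal, h, map_one, map_one]

/-- The cocycle itself is homogeneous, but the exact correction `z` need not be. Comparing the
rescaled expansion of the volume coefficient with `2 ^ w` times the original one shows that `∑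
(scale(r_i) 2 ^ deg φ_i - 2 ^ w r_i) φ_i Ω` is exact. Independence of the classes then makes every
coefficient vanish. -/
lemma mem_RkuWeight_of_mem_formWeight (hS : S.IsProjective) (hσ : S.IsGoodOrder σ) {w : ℤ}
    {r : Fin μ → S.Rku (Param σ n) k} {η z : S.Forms (Param σ n) k}
    (hη : η ∈ S.formWeight (Param σ n) (paramDeg σ n) k w)
    (h : η = ∑ i, r i • S.phiForm σ k i + S.twist (Param σ n) k (S.superF σ) z) (i : Fin μ) :
    r i ∈ S.RkuWeight (Param σ n) (paramDeg σ n) k (w - phiDeg σ n i) := by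
  have h1 : S.top (Param σ n) k η = ∑ i, r i • S.toU (Param σ n) k (S.phi σ i) +
      S.top (Param σ n) k (S.twist (Param σ n) k (S.superF σ) z) := by
    rw [h, map_add, map_sum]
    simp only [smul_phiForm, top_form_vol]
  have h2 := S.scaleU_top (paramDeg σ n) k hη
  have hz := S.top_twist_mem (Param σ n) k (S.superF σ) z
  have hz' := S.scaleU_divergence_mem k (scale_superF hσ) hz
  generalize S.top (Param σ n) k (S.twist (Param σ n) k (S.superF σ) z) = y at h1 hz hz'
  have hphi : ∀ i, S.scaleU (paramDeg σ n) k (S.toU (Param σ n) k (S.phi σ i)) =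
      S.scal (Param σ n) k (2 ^ phiDeg σ n i) • S.toU (Param σ n) k (S.phi σ i) := by
    intro i
    ext e
    rw [scaleU_toU, scale_phi hσ, scal, coeff_C_smul, toU, toU, PowerSeries.coeff_C,
      PowerSeries.coeff_C]
    split_ifs
    · rw [toOk_smul]
    · rw [smul_zero]
  rw [h1, map_add, map_sum] at h2
  simp only [scaleU_smul, hphi, smul_smul, smul_add, Finset.smul_sum] at h2
  have h3 : ∑ i, (S.scaleRku (paramDeg σ n) k (r i) * S.scal (Param σ n) k (2 ^ phiDeg σ n i) -
      S.scal (Param σ n) k (2 ^ w) * r i) • S.toU (Param σ n) k (S.phi σ i) ∈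
      LinearMap.range (S.divergence (Param σ n) k (S.superF σ)) := by
    simp only [sub_smul, Finset.sum_sub_distrib]
    have h4 := sub_mem (Submodule.smul_mem _ (S.scal (Param σ n) k (2 ^ w)) hz) hz'
    convert h4 using 1
    rw [sub_eq_sub_iff_add_eq_add, h2, add_comm]
  obtain ⟨b, hb⟩ := h3
  have h4 := S.form_divergence_mem (Param σ n) k (S.superF σ) b
  rw [hb, ← formHom_apply, map_sum, LinearMap.sum_apply] at h4
  have h5 := eq_zero_of_mem_range hS hσ k (r := fun i =>
    S.scaleRku (paramDeg σ n) k (r i) * S.scal (Param σ n) k (2 ^ phiDeg σ n i) -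
      S.scal (Param σ n) k (2 ^ w) * r i) (by
      rw [Finset.sum_congr rfl fun i _ => smul_phiForm k _ i]
      exact h4) i
  refine S.mem_RkuWeight_of_scaleRku_eq _ k ?_
  have h6 : S.scal (Param σ n) k (2 ^ phiDeg σ n i) * S.scal (Param σ n) k (2 ^ (-phiDeg σ n i)) =
      1 := by
    rw [← scal_mul, ← zpow_add₀ two_ne_zero, add_neg_cancel, zpow_zero, scal_one]
  calc S.scaleRku (paramDeg σ n) k (r i)
      = S.scaleRku (paramDeg σ n) k (r i) * S.scal (Param σ n) k (2 ^ phiDeg σ n i) *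
          S.scal (Param σ n) k (2 ^ (-phiDeg σ n i)) := by rw [mul_assoc, h6, mul_one]
    _ = S.scal (Param σ n) k (2 ^ w) * r i * S.scal (Param σ n) k (2 ^ (-phiDeg σ n i)) := by
      rw [sub_eq_zero.1 h5]
    _ = S.scal (Param σ n) k (2 ^ (w - phiDeg σ n i)) * r i := by
      rw [sub_eq_add_neg, zpow_add₀ two_ne_zero, scal_mul]
      ring

/-- For the converse direction, the combination of the `φ_i Ω` with homogeneous coefficients is
itself a cocycle of weight `w` representing the class. -/
lemma mem_cohWeight_iff (w : ℤ) (h : S.Hodge σ k) :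
    h ∈ S.cohWeight (Param σ n) (paramDeg σ n) k (S.superF σ) w ↔
      ∀ i, (phiBasis hS hσ k).repr h i ∈
        S.RkuWeight (Param σ n) (paramDeg σ n) k (w - phiDeg σ n i) := by
  have h0 := (phiBasis hS hσ k).sum_repr h
  simp only [phiBasis_apply] at h0
  rw [sum_smul_phiClass k _ (sum_smul_phiForm_mem_ker k _)] at h0
  constructor
  · rintro ⟨η, hη, hη'⟩ i
    rw [hη', Submodule.Quotient.eq'] at h0
    obtain ⟨z, hz⟩ := h0
    refine mem_RkuWeight_of_mem_formWeight k hS hσ hη (z := z) ?_ i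
    change S.twist (Param σ n) k (S.superF σ) z = -(∑ i, _ • S.phiForm σ k i) + η.1 at hz
    rw [hz, hη', add_neg_cancel_left]
  · intro hr
    have hmem : ∑ i, (phiBasis hS hσ k).repr h i • S.phiForm σ k i ∈
        S.formWeight (Param σ n) (paramDeg σ n) k w :=
      sum_mem fun i _ => phiForm_smul_mem_formWeight k hσ (hr i)
    exact ⟨_, hmem, h0.symm⟩

end Main

end SmoothCompleteFan

end LogLG

end

open LogLG LogLG.SmoothCompleteFan in
theorem mainTheorem9 {n : ℕ} {ι : Type} [Fintype ι] [DecidableEq ι]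
    (S : SmoothCompleteFan n ι) (hS : S.IsProjective)
    {μ : ℕ} (σ : Fin μ → Finset ι) (hσ : S.IsGoodOrder σ) (k : ℕ) :
    ∃ b : Module.Basis (Fin μ) (S.Rku (Param σ n) k) (S.Hodge σ k),
      (∀ i, ∃ hi : S.phiForm σ k i ∈ LinearMap.ker (S.twist (Param σ n) k (S.superF σ)),
        b i = Submodule.Quotient.mk ⟨S.phiForm σ k i, hi⟩) ∧
      ∀ (w : ℤ) (h : S.Hodge σ k),
        h ∈ S.cohWeight (Param σ n) (paramDeg σ n) k (S.superF σ) w ↔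
          ∀ i, b.repr h i ∈ S.RkuWeight (Param σ n) (paramDeg σ n) k (w - phiDeg σ n i) := by
  refine ⟨phiBasis hS hσ k, fun i => ⟨phiForm_mem_ker k i, ?_⟩, mem_cohWeight_iff hS hσ k⟩
  rw [phiBasis_apply]
  rfl
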